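/- Let $n\ge 1$ and $\beta\in\mathbb C$. Let $\mathsf{aTL}_n(\beta)$ be the affine Temperley–Lieb algebra with generators $e_0,\dots,e_{n-1},\Omega,\Omega^{-1}$ (indices mod $n$) and relations $$e_j^2=\beta e_j,\quad e_je_{j\pm1}e_j=e_j,\quad e_ie_j=e_je_i\ (i\neq j,\,j\pm1),\quad \Omega e_j\Omega^{-1}=e_{j-1},\quad \Omega\Omega^{-1}=\Omega^{-1}\Omega=1,\quad \Omega^2e_1=e_{n-1}\cdots e_2e_1,$$ where the relations $e_je_{j\pm1}e_j=e_j$ are omitted for $n=2$, and for $n=1$ there are only the generators $\Omega^{\pm1}$ (one reads $e_0=0$ below). Let $\mathsf{pTL}_n(\beta)$ be the algebra with generators $e_0,\dots,e_{n-1}$ and the relations among them only. For $0\le d\le n$, $d\equiv n \bmod 2$ and $z\in\mathbb C^\times$, let $\mathsf W_{n,d,z}$ be the standard module, with basis the periodic link states on $n$ nodes with $d$ defects and the diagrammatic action, in which contractible loops have weight $\beta$, non-contractible loops (possible only for $d=0$) have weight $z+z^{-1}$, the connection of two defects gives zero, and a defect that crosses the periodic boundary towards the left (right) as it goes down gives a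 factor $z$ ($z^{-1}$). It is an $\mathsf{aTL}_n(\beta)$-module and, by restriction, a $\mathsf{pTL}_n(\beta)$-module. Put $E=e_0e_2\cdots e_{n-2}$ and $F=e_1e_3\cdots e_{n-1}$ for $n$ even. For $\alpha,\gamma\in\mathbb C$ define the uncoiled algebras as the following quotients. * $n$ odd: $\mathsf{uaTL}_n(\beta,\gamma)=\mathsf{aTL}_n(\beta)/(\Omega^n=\gamma)$ and $\mathsf{upTL}_n(\beta,\gamma)=\mathsf{pTL}_n(\beta)/(e_0(e_{n-1}\cdots e_1e_0)^{n-2}=\gamma^2e_0)$ (for $n=1$ the last relation is void). * $n$ even, $\alpha$-type: $\mathsf{uaTL}^{(1)}_n(\beta,\alpha)=\mathsf{aTL}_n(\beta)/(E\Omega E=\alpha E,\ \Omega^n=1)$ and $\mathsf{upTL}^{(1)}_n(\beta,\alpha)=\mathsf{pTL}_n(\beta)/(EFE=\alpha^2E,\ e_0(e_{n-1}\cdots e_1e_0)^{(n-2)/2}=e_0)$. * $n$ even, $\gamma$-type: $\mathsf{uaTL}^{(2)}_n(\beta,\gamma)=\mathsf{aTL}_n(\beta)/(E=0,\ \Omega^n=\gamma)$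 and $\mathsf{upTL}^{(2)}_n(\beta,\gamma)=\mathsf{pTL}_n(\beta)/(E=0,\ e_0(e_{n-1}\cdots e_1e_0)^{(n-2)/2}=\gamma e_0)$. Let $\gamma^{1/d}$ denote any fixed $d$-th root of $\gamma$. The standard modules whose action descends to these quotients are the following. Throughout, $d\equiv n\bmod 2$ and $d\le n$. 1. $\mathsf{uaTL}_n(\beta,\gamma)$, $n$ odd: those with $z^d=\gamma$, that is, $\mathsf W_{n,d,\gamma^{1/d}e^{2\pi i r/d}}$ with $0\le r<d$, $d=1,3,\dots,n$. 2. $\mathsf{upTL}_n(\beta,\gamma)$, $n$ odd: those with $d=n$ or $z^d=\pm\gamma$. 3. $\mathsf{uaTL}^{(1)}_n(\beta,\alpha)$, $n$ even: the modules $\mathsf W_{n,0,z}$ with $z+z^{-1}=\alpha$, the modules with $d>0$ and $z^d=1$, that is, $\mathsf W_{n,d,e^{2\pi i r/d}}$ with $0\le r<d$, $d=2,4,\dots,n$, and, if $\beta=0$, also $\mathsf W_{n,0,\pm i}$ (whatever $\alpha$ is). 4. $\mathsf{upTL}^{(1)}_n(\beta,\alpha)$, $n$ even: the modules $\mathsf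 W_{n,0,z}$ with $z+z^{-1}=\pm\alpha$, those with $d=n$, those with $d>0$ and $z^d=1$, and, if $\beta=0$, also $\mathsf W_{n,0,\pm i}$. 5. $\mathsf{uaTL}^{(2)}_n(\beta,\gamma)$, $n$ even: those with $d>0$ and $z^d=\gamma$, that is, $\mathsf W_{n,d,\gamma^{1/d}e^{2\pi i r/d}}$ with $0\le r<d$, $d=2,4,\dots,n$, and, if $\beta=0$ and $\gamma=1$, also $\mathsf W_{n,0,\pm i}$. 6. $\mathsf{upTL}^{(2)}_n(\beta,\gamma)$, $n$ even: those with $d=n$, those with $d>0$ and $z^d=\gamma$, and, if $\beta=0$ and ($\gamma=1$ or $n=2$), also $\mathsf W_{n,0,\pm i}$. (For $\gamma=0$ there are no labels $z\in\mathbb C^\times$ with $z^d=\gamma$, and the lists in terms of $\gamma^{1/d}$ are empty.) In the periodic cases 2, 4 and 6, each of these modules is isomorphic over $\mathsf{pTL}_n(\beta)$ to a module with the same $d$ in the following list, the label $z$ being replaced by $z$ or $-z$ if $d<n$ and by $1$ if $d=n$; every module in the list descends; and for $d>0$ the list never contains both $\mathsf W_{n,d,z}$ and $\mathsf W_{n,d,-z}$: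 * case 2: $\mathsf W_{n,n,1}$ and $\mathsf W_{n,d,\gamma^{1/d}e^{\pi i r/d}}$ with $0\le r<d$, $d=1,3,\dots,n-2$; * case 4: $\mathsf W_{n,0,z}$ with $z+z^{-1}=\alpha$, $\mathsf W_{n,n,1}$, $\mathsf W_{n,d,e^{2\pi i r/d}}$ with $0\le r<\frac d2$, $d=2,4,\dots,n-2$, and, if $\beta=0$, $\mathsf W_{n,0,\pm i}$; * case 6: $\mathsf W_{n,n,1}$, $\mathsf W_{n,d,\gamma^{1/d}e^{2\pi i r/d}}$ with $0\le r<\frac d2$, $d=2,4,\dots,n-2$, and, if $\beta=0$ and ($\gamma=1$ or $n=2$), $\mathsf W_{n,0,\pm i}$. -/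

import Mathlib

namespace AffineTL

/-- A periodic link state on `n` nodes with `d` defects, drawn on the universal cover: the nodes are
the integers, `i` and `i + n` being the same node of the circle, and `p i` is the node to which the
loop segment at `i` is attached, with `p i = i` if `i` carries a defect. Segments do not cross, and
a defect is never overarched. The boundary of the box lies between the nodes `n` and `n + 1`, that
is, between `0` and `1`. -/
structure IsLinkState (n d : ℕ) (p : ℤ → ℤ) : Prop where
  periodic : ∀ i, p (i + n) = p i + n
  involutive : ∀ i, p (p i) = i
  noncrossing : ∀ i k, i < k → k < p i → p k ≠ k ∧ i < p k ∧ p k < p i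
  defects : Set.ncard {x : ZMod n | ∃ i : ℤ, (i : ZMod n) = x ∧ p i = i} = d

open Classical in
/-- The connections seen at the bottom of `e_j` when a link state `p` is drawn above it: the nodes
`j` and `j + 1` are connected to one another, and the former partners of `j` and `j + 1` are
connected to one another, or the partner of one of them becomes a defect if the other one was. -/
noncomputable def joinFun (n : ℕ) (j : ℤ) (p : ℤ → ℤ) (i : ℤ) : ℤ :=
  if i ≡ j [ZMOD n] then i + 1
  else if i ≡ j + 1 [ZMOD n] then i - 1
  else if p i ≡ j [ZMOD n] then (if p (p i + 1) = p i + 1 then i else p (p i + 1))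
  else if p i ≡ j + 1 [ZMOD n] then (if p (p i - 1) = p i - 1 then i else p (p i - 1))
  else p i

/-- The link state `p` with all its nodes moved by `s` steps to the left. -/
def rotFun (s : ℤ) (p : ℤ → ℤ) (i : ℤ) : ℤ := p (i + s) - s

theorem IsLinkState.rot {n d : ℕ} {p : ℤ → ℤ} (h : IsLinkState n d p) (s : ℤ) :
    IsLinkState n d (rotFun s p) where
  periodic i := by
    have := h.periodic (i + s)
    simp only [rotFun]
    rw [show i + n + s = i + s + n by ring, this]; ring
  involutive i := by simp [rotFun, h.involutive]
  noncrossing i k h1 h2 := by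
    have := h.noncrossing (i + s) (k + s) (by omega) (by simp only [rotFun] at h2; omega)
    simp only [rotFun]; omega
  defects := by
    rw [← h.defects]
    symm
    apply Set.ncard_congr (fun x _ => x - (s : ZMod n))
    · rintro x ⟨i, rfl, hi⟩
      exact ⟨i - s, by push_cast; ring, by simp [rotFun, hi]⟩
    · intro a b _ _ hab
      simpa using hab
    · rintro x ⟨i, rfl, hi⟩
      refine ⟨(i + s : ℤ), ⟨i + s, rfl, ?_⟩, by push_cast; ring⟩
      simp only [rotFun] at hi; omega

section
variable {n d : ℕ} {p : ℤ → ℤ}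

theorem IsLinkState.periodic_mul (h : IsLinkState n d p) (i m : ℤ) :
    p (i + n * m) = p i + n * m := by
  induction m using Int.induction_on with
  | zero => simp
  | succ k ih =>
    have := h.periodic (i + n * k)
    rw [ih] at this
    rw [show i + (n : ℤ) * (k + 1) = i + n * k + n by ring, this]; ring
  | pred k ih =>
    have := h.periodic (i + n * (-k - 1))
    rw [show i + (n : ℤ) * (-k - 1) + n = i + n * (-k) by ring, ih] at this
    linarith

theorem IsLinkState.modEq (h : IsLinkState n d p) {i k : ℤ} (hik : i ≡ k [ZMOD n]) :
    p i - i = p k - k := by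
  obtain ⟨m, hm⟩ := hik.dvd
  have := h.periodic_mul i m
  rw [show i + (n : ℤ) * m = k by linarith] at this
  linarith

end
section
variable {n d : ℕ} {p : ℤ → ℤ}

theorem IsLinkState.span [NeZero n] (h : IsLinkState n d p) (i : ℤ) : p i < i + n := by
  by_contra hc
  have hn : 0 < (n : ℤ) := by exact_mod_cast NeZero.pos n
  have h1 := h.periodic i
  rcases eq_or_lt_of_le (not_lt.mp hc) with h2 | h2
  · have := h.involutive i
    rw [← h2] at this
    omega
  · have := h.noncrossing i (i + n) (by omega) h2
    omega

theorem int_modEq_cases {n : ℕ} [NeZero n] {a b : ℤ} (h : a ≡ b [ZMOD n]) :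
    a = b ∨ a + n ≤ b ∨ b + n ≤ a := by
  have hn : 0 < (n : ℤ) := by exact_mod_cast NeZero.pos n
  obtain ⟨m, hm⟩ := h.dvd
  rcases lt_trichotomy m 0 with h1 | h1 | h1
  · right; right; nlinarith
  · left; subst h1; omega
  · right; left; nlinarith

theorem IsLinkState.nc (h : IsLinkState n d p) (u v : ℤ) (h1 : v ≠ u) (h2 : v ≠ p u) :
    (u < v ∧ v < p u → p v ≠ v ∧ u < p v ∧ p v < p u) ∧
    (p u < v ∧ v < u → p v ≠ v ∧ p u < p v ∧ p v < u) ∧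
    (u < p v ∧ p v < p u → u < v ∧ v < p u) ∧
    (p u < p v ∧ p v < u → p u < v ∧ v < u) := by
  have e1 := h.involutive u
  have e2 := h.involutive v
  have a1 := h.noncrossing u v
  have a2 := h.noncrossing (p u) v
  have a3 := h.noncrossing u (p v)
  have a4 := h.noncrossing (p u) (p v)
  rw [e1] at a2
  rw [e2] at a3
  rw [e1, e2] at a4
  refine ⟨fun hh => a1 hh.1 hh.2, fun hh => a2 hh.1 hh.2, fun hh => (a3 hh.1 hh.2).2,
    fun hh => (a4 hh.1 hh.2).2⟩


theorem joinFun_cases (h : IsLinkState n d p) (j i : ℤ) :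
    (i ≡ j [ZMOD n] ∧ joinFun n j p i = i + 1) ∨
    (i ≡ j + 1 [ZMOD n] ∧ joinFun n j p i = i - 1) ∨
    (∃ x x', p i = x ∧ p x = i ∧ ¬ i ≡ j [ZMOD n] ∧ ¬ i ≡ j + 1 [ZMOD n] ∧
      (x ≡ j [ZMOD n] ∧ x' ≡ j + 1 [ZMOD n] ∧ x' = x + 1 ∨
        x ≡ j + 1 [ZMOD n] ∧ x' ≡ j [ZMOD n] ∧ x' = x - 1) ∧
      (p x' = x' ∧ joinFun n j p i = i ∨ p x' ≠ x' ∧ joinFun n j p i = p x')) ∨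
    (¬ i ≡ j [ZMOD n] ∧ ¬ i ≡ j + 1 [ZMOD n] ∧ ¬ p i ≡ j [ZMOD n] ∧ ¬ p i ≡ j + 1 [ZMOD n] ∧
      joinFun n j p i = p i) := by
  by_cases h1 : i ≡ j [ZMOD n]
  · left; simp [joinFun, h1]
  by_cases h2 : i ≡ j + 1 [ZMOD n]
  · right; left; simp [joinFun, h1, h2]
  by_cases h3 : p i ≡ j [ZMOD n]
  · right; right; left
    refine ⟨p i, p i + 1, rfl, h.involutive i, h1, h2, Or.inl ⟨h3, h3.add_right 1, rfl⟩, ?_⟩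
    by_cases h4 : p (p i + 1) = p i + 1
    · left; simp [joinFun, h1, h2, h3, h4]
    · right; simp [joinFun, h1, h2, h3, h4]
  by_cases h4 : p i ≡ j + 1 [ZMOD n]
  · right; right; left
    refine ⟨p i, p i - 1, rfl, h.involutive i, h1, h2,
      Or.inr ⟨h4, by simpa using h4.sub_right 1, rfl⟩, ?_⟩
    by_cases h5 : p (p i - 1) = p i - 1
    · left; simp [joinFun, h1, h2, h3, h4, h5]
    · right; simp [joinFun, h1, h2, h3, h4, h5]
  · right; right; right
    simp [joinFun, h1, h2, h3, h4]

theorem modEq_p (h : IsLinkState n d p) {a b : ℤ} (hab : a ≡ b [ZMOD n]) : p a ≡ p b [ZMOD n] := by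
  have := h.modEq hab
  have h2 : p a = a + (p b - b) := by omega
  rw [h2]
  simpa using hab.add_right (p b - b)

theorem modEq_p_iff (h : IsLinkState n d p) {a b : ℤ} : p a ≡ p b [ZMOD n] ↔ a ≡ b [ZMOD n] :=
  ⟨fun hh => by simpa [h.involutive] using modEq_p h hh, modEq_p h⟩

theorem modEq_self_p [NeZero n] (h : IsLinkState n d p) {a : ℤ} (hh : p a ≡ a [ZMOD n]) : p a = a := by
  have h1 := h.span a
  have h2 := h.span (p a)
  rw [h.involutive] at h2
  rcases int_modEq_cases hh with h3 | h3 | h3 <;> omega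

/-- `v` lies strictly between `a` and `b`. -/
def SepBy (a b v : ℤ) : Prop := a < v ∧ v < b ∨ b < v ∧ v < a

theorem IsLinkState.btw (h : IsLinkState n d p) (u v : ℤ) (h1 : v ≠ u) (h2 : v ≠ p u) :
    (SepBy u (p u) v → p v ≠ v) ∧ (SepBy u (p u) v ↔ SepBy u (p u) (p v)) := by
  have := h.nc u v h1 h2
  simp only [SepBy]
  tauto

theorem xor_btw {i x x' b v : ℤ} (hx : x' = x + 1 ∨ x' = x - 1) (h1 : i < v) (h2 : v < b)
    (h3 : v ≠ x) (h4 : v ≠ x') (h5 : i ≠ x) (h6 : b ≠ x') :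
    Xor (SepBy i x v) (SepBy x' b v) := by
  simp only [Xor, SepBy]; omega

theorem btw_xor {i x x' b v : ℤ} (hx : x' = x + 1 ∨ x' = x - 1) {k : ℤ} (h1 : i < k) (h2 : k < b)
    (h3 : v ≠ x) (h4 : v ≠ x') (h5 : v ≠ i) (h6 : v ≠ b)
    (h : Xor (SepBy i x v) (SepBy x' b v)) : i < v ∧ v < b := by
  simp only [Xor, SepBy] at h; omega

theorem sepBy_adj {a b y y' : ℤ} (hy : y' = y + 1 ∨ y' = y - 1) (h1 : y ≠ a) (h2 : y ≠ b)
    (h3 : y' ≠ a) (h4 : y' ≠ b) : SepBy a b y ↔ SepBy a b y' := by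
  simp only [SepBy]; omega

theorem IsLinkState.arc_arc (h : IsLinkState n d p) {i x x' k y y' : ℤ}
    (hx : x' = x + 1 ∨ x' = x - 1) (hy : y' = y + 1 ∨ y' = y - 1)
    (hik : i < k) (hkb : k < p x') (hix : p i = x) (hky : p k = y)
    (ix : i ≠ x) (bx' : p x' ≠ x') (ky : k ≠ y) (kx : k ≠ x) (kx' : k ≠ x') (yx : y ≠ x) (yx' : y ≠ x')
    (y'x : y' ≠ x) (y'x' : y' ≠ x') (yi : y ≠ i) (y'i : y' ≠ i) (yb : y ≠ p x') (y'b : y' ≠ p x') :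
    p y' ≠ y' ∧ p y' ≠ k ∧ i < p y' ∧ p y' < p x' := by
  have inj : ∀ {u v : ℤ}, p u = p v → u = v := fun {u v} huv => by
    rw [← h.involutive u, huv, h.involutive]
  have k1 := h.btw i k hik.ne' (by rw [hix]; exact kx)
  have k2 := h.btw x' k kx' hkb.ne
  have y1 := h.btw i y' y'i (by rw [hix]; exact y'x)
  have y2 := h.btw x' y' y'x' y'b
  rw [hix] at k1 y1
  rw [hky] at k1 k2
  have w1 := xor_btw hx hik hkb kx kx' ix bx'
  rw [k1.2, k2.2, sepBy_adj hy yi yx y'i y'x, sepBy_adj hy yx' yb y'x' y'b] at w1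
  have c1 : p y' ≠ i := fun hc => y'x (by rw [← hix, ← hc, h.involutive])
  have c2 : p y' ≠ p x' := fun hc => y'x' (inj hc)
  have c3 : p y' ≠ x := fun hc => y'i (inj (hc.trans hix.symm))
  have c4 : p y' ≠ x' := fun hc => y'b (by rw [← hc, h.involutive])
  have c5 : p y' ≠ k := fun hc => by
    have : y' = y := by rw [← hky, ← hc, h.involutive]
    omega
  refine ⟨?_, c5, ?_⟩
  · rcases w1 with w1 | w1
    · exact y1.1 w1.1
    · exact y2.1 w1.1
  · rw [y1.2, y2.2] at w1
    exact btw_xor hx hik hkb c3 c4 c1 c2 w1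

theorem IsLinkState.arc_simple (h : IsLinkState n d p) {i x x' k : ℤ}
    (hx : x' = x + 1 ∨ x' = x - 1)
    (hik : i < k) (hkb : k < p x') (hix : p i = x)
    (ix : i ≠ x) (bx' : p x' ≠ x') (kx : k ≠ x) (kx' : k ≠ x')
    (yx : p k ≠ x) (yx' : p k ≠ x') :
    p k ≠ k ∧ i < p k ∧ p k < p x' := by
  have k1 := h.btw i k hik.ne' (by rw [hix]; exact kx)
  have k2 := h.btw x' k kx' hkb.ne
  rw [hix] at k1
  have w1 := xor_btw hx hik hkb kx kx' ix bx'
  refine ⟨?_, ?_⟩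
  · rcases w1 with w1 | w1
    · exact k1.1 w1.1
    · exact k2.1 w1.1
  · rw [k1.2, k2.2] at w1
    refine btw_xor hx hik hkb yx yx' ?_ ?_ w1
    · intro hc; apply kx; rw [← hix, ← hc, h.involutive]
    · intro hc; apply kx'; rw [← h.involutive k, hc, h.involutive]

theorem joinFun_noncrossing [NeZero n] (h : IsLinkState n d p) {j : ℤ}
    (nj : ¬ j + 1 ≡ j [ZMOD n])
    (i k : ℤ) (hik : i < k) (hk : k < joinFun n j p i) :
    joinFun n j p k ≠ k ∧ i < joinFun n j p k ∧ joinFun n j p k < joinFun n j p i := by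
  have inj : ∀ {u v : ℤ}, p u = p v → u = v := fun {u v} huv => by
    rw [← h.involutive u, huv, h.involutive]
  rcases joinFun_cases h j i with ⟨hi, ei⟩ | ⟨hi, ei⟩ | ⟨x, x', hix, hxi, hij, hij', hx, hh⟩ | ⟨hi1, hi2, hi3, hi4, ei⟩
  · omega
  · omega
  · rcases hh with ⟨hb, ei⟩ | ⟨hb, ei⟩
    · omega
    rw [ei] at hk ⊢
    have hxx : x' = x + 1 ∨ x' = x - 1 := hx.imp (·.2.2) (·.2.2)
    have hbj : ¬ p x' ≡ j [ZMOD n] ∧ ¬ p x' ≡ j + 1 [ZMOD n] := by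
      have q1 : ∀ {t}, x ≡ t [ZMOD n] → p x' ≡ t [ZMOD n] → x' ≡ i [ZMOD n] := by
        intro t h1 h2
        have := modEq_p h (h2.trans h1.symm)
        rwa [h.involutive, hxi] at this
      have q2 : ∀ {t}, x' ≡ t [ZMOD n] → ¬ p x' ≡ t [ZMOD n] := fun h1 h2 =>
        hb (modEq_self_p h (h2.trans h1.symm))
      rcases hx with ⟨hx1, hx2, hx3⟩ | ⟨hx1, hx2, hx3⟩
      · exact ⟨fun hc => hij' ((q1 hx1 hc).symm.trans hx2), q2 hx2⟩
      · exact ⟨q2 hx2, fun hc => hij ((q1 hx1 hc).symm.trans hx2)⟩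
    have xj : (x ≡ j [ZMOD n] ∨ x ≡ j + 1 [ZMOD n]) ∧ (x' ≡ j [ZMOD n] ∨ x' ≡ j + 1 [ZMOD n]) :=
      hx.elim (fun a => ⟨.inl a.1, .inr a.2.1⟩) (fun a => ⟨.inr a.1, .inl a.2.1⟩)
    have sep : ∀ {u v : ℤ}, ¬ u ≡ j [ZMOD n] → ¬ u ≡ j + 1 [ZMOD n] →
        (v ≡ j [ZMOD n] ∨ v ≡ j + 1 [ZMOD n]) → u ≠ v := by
      rintro u v a b c rfl; exact c.elim a b
    rcases joinFun_cases h j k with ⟨hk1, ek⟩ | ⟨hk1, ek⟩ | ⟨y, y', hky, hyk, hkj, hkj', hy, hh⟩ | ⟨hk1, hk2, hk3, hk4, ek⟩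
    · rw [ek]
      have : k + 1 ≠ p x' := fun hc => hbj.2 (hc ▸ hk1.add_right 1)
      clear hx; omega
    · rw [ek]
      have : k - 1 ≠ i := fun hc => hij (hc ▸ by simpa using hk1.sub_right 1)
      clear hx; omega
    · have yj : (y ≡ j [ZMOD n] ∨ y ≡ j + 1 [ZMOD n]) ∧
        (y' ≡ j [ZMOD n] ∨ y' ≡ j + 1 [ZMOD n]) :=
        hy.elim (fun a => ⟨.inl a.1, .inr a.2.1⟩) (fun a => ⟨.inr a.1, .inl a.2.1⟩)
      have yx : y ≠ x := fun hc => hik.ne (inj (by rw [hix, hky, hc]))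
      have yx' : y ≠ x' := fun hc => hk.ne (by rw [← hyk, hc])
      have t1 : y' ≠ x ∧ y' ≠ x' := by
        rcases hx with ⟨hx1, hx2, hx3⟩ | ⟨hx1, hx2, hx3⟩ <;>
          rcases hy with ⟨hy1, hy2, hy3⟩ | ⟨hy1, hy2, hy3⟩
        · exact ⟨fun hc => nj (hy2.symm.trans (hc ▸ hx1)), by omega⟩
        · exact ⟨by omega, fun hc => nj (hx2.symm.trans (hc ▸ hy2))⟩
        · exact ⟨by omega, fun hc => nj (hy2.symm.trans (hc ▸ hx2))⟩
        · exact ⟨fun hc => nj (hx1.symm.trans (hc ▸ hy2)), by omega⟩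
      obtain ⟨r1, r2, r3⟩ := h.arc_arc hxx (hy.imp (·.2.2) (·.2.2)) hik hk hix hky
        (sep hij hij' xj.1) hb (sep hkj hkj' yj.1) (sep hkj hkj' xj.1) (sep hkj hkj' xj.2)
        yx yx' t1.1 t1.2 (sep hij hij' yj.1).symm (sep hij hij' yj.2).symm
        (sep hbj.1 hbj.2 yj.1).symm (sep hbj.1 hbj.2 yj.2).symm
      rcases hh with ⟨hh, ek⟩ | ⟨hh, ek⟩
      · exact absurd hh r1
      · rw [ek]; exact ⟨r2, r3⟩
    · rw [ek]
      exact h.arc_simple hxx hik hk hix (sep hij hij' xj.1) hb (sep hk1 hk2 xj.1)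
        (sep hk1 hk2 xj.2) (sep hk3 hk4 xj.1) (sep hk3 hk4 xj.2)
  · rw [ei] at hk ⊢
    rcases joinFun_cases h j k with ⟨hk1, ek⟩ | ⟨hk1, ek⟩ | ⟨y, y', hky, hyk, hkj, hkj', hy, hh⟩ | ⟨hk1, hk2, hk3, hk4, ek⟩
    · rw [ek]
      have : k + 1 ≠ p i := fun hc => hi4 (hc ▸ hk1.add_right 1)
      omega
    · rw [ek]
      have : k - 1 ≠ i := fun hc => hi1 (hc ▸ by simpa using hk1.sub_right 1)
      omega
    · have a1 := h.noncrossing i k hik hk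
      rw [hky] at a1
      have yj : (y' ≡ j [ZMOD n] ∨ y' ≡ j + 1 [ZMOD n]) :=
        hy.elim (fun a => .inr a.2.1) (fun a => .inl a.2.1)
      have b1 : y' ≠ i := by rintro rfl; exact yj.elim hi1 hi2
      have b2 : y' ≠ p i := by rintro rfl; exact yj.elim hi3 hi4
      have hyy : y' = y + 1 ∨ y' = y - 1 := hy.imp (·.2.2) (·.2.2)
      clear hy
      have a2 := h.noncrossing i y' (by omega) (by omega)
      have b3 : p y' ≠ k := by
        rintro rfl
        rw [h.involutive] at hky; omega
      rcases hh with ⟨hh, ek⟩ | ⟨hh, ek⟩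
      · exact absurd hh a2.1
      · rw [ek]; exact ⟨b3, a2.2⟩
    · rw [ek]
      exact h.noncrossing i k hik hk
end
section
variable {n d : ℕ} {p : ℤ → ℤ}

theorem not_modEq_of [NeZero n] (h : IsLinkState n d p) {j : ℤ}
    (hj : ¬ (p j = j ∧ p (j + 1) = j + 1)) : ¬ j + 1 ≡ j [ZMOD n] := by
  intro hc
  apply hj
  have e := h.modEq hc
  have hn : n = 1 := by
    have h1 : (n : ℤ) ∣ 1 := by simpa using hc.symm.dvd
    exact_mod_cast Int.eq_one_of_dvd_one (Int.natCast_nonneg n) h1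
  have s1 := h.span j
  have s2 := h.span (p j)
  rw [h.involutive] at s2
  subst hn
  push_cast at s1 s2
  omega

theorem joinFun_periodic (h : IsLinkState n d p) (j i : ℤ) :
    joinFun n j p (i + n) = joinFun n j p i + n := by
  have c : ∀ a b : ℤ, a + n ≡ b [ZMOD n] ↔ a ≡ b [ZMOD n] := fun a b => by
    simp [Int.ModEq]
  have e1 : p (p i + n + 1) = p (p i + 1) + n := by
    rw [show p i + n + 1 = p i + 1 + n by ring, h.periodic]
  have e2 : p (p i + n - 1) = p (p i - 1) + n := by
    rw [show p i + n - 1 = p i - 1 + n by ring, h.periodic]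
  have e3 : p (p i + 1) + n = p i + n + 1 ↔ p (p i + 1) = p i + 1 := by omega
  have e4 : p (p i - 1) + n = p i + n - 1 ↔ p (p i - 1) = p i - 1 := by omega
  simp only [joinFun, c, h.periodic, e1, e2, e3, e4]
  split_ifs <;> ring

theorem joinFun_involutive [NeZero n] (h : IsLinkState n d p) {j : ℤ}
    (nj : ¬ j + 1 ≡ j [ZMOD n]) (i : ℤ) : joinFun n j p (joinFun n j p i) = i := by
  rcases joinFun_cases h j i with ⟨hi, ei⟩ | ⟨hi, ei⟩ | ⟨x, x', hix, hxi, hij, hij', hx, hh⟩ | ⟨hi1, hi2, hi3, hi4, ei⟩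
  · have h1 : i + 1 ≡ j + 1 [ZMOD n] := hi.add_right 1
    have h2 : ¬ i + 1 ≡ j [ZMOD n] := fun hc => nj (h1.symm.trans hc)
    rw [ei, joinFun, if_neg h2, if_pos h1]; ring
  · have h1 : i - 1 ≡ j [ZMOD n] := by simpa using hi.sub_right 1
    rw [ei, joinFun, if_pos h1]; ring
  · rcases hh with ⟨hb, ei⟩ | ⟨hb, ei⟩
    · rw [ei, ei]
    · rw [ei]
      have q1 : ∀ {t}, x ≡ t [ZMOD n] → p x' ≡ t [ZMOD n] → x' ≡ i [ZMOD n] := by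
        intro t h1 h2
        have := modEq_p h (h2.trans h1.symm)
        rwa [h.involutive, hxi] at this
      have q2 : ∀ {t}, x' ≡ t [ZMOD n] → ¬ p x' ≡ t [ZMOD n] := fun h1 h2 =>
        hb (modEq_self_p h (h2.trans h1.symm))
      rcases hx with ⟨hx1, hx2, hx3⟩ | ⟨hx1, hx2, hx3⟩
      · have h1 : ¬ x' ≡ j [ZMOD n] := fun hc => nj (hx2.symm.trans hc)
        have hne : p (x' - 1) ≠ x' - 1 := by
          rw [hx3, add_sub_cancel_right, hxi]; rintro rfl; exact hij hx1
        rw [joinFun, if_neg (fun hc => hij' ((q1 hx1 hc).symm.trans hx2)), if_neg (q2 hx2),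
          h.involutive, if_neg h1, if_pos hx2, if_neg hne, hx3, add_sub_cancel_right, hxi]
      · have hne : p (x' + 1) ≠ x' + 1 := by
          rw [hx3, sub_add_cancel, hxi]; rintro rfl; exact hij' hx1
        rw [joinFun, if_neg (q2 hx2), if_neg (fun hc => hij ((q1 hx1 hc).symm.trans hx2)),
          h.involutive, if_pos hx2, if_neg hne, hx3, sub_add_cancel, hxi]
  · rw [ei, joinFun, if_neg hi3, if_neg hi4, h.involutive, if_neg hi1, if_neg hi2]

theorem joinFun_fixed [NeZero n] (h : IsLinkState n d p) (j i : ℤ) :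
    joinFun n j p i = i ↔ ¬ i ≡ j [ZMOD n] ∧ ¬ i ≡ j + 1 [ZMOD n] ∧
      (p i = i ∨ (p i ≡ j [ZMOD n] ∧ p (j + 1) = j + 1) ∨ (p i ≡ j + 1 [ZMOD n] ∧ p j = j)) := by
  have fx : ∀ {a b : ℤ}, a ≡ b [ZMOD n] → (p a = a ↔ p b = b) := fun hab => by
    have := h.modEq hab; omega
  rcases joinFun_cases h j i with ⟨hi, ei⟩ | ⟨hi, ei⟩ | ⟨x, x', hix, hxi, hij, hij', hx, hh⟩ | ⟨hi1, hi2, hi3, hi4, ei⟩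
  · rw [ei]; simp [hi]
  · rw [ei]; simp [hi]
  · have key : joinFun n j p i = i ↔ p x' = x' := by
      rcases hh with ⟨hb, ei⟩ | ⟨hb, ei⟩
      · simp [hb, ei]
      · rw [ei]
        refine ⟨fun hc => ?_, fun hc => absurd hc hb⟩
        have : x' = x := by rw [← hix, ← hc, h.involutive]
        exfalso
        rcases hx with hx | hx
        · exact absurd hx.2.2 (by omega)
        · exact absurd hx.2.2 (by omega)
    rw [key]
    have hne : i ≠ x := by
      rintro rfl
      exact hx.elim (fun hx => hij hx.1) (fun hx => hij' hx.1)
    simp only [hij, hij', not_false_eq_true, true_and, hix, hne.symm, false_or]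
    have hxx : ∀ {t s}, x ≡ t [ZMOD n] → p t = t → s ∨ True := fun _ _ => Or.inr trivial
    have pxi : p x ≠ x := by rw [hxi]; exact hne
    rcases hx with ⟨hx1, hx2, hx3⟩ | ⟨hx1, hx2, hx3⟩
    · have : p j ≠ j := fun hc => pxi ((fx hx1).2 hc)
      simp [hx1, fx hx2, this]
    · have : p (j + 1) ≠ j + 1 := fun hc => pxi ((fx hx1).2 hc)
      simp [hx1, fx hx2, this]
  · rw [ei]; simp [hi1, hi2, hi3, hi4]

theorem mem_defects (hp : ∀ i, p (i + n) = p i + n) (i : ℤ) :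
    (∃ k : ℤ, (k : ZMod n) = (i : ZMod n) ∧ p k = k) ↔ p i = i := by
  constructor
  · rintro ⟨k, hk, e⟩
    rw [ZMod.intCast_eq_intCast_iff] at hk
    obtain ⟨m, hm⟩ := hk.dvd
    have key : ∀ m : ℤ, p (k + n * m) = p k + n * m := by
      intro m
      induction m using Int.induction_on with
      | zero => simp
      | succ l ih =>
        have := hp (k + n * l)
        rw [show k + (n : ℤ) * (l + 1) = k + n * l + n by ring, this, ih]; ring
      | pred l ih =>
        have := hp (k + n * (-l - 1))
        rw [show k + (n : ℤ) * (-l - 1) + n = k + n * (-l) by ring, ih] at this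
        linarith
    have := key m
    rw [show k + (n : ℤ) * m = i by linarith] at this
    linarith
  · intro e; exact ⟨i, rfl, e⟩

theorem joinFun_defects [NeZero n] (h : IsLinkState n d p) {j : ℤ}
    (hj : ¬ (p j = j ∧ p (j + 1) = j + 1)) :
    Set.ncard {x : ZMod n | ∃ i : ℤ, (i : ZMod n) = x ∧ joinFun n j p i = i} = d := by
  have nj := not_modEq_of h hj
  have fx : ∀ {a b : ℤ}, a ≡ b [ZMOD n] → (p a = a ↔ p b = b) := fun hab => by
    have := h.modEq hab; omega
  set D : Set (ZMod n) := {x : ZMod n | ∃ i : ℤ, (i : ZMod n) = x ∧ p i = i} with hD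
  set D' : Set (ZMod n) := {x : ZMod n | ∃ i : ℤ, (i : ZMod n) = x ∧ joinFun n j p i = i} with hD'
  have m1 : ∀ i : ℤ, (i : ZMod n) ∈ D ↔ p i = i := mem_defects h.periodic
  have m2 : ∀ i : ℤ, (i : ZMod n) ∈ D' ↔ joinFun n j p i = i := mem_defects (joinFun_periodic h j)
  have hd : D.ncard = d := h.defects
  have pm : ∀ {a b : ℤ}, p a ≡ b [ZMOD n] ↔ a ≡ p b [ZMOD n] := fun {a b} => by
    rw [← modEq_p_iff h, h.involutive]
  by_cases h1 : p j = j
  · have h2 : p (j + 1) ≠ j + 1 := fun hc => hj ⟨h1, hc⟩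
    have : D' = insert ((p (j + 1) : ℤ) : ZMod n) (D \ {(j : ZMod n)}) := by
      ext x
      obtain ⟨i, rfl⟩ := ZMod.intCast_surjective x
      rw [m2, joinFun_fixed h, Set.mem_insert_iff, Set.mem_sdiff, m1, Set.mem_singleton_iff,
        ZMod.intCast_eq_intCast_iff, ZMod.intCast_eq_intCast_iff, ← pm]
      constructor
      · rintro ⟨a, b, c | c | c⟩
        · exact Or.inr ⟨c, a⟩
        · exact absurd c.2 h2
        · exact Or.inl c.1
      · rintro (c | c)
        · refine ⟨fun hc => ?_, fun hc => ?_, Or.inr (Or.inr ⟨c, h1⟩)⟩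
          · exact nj (c.symm.trans ((modEq_p h hc).trans (by rw [h1])))
          · exact h2 (modEq_self_p h ((modEq_p h hc).symm.trans c))
        · exact ⟨c.2, fun hc => h2 ((fx hc).1 c.1), Or.inl c.1⟩
    rw [this, Set.ncard_exchange, hd]
    · rw [m1, h.involutive]; exact h2.symm
    · exact (m1 j).2 h1
  by_cases h2 : p (j + 1) = j + 1
  · have : D' = insert ((p j : ℤ) : ZMod n) (D \ {((j + 1 : ℤ) : ZMod n)}) := by
      ext x
      obtain ⟨i, rfl⟩ := ZMod.intCast_surjective x
      rw [m2, joinFun_fixed h, Set.mem_insert_iff, Set.mem_sdiff, m1, Set.mem_singleton_iff,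
        ZMod.intCast_eq_intCast_iff, ZMod.intCast_eq_intCast_iff, ← pm]
      constructor
      · rintro ⟨a, b, c | c | c⟩
        · exact Or.inr ⟨c, b⟩
        · exact Or.inl c.1
        · exact absurd c.2 h1
      · rintro (c | c)
        · refine ⟨fun hc => ?_, fun hc => ?_, Or.inr (Or.inl ⟨c, h2⟩)⟩
          · exact h1 (modEq_self_p h ((modEq_p h hc).symm.trans c))
          · have := modEq_p h hc
            rw [h2] at this
            exact nj (this.symm.trans c)
        · exact ⟨fun hc => h1 ((fx hc).1 c.1), c.2, Or.inl c.1⟩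
    rw [this, Set.ncard_exchange, hd]
    · rw [m1, h.involutive]; exact fun hc => h1 hc.symm
    · exact (m1 (j + 1)).2 h2
  · have : D' = D := by
      ext x
      obtain ⟨i, rfl⟩ := ZMod.intCast_surjective x
      rw [m2, joinFun_fixed h, m1]
      constructor
      · rintro ⟨a, b, c | c | c⟩
        · exact c
        · exact absurd c.2 h2
        · exact absurd c.2 h1
      · intro c
        exact ⟨fun hc => h1 ((fx hc).1 c), fun hc => h2 ((fx hc).1 c), Or.inl c⟩
    rw [this, hd]

theorem IsLinkState.join [NeZero n] (h : IsLinkState n d p) {j : ℤ}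
    (hj : ¬ (p j = j ∧ p (j + 1) = j + 1)) : IsLinkState n d (joinFun n j p) where
  periodic := joinFun_periodic h j
  involutive := joinFun_involutive h (not_modEq_of h hj)
  noncrossing := joinFun_noncrossing h (not_modEq_of h hj)
  defects := joinFun_defects h hj
end

/-- The link states on `n` nodes with `d` defects. -/
def LinkState (n d : ℕ) : Type := {p : ℤ → ℤ // IsLinkState n d p}

/-- The vector space of the standard module with `d` defects. -/
abbrev StdSpace (n d : ℕ) : Type := LinkState n d →₀ ℂ

/-- The index of the copy `{cell * n + 1, …, cell * n + n}` of the box that contains the node `i`. -/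
def cell (n : ℕ) (i : ℤ) : ℤ := (i - 1) / n

/-- The prefactor of `e_j · p`, when `j` and `j + 1` are not both defects: `β` for a contractible
loop, `z + z⁻¹` for a non-contractible loop, and `z ^ k` for a defect that crosses the boundary of
the box `k` times towards the left as it goes down from its old node to its new node. -/
noncomputable def joinWeight (n : ℕ) (β : ℂ) (z : ℂˣ) (j : ℤ) (p : ℤ → ℤ) : ℂ :=
  if p j = j + 1 then β
  else if p (j + 1) = j + n then (z : ℂ) + (z : ℂ)⁻¹
  else if p j = j then (z : ℂ) ^ (cell n j - cell n (p (j + 1)))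
  else if p (j + 1) = j + 1 then (z : ℂ) ^ (cell n (j + 1) - cell n (p j))
  else 1

open Classical in
/-- The action of `e_j` on the standard module `W_{n,d,z}`. It is zero on a link state in which `j`
and `j + 1` are both defects. -/
noncomputable def opE (n d : ℕ) [NeZero n] (β : ℂ) (z : ℂˣ) (j : ℤ) :
    Module.End ℂ (StdSpace n d) :=
  Finsupp.linearCombination ℂ fun w : LinkState n d =>
    if h : w.1 j = j ∧ w.1 (j + 1) = j + 1 then (0 : StdSpace n d)
    else Finsupp.single (⟨joinFun n j w.1, w.2.join h⟩ : LinkState n d) (joinWeight n β z j w.1)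

/-- The action of `Ω` on `W_{n,d,z}`: everything moves one node to the left, and a defect at the
node `1` crosses the boundary. -/
noncomputable def opOm (n d : ℕ) (z : ℂˣ) : Module.End ℂ (StdSpace n d) :=
  Finsupp.linearCombination ℂ fun w : LinkState n d =>
    Finsupp.single (⟨rotFun 1 w.1, w.2.rot 1⟩ : LinkState n d) (if w.1 1 = 1 then (z : ℂ) else 1)

/-- The action of `Ω⁻¹` on `W_{n,d,z}`: everything moves one node to the right, and a defect at the
node `n`, which is also the node `0`, crosses the boundary. -/
noncomputable def opOmInv (n d : ℕ) (z : ℂˣ) : Module.End ℂ (StdSpace n d) :=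
  Finsupp.linearCombination ℂ fun w : LinkState n d =>
    Finsupp.single (⟨rotFun (-1) w.1, w.2.rot (-1)⟩ : LinkState n d)
      (if w.1 0 = 0 then (z : ℂ)⁻¹ else 1)

/-- The generators of the affine algebra. Those of the periodic algebra are the `e j`, and are
indexed by `ZMod n`. -/
inductive AffineGen (n : ℕ) : Type
  | e (j : ZMod n)
  | Om
  | OmInv

section Relations

variable {A : Type} [Ring A] [Algebra ℂ A]

/-- `e_{m-1} ⋯ e_1 e_0`. -/
def descProd (n : ℕ) (e : ZMod n → A) (m : ℕ) : A :=
  ((List.range m).reverse.map fun k : ℕ => e (k : ZMod n)).prod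

/-- `e_{n-1} ⋯ e_2 e_1`. -/
def descProdOne (n : ℕ) (e : ZMod n → A) : A :=
  ((List.range (n - 1)).reverse.map fun k : ℕ => e ((k + 1 : ℕ) : ZMod n)).prod

/-- `E = e_0 e_2 e_4 ⋯ e_{n-2}`. -/
def evenProd (n : ℕ) (e : ZMod n → A) : A :=
  ((List.range (n / 2)).map fun k : ℕ => e ((2 * k : ℕ) : ZMod n)).prod

/-- `F = e_1 e_3 e_5 ⋯ e_{n-1}`. -/
def oddProd (n : ℕ) (e : ZMod n → A) : A :=
  ((List.range (n / 2)).map fun k : ℕ => e ((2 * k + 1 : ℕ) : ZMod n)).prod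

/-- The defining relations of the periodic Temperley--Lieb algebra, with indices modulo `n`. For
`n = 2` the cubic relations are absent. For `n = 1` there is no generator `e_j`, which is expressed
by the relation `e_0 = 0`. -/
inductive PeriodicRel (n : ℕ) (β : ℂ) (e : ZMod n → A) : A → A → Prop
  | square (j : ZMod n) : PeriodicRel n β e (e j * e j) (β • e j)
  | cubic_succ (hn : 3 ≤ n) (j : ZMod n) : PeriodicRel n β e (e j * e (j + 1) * e j) (e j)
  | cubic_pred (hn : 3 ≤ n) (j : ZMod n) : PeriodicRel n β e (e j * e (j - 1) * e j) (e j)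
  | comm (i j : ZMod n) (h0 : i ≠ j) (h1 : i ≠ j + 1) (h2 : j ≠ i + 1) :
      PeriodicRel n β e (e i * e j) (e j * e i)
  | none (hn : n = 1) (j : ZMod n) : PeriodicRel n β e (e j) 0

/-- The defining relations of the affine Temperley--Lieb algebra. -/
inductive AffineRel (n : ℕ) (β : ℂ) (e : ZMod n → A) (Om OmInv : A) : A → A → Prop
  | periodic {a b : A} (h : PeriodicRel n β e a b) : AffineRel n β e Om OmInv a b
  | conj (j : ZMod n) : AffineRel n β e Om OmInv (Om * e j * OmInv) (e (j - 1))
  | mul_inv : AffineRel n β e Om OmInv (Om * OmInv) 1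
  | inv_mul : AffineRel n β e Om OmInv (OmInv * Om) 1
  | square (hn : 2 ≤ n) : AffineRel n β e Om OmInv (Om ^ 2 * e 1) (descProdOne n e)

end Relations

/-- The generator `e_j` in the free algebra of the affine generators. -/
abbrev aE (n : ℕ) (j : ZMod n) : FreeAlgebra ℂ (AffineGen n) := FreeAlgebra.ι ℂ (AffineGen.e j)

/-- The generator `Ω` in the free algebra of the affine generators. -/
abbrev aOm (n : ℕ) : FreeAlgebra ℂ (AffineGen n) := FreeAlgebra.ι ℂ AffineGen.Om

/-- The generator `Ω⁻¹` in the free algebra of the affine generators. -/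
abbrev aOmInv (n : ℕ) : FreeAlgebra ℂ (AffineGen n) := FreeAlgebra.ι ℂ AffineGen.OmInv

/-- The generator `e_j` in the free algebra of the periodic generators. -/
abbrev pE (n : ℕ) (j : ZMod n) : FreeAlgebra ℂ (ZMod n) := FreeAlgebra.ι ℂ j

/-- The relations of `aTL_n(β)`. -/
abbrev aTLRel (n : ℕ) (β : ℂ) : FreeAlgebra ℂ (AffineGen n) → FreeAlgebra ℂ (AffineGen n) → Prop :=
  AffineRel n β (aE n) (aOm n) (aOmInv n)

/-- The relations of `uaTL_n(β,γ)`, `n` odd: those of `aTL_n(β)` and `Ω^n = γ`. -/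
inductive uaTLRel (n : ℕ) (β γ : ℂ) :
    FreeAlgebra ℂ (AffineGen n) → FreeAlgebra ℂ (AffineGen n) → Prop
  | affine {a b : FreeAlgebra ℂ (AffineGen n)} (h : aTLRel n β a b) : uaTLRel n β γ a b
  | unwind : uaTLRel n β γ (aOm n ^ n) (γ • 1)

/-- The relations of `upTL_n(β,γ)`, `n` odd: those of `pTL_n(β)` and
`e_0 (e_{n-1} ⋯ e_1 e_0)^{n-2} = γ² e_0`. -/
inductive upTLRel (n : ℕ) (β γ : ℂ) : FreeAlgebra ℂ (ZMod n) → FreeAlgebra ℂ (ZMod n) → Prop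
  | periodic {a b : FreeAlgebra ℂ (ZMod n)} (h : PeriodicRel n β (pE n) a b) : upTLRel n β γ a b
  | unwind : upTLRel n β γ (pE n 0 * descProd n (pE n) n ^ (n - 2)) (γ ^ 2 • pE n 0)

/-- The relations of the `α`-type algebra `uaTL_n(β,α)`, `n` even: those of `aTL_n(β)`,
`E Ω E = α E` and `Ω^n = 1`. -/
inductive uaTLaRel (n : ℕ) (β α : ℂ) :
    FreeAlgebra ℂ (AffineGen n) → FreeAlgebra ℂ (AffineGen n) → Prop
  | affine {a b : FreeAlgebra ℂ (AffineGen n)} (h : aTLRel n β a b) : uaTLaRel n β α a b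
  | loop : uaTLaRel n β α (evenProd n (aE n) * aOm n * evenProd n (aE n)) (α • evenProd n (aE n))
  | unwind : uaTLaRel n β α (aOm n ^ n) 1

/-- The relations of the `α`-type algebra `upTL_n(β,α)`, `n` even: those of `pTL_n(β)`,
`E F E = α² E` and `e_0 (e_{n-1} ⋯ e_1 e_0)^{(n-2)/2} = e_0`. -/
inductive upTLaRel (n : ℕ) (β α : ℂ) : FreeAlgebra ℂ (ZMod n) → FreeAlgebra ℂ (ZMod n) → Prop
  | periodic {a b : FreeAlgebra ℂ (ZMod n)} (h : PeriodicRel n β (pE n) a b) : upTLaRel n β α a b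
  | loop : upTLaRel n β α (evenProd n (pE n) * oddProd n (pE n) * evenProd n (pE n))
      (α ^ 2 • evenProd n (pE n))
  | unwind : upTLaRel n β α (pE n 0 * descProd n (pE n) n ^ ((n - 2) / 2)) (pE n 0)

/-- The relations of the `γ`-type algebra `uaTL_n(β,γ)`, `n` even: those of `aTL_n(β)`, `E = 0`
and `Ω^n = γ`. -/
inductive uaTLbRel (n : ℕ) (β γ : ℂ) :
    FreeAlgebra ℂ (AffineGen n) → FreeAlgebra ℂ (AffineGen n) → Prop
  | affine {a b : FreeAlgebra ℂ (AffineGen n)} (h : aTLRel n β a b) : uaTLbRel n β γ a b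
  | loop : uaTLbRel n β γ (evenProd n (aE n)) 0
  | unwind : uaTLbRel n β γ (aOm n ^ n) (γ • 1)

/-- The relations of the `γ`-type algebra `upTL_n(β,γ)`, `n` even: those of `pTL_n(β)`, `E = 0`
and `e_0 (e_{n-1} ⋯ e_1 e_0)^{(n-2)/2} = γ e_0`. -/
inductive upTLbRel (n : ℕ) (β γ : ℂ) : FreeAlgebra ℂ (ZMod n) → FreeAlgebra ℂ (ZMod n) → Prop
  | periodic {a b : FreeAlgebra ℂ (ZMod n)} (h : PeriodicRel n β (pE n) a b) : upTLbRel n β γ a b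
  | loop : upTLbRel n β γ (evenProd n (pE n)) 0
  | unwind : upTLbRel n β γ (pE n 0 * descProd n (pE n) n ^ ((n - 2) / 2)) (γ • pE n 0)

/-- The algebra presented by the generators `X` and the relations `r`. -/
abbrev Presented {X : Type} (r : FreeAlgebra ℂ X → FreeAlgebra ℂ X → Prop) : Type := RingQuot r

/-- The affine Temperley--Lieb algebra. -/
abbrev aTL (n : ℕ) (β : ℂ) : Type := Presented (aTLRel n β)

/-- The uncoiled affine Temperley--Lieb algebra, `n` odd. -/
abbrev uaTL (n : ℕ) (β γ : ℂ) : Type := Presented (uaTLRel n β γ)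

/-- The uncoiled periodic Temperley--Lieb algebra, `n` odd. -/
abbrev upTL (n : ℕ) (β γ : ℂ) : Type := Presented (upTLRel n β γ)

/-- The first uncoiled affine Temperley--Lieb algebra for `n` even. -/
abbrev uaTLa (n : ℕ) (β α : ℂ) : Type := Presented (uaTLaRel n β α)

/-- The first uncoiled periodic Temperley--Lieb algebra for `n` even. -/
abbrev upTLa (n : ℕ) (β α : ℂ) : Type := Presented (upTLaRel n β α)

/-- The second uncoiled affine Temperley--Lieb algebra for `n` even. -/
abbrev uaTLb (n : ℕ) (β γ : ℂ) : Type := Presented (uaTLbRel n β γ)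

/-- The second uncoiled periodic Temperley--Lieb algebra for `n` even. -/
abbrev upTLb (n : ℕ) (β γ : ℂ) : Type := Presented (upTLbRel n β γ)

/-- The class of a generator in the presented algebra. -/
def Presented.gen {X : Type} (r : FreeAlgebra ℂ X → FreeAlgebra ℂ X → Prop) (x : X) :
    Presented r :=
  RingQuot.mkAlgHom ℂ r (FreeAlgebra.ι ℂ x)

/-- Labels `(d, z)` of standard modules. -/
abbrev Label : Type := ℕ × ℂˣ

/-- The labels of all standard modules on `n` nodes: `0 ≤ d ≤ n` and `d ≡ n mod 2`. -/
def labels (n : ℕ) : Set Label := {s | s.1 ≤ n ∧ s.1 ≡ n [MOD 2]}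

/-- The action of the affine generators on `W_{n,d,z}`. -/
noncomputable def affineAct (n : ℕ) [NeZero n] (β : ℂ) (s : Label) :
    AffineGen n → Module.End ℂ (StdSpace n s.1)
  | .e j => opE n s.1 β s.2 (j.val : ℤ)
  | .Om => opOm n s.1 s.2
  | .OmInv => opOmInv n s.1 s.2

/-- The action of the periodic generators on `W_{n,d,z}`. -/
noncomputable def periodicAct (n : ℕ) [NeZero n] (β : ℂ) (s : Label) (j : ZMod n) :
    Module.End ℂ (StdSpace n s.1) :=
  affineAct n β s (.e j)

/-- `W_{n,d,z}`, with its action of the affine generators, is a module over the algebra presented by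
the affine generators and the relations `r`. -/
def IsAffineModule (n : ℕ) [NeZero n] (β : ℂ)
    (r : FreeAlgebra ℂ (AffineGen n) → FreeAlgebra ℂ (AffineGen n) → Prop) (s : Label) : Prop :=
  ∃ ρ : Presented r →ₐ[ℂ] Module.End ℂ (StdSpace n s.1),
    ∀ x, ρ (Presented.gen r x) = affineAct n β s x

/-- `W_{n,d,z}`, with its action of the periodic generators, is a module over the algebra presented
by the periodic generators and the relations `r`. -/
def IsPeriodicModule (n : ℕ) [NeZero n] (β : ℂ)
    (r : FreeAlgebra ℂ (ZMod n) → FreeAlgebra ℂ (ZMod n) → Prop) (s : Label) : Prop :=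
  ∃ ρ : Presented r →ₐ[ℂ] Module.End ℂ (StdSpace n s.1),
    ∀ x, ρ (Presented.gen r x) = periodicAct n β s x

/-- The labels of the standard modules that are modules over an affine quotient. -/
def affineModules (n : ℕ) [NeZero n] (β : ℂ)
    (r : FreeAlgebra ℂ (AffineGen n) → FreeAlgebra ℂ (AffineGen n) → Prop) : Set Label :=
  {s ∈ labels n | IsAffineModule n β r s}

/-- The labels of the standard modules that are modules over a periodic quotient. -/
def periodicModules (n : ℕ) [NeZero n] (β : ℂ)
    (r : FreeAlgebra ℂ (ZMod n) → FreeAlgebra ℂ (ZMod n) → Prop) : Set Label :=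
  {s ∈ labels n | IsPeriodicModule n β r s}

/-- Two standard modules are isomorphic over the periodic algebra. -/
def PeriodicIso (n : ℕ) [NeZero n] (β : ℂ) (s t : Label) : Prop :=
  ∃ φ : StdSpace n s.1 ≃ₗ[ℂ] StdSpace n t.1,
    ∀ (j : ZMod n) (w : StdSpace n s.1), φ (periodicAct n β s j w) = periodicAct n β t j (φ w)

/-- `L` lists the standard modules with labels in `S` over the periodic algebra, after `W_{n,d,z}`
has been identified with the isomorphic module `W_{n,d,-z}`, and all the modules `W_{n,n,z}`, which
are isomorphic, have been identified with one another. -/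
structure IsListUpToSign (n : ℕ) [NeZero n] (β : ℂ) (S L : Set Label) : Prop where
  subset : L ⊆ S
  exists_iso : ∀ s ∈ S, ∃ t ∈ L, t.1 = s.1 ∧ (t.2 = s.2 ∨ t.2 = -s.2 ∨ s.1 = n) ∧
    PeriodicIso n β s t
  irredundant : ∀ s ∈ L, 0 < s.1 → (s.1, -s.2) ∉ L

/-- The labels `(d, ν_d e^{2πir/d})` with `0 ≤ r < d`, `1 ≤ d ≤ n` and `d ≡ n mod 2`. -/
def affineList (n : ℕ) (ν : ℕ → ℂ) : Set Label :=
  {s | 1 ≤ s.1 ∧ s.1 ≤ n ∧ s.1 ≡ n [MOD 2] ∧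
    ∃ r : ℕ, r < s.1 ∧ (s.2 : ℂ) = ν s.1 * Complex.exp (2 * Real.pi * Complex.I * r / s.1)}

/-- The label `(n, 1)` and the labels `(d, ν_d e^{πir/d})` with `0 ≤ r < d`, `1 ≤ d ≤ n - 2` and
`d ≡ n mod 2`. -/
def periodicListOdd (n : ℕ) (ν : ℕ → ℂ) : Set Label :=
  {(n, 1)} ∪ {s | 1 ≤ s.1 ∧ s.1 + 2 ≤ n ∧ s.1 ≡ n [MOD 2] ∧
    ∃ r : ℕ, r < s.1 ∧ (s.2 : ℂ) = ν s.1 * Complex.exp (Real.pi * Complex.I * r / s.1)}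

/-- The label `(n, 1)` and the labels `(d, ν_d e^{2πir/d})` with `0 ≤ r < d/2`, `1 ≤ d ≤ n - 2` and
`d ≡ n mod 2`. -/
def periodicListEven (n : ℕ) (ν : ℕ → ℂ) : Set Label :=
  {(n, 1)} ∪ {s | 1 ≤ s.1 ∧ s.1 + 2 ≤ n ∧ s.1 ≡ n [MOD 2] ∧
    ∃ r : ℕ, 2 * r < s.1 ∧ (s.2 : ℂ) = ν s.1 * Complex.exp (2 * Real.pi * Complex.I * r / s.1)}

/-- The labels `(0, z)` for which the fugacity `z + z⁻¹` of non-contractible loops is `α`. -/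
def loopLabels (α : ℂ) : Set Label := {s | s.1 = 0 ∧ (s.2 : ℂ) + (s.2 : ℂ)⁻¹ = α}

/-- The labels `(0, z)` with `z + z⁻¹ = 0` if `β = 0`, and no label otherwise: here all loops have
weight zero. -/
def degenerateLabels (β : ℂ) : Set Label := {s ∈ loopLabels 0 | β = 0}

end AffineTL

/-!
The relations of a quotient have to hold in a standard module `W_{n,d,z}`, and they are evaluated
there on the basis of link states.

*The module structure.* Every generator maps a link state to a multiple of a link state, and the
multiple is described by `wt`: it depends on whether the cap of `e_j` meets two defects
(`wt_zero`), a contractible loop (`wt_loop`), a non-contractible loop (`wt_noncontractible`), one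
defect (`wt_defect`) or two arcs (`wt_one`). Disjoint caps commute (`opE_comm`) because the paths
through both caps do not depend on the order. The cubic relation holds because `e_{j ± 1}` slides a
short arc from `j`, `j + 1` to its own cap and `e_j` slides it back (`next_next_of_linked`); in the
same way, `e_{n-1} ⋯ e_2` moves the short arc made by `e_1` around the cylinder, which is a rotation
by two steps (`opOm_sq_mul_opE`).

*The quotients.* A full turn `Ω^n` is the scalar `z ^ d` (`opOm_pow_n`). The periodic unwinding
relations are turned into affine ones by `Ω² e_j = e_{j+n-2} ⋯ e_j`: the word
`e_0 (e_{n-1} ⋯ e_0)^k` is `Ω^n e_0` for `k = (n - 2) / 2` and `Ω^{2n} e_0` for `k = n - 2`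
(`unwind_even`, `unwind_odd`). So they only constrain `z` if `e_0` does not act as zero, and for
`n ≥ 3` it acts as zero exactly if `d = n` (`actE_zero_eq_zero_iff`); for `n = 2` one has `e_0 = E`.
The product `E` makes all the short arcs from `2 k` to `2 k + 1`. So it vanishes if there are
defects, and without defects it maps everything to multiples of one link state, on which `E Ω` and
`E F` are the loop weight `z + z⁻¹` and its square (`even_mul_opOm_mul_even`,
`even_mul_odd_mul_even`). It is zero if and only if all loops have weight zero
(`evenProd_eq_zero_iff`).

*The isomorphisms.* The sign of a link state is `-1` to the number of arcs across the boundary of the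
box. Multiplication by it changes `z` to `-z` in the action of all `e_j` (`sign_next_mul_wt`):
joining strands preserves the parity of the number of crossings, of which the
crossings by defects are counted by `z` and a non-contractible loop takes one away.
-/

namespace AffineTL

/-! ### Caps, joined link states and weights -/

section Cap

/-- The node `x` is, modulo `n`, one of the two nodes `j` and `j + 1` joined by `e_j`. -/
def OnCap (n : ℕ) (j x : ℤ) : Prop := x ≡ j [ZMOD n] ∨ x ≡ j + 1 [ZMOD n]

/-- The node at the other end of the cap of `e_j` at `x`; meaningful if `OnCap n j x`. -/
def capFun (n : ℕ) (j x : ℤ) : ℤ := if x ≡ j [ZMOD n] then x + 1 else x - 1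

variable {n d : ℕ} {p : ℤ → ℤ} {i j k x y : ℤ}

theorem not_succ_modEq (hn : 2 ≤ n) (j : ℤ) : ¬ j + 1 ≡ j [ZMOD n] := by
  intro hc
  have h1 : (n : ℤ) ∣ 1 := by simpa using hc.symm.dvd
  have := Int.eq_one_of_dvd_one (Int.natCast_nonneg n) h1
  omega

theorem onCap_of_modEq (h : x ≡ y [ZMOD n]) : OnCap n j x ↔ OnCap n j y :=
  or_congr ⟨h.symm.trans, h.trans⟩ ⟨h.symm.trans, h.trans⟩

theorem onCap_left (n : ℕ) (j : ℤ) : OnCap n j j := Or.inl rfl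

theorem onCap_right (n : ℕ) (j : ℤ) : OnCap n j (j + 1) := Or.inr rfl

theorem OnCap.cap (h : OnCap n j x) : OnCap n j (capFun n j x) := by
  unfold capFun
  split_ifs with h1
  · exact Or.inr (h1.add_right 1)
  · exact Or.inl (by simpa using (h.resolve_left h1).sub_right 1)

theorem capFun_cap (hn : 2 ≤ n) (h : OnCap n j x) : capFun n j (capFun n j x) = x := by
  by_cases h1 : x ≡ j [ZMOD n]
  · have h2 : ¬ x + 1 ≡ j [ZMOD n] := fun hc => not_succ_modEq hn j ((h1.add_right 1).symm.trans hc)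
    simp [capFun, h1, h2]
  · have h2 : x - 1 ≡ j [ZMOD n] := by simpa using (h.resolve_left h1).sub_right 1
    simp [capFun, h1, h2]

theorem capFun_adj (n : ℕ) (j x : ℤ) : capFun n j x = x + 1 ∨ capFun n j x = x - 1 := by
  unfold capFun; split_ifs <;> simp

theorem capFun_ne (n : ℕ) (j x : ℤ) : capFun n j x ≠ x := by
  have := capFun_adj n j x; omega

theorem capFun_not_modEq (hn : 2 ≤ n) (j x : ℤ) : ¬ capFun n j x ≡ x [ZMOD n] := by
  intro hc
  rcases capFun_adj n j x with h | h <;> rw [h] at hc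
  · exact not_succ_modEq hn x hc
  · exact not_succ_modEq hn (x - 1) (by simpa using hc.symm)

theorem capFun_modEq (h : x ≡ y [ZMOD n]) : capFun n j x ≡ capFun n j y [ZMOD n] := by
  have : x ≡ j [ZMOD n] ↔ y ≡ j [ZMOD n] := ⟨h.symm.trans, h.trans⟩
  unfold capFun
  by_cases h1 : y ≡ j [ZMOD n]
  · simpa [this, h1] using h.add_right 1
  · simpa [this, h1] using h.sub_right 1

theorem OnCap.modEq_or (hx : OnCap n j x) (hy : OnCap n j y) :
    y ≡ x [ZMOD n] ∨ y ≡ capFun n j x [ZMOD n] := by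
  by_cases h1 : x ≡ j [ZMOD n]
  · simp only [capFun, if_pos h1]
    exact hy.imp (·.trans h1.symm) (·.trans (h1.add_right 1).symm)
  · simp only [capFun, if_neg h1]
    have h2 := hx.resolve_left h1
    rcases hy with hy | hy
    · right; exact hy.trans (by simpa using (h2.sub_right 1).symm)
    · left; exact hy.trans h2.symm

theorem joinFun_of_onCap (h : OnCap n j i) : joinFun n j p i = capFun n j i := by
  by_cases h1 : i ≡ j [ZMOD n]
  · simp [joinFun, capFun, h1]
  · simp [joinFun, capFun, h1, h.resolve_left h1]

theorem joinFun_of_not (h : ¬ OnCap n j i) (h' : ¬ OnCap n j (p i)) : joinFun n j p i = p i := by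
  simp only [OnCap, not_or] at h h'
  simp [joinFun, h, h']

theorem joinFun_of_defect (h : ¬ OnCap n j i) (h' : OnCap n j (p i))
    (hc : p (capFun n j (p i)) = capFun n j (p i)) : joinFun n j p i = i := by
  simp only [OnCap, not_or] at h h'
  by_cases h1 : p i ≡ j [ZMOD n]
  · simp only [capFun, if_pos h1] at hc
    simp [joinFun, h, h1, hc]
  · have h2 := h'.resolve_left h1
    simp only [capFun, if_neg h1] at hc
    simp [joinFun, h, h1, h2, hc]

theorem joinFun_of_arc (h : ¬ OnCap n j i) (h' : OnCap n j (p i))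
    (hc : p (capFun n j (p i)) ≠ capFun n j (p i)) :
    joinFun n j p i = p (capFun n j (p i)) := by
  simp only [OnCap, not_or] at h h'
  by_cases h1 : p i ≡ j [ZMOD n]
  · simp only [capFun, if_pos h1] at hc ⊢
    simp [joinFun, h, h1, hc]
  · have h2 := h'.resolve_left h1
    simp only [capFun, if_neg h1] at hc ⊢
    simp [joinFun, h, h1, h2, hc]

theorem joinFun_congr (h : j ≡ k [ZMOD n]) : joinFun n j p = joinFun n k p := by
  funext i
  have e1 : ∀ x : ℤ, x ≡ j [ZMOD n] ↔ x ≡ k [ZMOD n] := fun x => ⟨(·.trans h), (·.trans h.symm)⟩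
  have e2 : ∀ x : ℤ, x ≡ j + 1 [ZMOD n] ↔ x ≡ k + 1 [ZMOD n] :=
    fun x => ⟨(·.trans (h.add_right 1)), (·.trans (h.add_right 1).symm)⟩
  simp only [joinFun, e1, e2]

end Cap

section Weight

variable {n d : ℕ} {p : ℤ → ℤ} {β : ℂ} {z : ℂˣ} {i j k x y : ℤ}

theorem cell_add_mul [NeZero n] (i m : ℤ) : cell n (i + n * m) = cell n i + m := by
  have hn : (n : ℤ) ≠ 0 := by exact_mod_cast NeZero.ne n
  unfold cell
  rw [show i + (n : ℤ) * m - 1 = i - 1 + n * m by ring, Int.add_mul_ediv_left _ _ hn]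

theorem cell_mono [NeZero n] {i k : ℤ} (h : i ≤ k) : cell n i ≤ cell n k :=
  Int.ediv_le_ediv (by exact_mod_cast NeZero.pos n) (by omega)

theorem IsLinkState.injective (h : IsLinkState n d p) (hxy : p x = p y) : x = y := by
  rw [← h.involutive x, hxy, h.involutive]

theorem IsLinkState.defect_congr (h : IsLinkState n d p) (hxy : x ≡ y [ZMOD n]) :
    p x = x ↔ p y = y := by
  have := h.modEq hxy; omega

theorem IsLinkState.cell_congr [NeZero n] (h : IsLinkState n d p) (hxy : x ≡ y [ZMOD n]) :
    cell n (p x) - cell n x = cell n (p y) - cell n y := by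
  obtain ⟨m, hm⟩ := hxy.dvd
  obtain rfl : y = x + n * m := by linarith
  rw [h.periodic_mul, cell_add_mul, cell_add_mul]; ring

/-- An arc that connects `x` to a node congruent to the neighbour `x + 1` is either the short arc
or winds once around the cylinder in the other direction. -/
theorem IsLinkState.modEq_succ [NeZero n] (hn : 2 ≤ n) (h : IsLinkState n d p)
    (hx : p x ≡ x + 1 [ZMOD n]) : p x = x + 1 ∨ p x = x + 1 - n := by
  obtain ⟨m, hm⟩ := hx.dvd
  have h1 := h.span x
  have h2 := h.span (p x)
  rw [h.involutive] at h2
  have hn' : (2 : ℤ) ≤ n := by exact_mod_cast hn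
  have m0 : 0 ≤ m := by by_contra hc; nlinarith
  have m1 : m ≤ 1 := by by_contra hc; nlinarith
  obtain rfl | rfl : m = 0 ∨ m = 1 := by omega
  · left; linarith
  · right; linarith

/-- The matrix element of `e_j` at the link state `p`: the prefactor `joinWeight`, or zero if `e_j`
connects two defects. -/
noncomputable def wt (n : ℕ) (β : ℂ) (z : ℂˣ) (j : ℤ) (p : ℤ → ℤ) : ℂ :=
  if p j = j ∧ p (j + 1) = j + 1 then 0 else joinWeight n β z j p

theorem wt_congr [NeZero n] (h : IsLinkState n d p) (hjk : j ≡ k [ZMOD n]) :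
    wt n β z j p = wt n β z k p := by
  obtain ⟨m, hm⟩ := hjk.dvd
  obtain rfl : k = j + n * m := by linarith
  have e1 := h.periodic_mul j m
  have e2 := h.periodic_mul (j + 1) m
  rw [show j + 1 + (n : ℤ) * m = j + n * m + 1 by ring] at e2
  have e3 : cell n (j + n * m + 1) = cell n (j + 1) + m := by
    rw [show j + (n : ℤ) * m + 1 = j + 1 + n * m by ring, cell_add_mul]
  have c1 : p j + n * m = j + n * m ↔ p j = j := by omega
  have c2 : p (j + 1) + n * m = j + n * m + 1 ↔ p (j + 1) = j + 1 := by omega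
  have c3 : p j + n * m = j + n * m + 1 ↔ p j = j + 1 := by omega
  have c4 : p (j + 1) + n * m = j + n * m + n ↔ p (j + 1) = j + n := by omega
  simp only [wt, joinWeight, e1, e2, c1, c2, c3, c4, cell_add_mul, e3, add_sub_add_right_eq_sub]

/-- Case distinction on which end of the cap the node `x` is. -/
theorem OnCap.elim (hx : OnCap n j x) :
    (j ≡ x [ZMOD n] ∧ capFun n j x = x + 1) ∨ (j ≡ x - 1 [ZMOD n] ∧ capFun n j x = x - 1) := by
  by_cases h1 : x ≡ j [ZMOD n]
  · left; exact ⟨h1.symm, by simp [capFun, h1]⟩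
  · right
    exact ⟨by simpa using ((hx.resolve_left h1).sub_right 1).symm, by simp [capFun, h1]⟩

theorem wt_zero [NeZero n] (h : IsLinkState n d p) (hx : OnCap n j x) (h1 : p x = x)
    (h2 : p (capFun n j x) = capFun n j x) : wt n β z j p = 0 := by
  rcases hx.elim with ⟨hj, e⟩ | ⟨hj, e⟩ <;> rw [e] at h2 <;> rw [wt_congr h hj]
  · simp [wt, h1, h2]
  · simp [wt, h1, h2]

theorem wt_loop [NeZero n] (h : IsLinkState n d p) (hx : OnCap n j x) (h1 : p x = capFun n j x) :
    wt n β z j p = β := by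
  rcases hx.elim with ⟨hj, e⟩ | ⟨hj, e⟩ <;> rw [e] at h1 <;> rw [wt_congr h hj]
  · simp [wt, joinWeight, h1]
  · have h2 : p (x - 1) = x := by rw [← h1, h.involutive]
    have h3 : ¬ (p (x - 1) = x - 1 ∧ p (x - 1 + 1) = x - 1 + 1) := by omega
    rw [wt, if_neg h3, joinWeight, if_pos (by omega)]

theorem wt_noncontractible [NeZero n] (hn : 2 ≤ n) (h : IsLinkState n d p) (hx : OnCap n j x)
    (h1 : p x ≠ capFun n j x) (h2 : p x ≡ capFun n j x [ZMOD n]) :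
    wt n β z j p = (z : ℂ) + (z : ℂ)⁻¹ := by
  rcases hx.elim with ⟨hj, e⟩ | ⟨hj, e⟩ <;> rw [e] at h1 h2 <;> rw [wt_congr h hj]
  · have h3 := (h.modEq_succ hn h2).resolve_left h1
    have h4 := h.periodic_mul (p x) 1
    rw [h.involutive, h3] at h4
    rw [show x + 1 - (n : ℤ) + n * 1 = x + 1 by ring] at h4
    have h5 : p x ≠ x := by omega
    simp [wt, joinWeight, h1, h4, h5]
  · have h2' : p (x - 1) ≡ (x - 1) + 1 [ZMOD n] := by
      rw [← modEq_p_iff h, h.involutive]; simpa using h2.symm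
    have h3 : p (x - 1) ≠ x := fun hc => h1 (by rw [← h.involutive (x - 1), hc])
    have h3' := (h.modEq_succ hn h2').resolve_left (by simpa using h3)
    have h4 := h.periodic_mul (p (x - 1)) 1
    rw [h.involutive, h3'] at h4
    rw [show x - 1 + 1 - (n : ℤ) + n * 1 = x by ring] at h4
    have h5 : p (x - 1) ≠ x - 1 := by omega
    have h6 : p x = x - 1 + n := by rw [h4]; ring
    simp [wt, joinWeight, h3, h5, h6]

theorem wt_defect [NeZero n] (hn : 2 ≤ n) (h : IsLinkState n d p) (hx : OnCap n j x)
    (h1 : p x = x) (h2 : p (capFun n j x) ≠ capFun n j x) :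
    wt n β z j p = (z : ℂ) ^ (cell n x - cell n (p (capFun n j x))) := by
  -- the other end of the cap is not connected to a copy of the defect
  have key : ∀ m : ℤ, p (capFun n j x) ≠ x + n * m := by
    intro m hc
    have := h.periodic_mul x m
    rw [← hc, h.involutive, h1] at this
    apply h2; rw [hc, this]
  have k0 := key 0
  have k1 := key 1
  rcases hx.elim with ⟨hj, e⟩ | ⟨hj, e⟩ <;> rw [e] at h2 k0 k1 ⊢ <;> rw [wt_congr h hj]
  · have : p (x + 1) ≠ x + n := by simpa using k1
    simp [wt, joinWeight, h1, h2, this]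
  · have h3 : p (x - 1) ≠ x := by simpa using k0
    have h5 : x ≠ x - 1 + n := by omega
    simp [wt, joinWeight, h1, h2, h3, h5]

theorem wt_one [NeZero n] (h : IsLinkState n d p) (hx : OnCap n j x)
    (h1 : p x ≠ x) (h2 : p (capFun n j x) ≠ capFun n j x) (h3 : ¬ p x ≡ capFun n j x [ZMOD n]) :
    wt n β z j p = 1 := by
  have key : ¬ p (capFun n j x) ≡ x [ZMOD n] := fun hc => h3 (by
    rw [← modEq_p_iff h, h.involutive]; exact hc.symm)
  rcases hx.elim with ⟨hj, e⟩ | ⟨hj, e⟩ <;> rw [e] at h2 h3 key <;> rw [wt_congr h hj]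
  · have h4 : p x ≠ x + 1 := fun hc => h3 (by rw [hc])
    have h5 : p (x + 1) ≠ x + n := fun hc => key (by rw [hc]; simp)
    simp [wt, joinWeight, h1, h2, h4, h5]
  · have h4 : p (x - 1) ≠ x := fun hc => key (by rw [hc])
    have h5 : p x ≠ x - 1 + n := fun hc => h3 (by rw [hc]; simp)
    simp [wt, joinWeight, h1, h2, h4, h5]

/-- The connections of a link state, as a function on the nodes of the universal cover. -/
def LinkState.fn (w : LinkState n d) : ℤ → ℤ := w.1

theorem LinkState.isLinkState (w : LinkState n d) : IsLinkState n d w.fn := w.2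

/-- The link state with given connections. -/
def LinkState.of (p : ℤ → ℤ) (h : IsLinkState n d p) : LinkState n d := ⟨p, h⟩

@[simp] theorem LinkState.of_fn (h : IsLinkState n d p) : (LinkState.of p h).fn = p := rfl

theorem LinkState.ext_fn {v w : LinkState n d} (h : v.fn = w.fn) : v = w := Subtype.ext h

open Classical in
/-- The link state that `e_j` makes of `w`; it is set to `w` if `e_j` connects two defects. -/
noncomputable def LinkState.next [NeZero n] (j : ℤ) (w : LinkState n d) : LinkState n d :=
  if h : w.fn j = j ∧ w.fn (j + 1) = j + 1 then w else .of (joinFun n j w.fn) (w.isLinkState.join h)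

/-- The link state `w` moved by `s` steps to the left. -/
def LinkState.rot (s : ℤ) (w : LinkState n d) : LinkState n d :=
  .of (rotFun s w.fn) (w.isLinkState.rot s)

theorem LinkState.next_fn [NeZero n] {w : LinkState n d}
    (h : ¬ (w.fn j = j ∧ w.fn (j + 1) = j + 1)) : (w.next j).fn = joinFun n j w.fn := by
  rw [LinkState.next, dif_neg h, LinkState.of_fn]

theorem opE_single [NeZero n] (j : ℤ) (w : LinkState n d) (c : ℂ) :
    opE n d β z j (Finsupp.single w c) = Finsupp.single (w.next j) (c * wt n β z j w.fn) := by
  refine (Finsupp.linearCombination_single _ _ _).trans ?_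
  by_cases h : w.fn j = j ∧ w.fn (j + 1) = j + 1
  · rw [wt, if_pos h, mul_zero, Finsupp.single_zero]
    exact (congrArg (c • ·) (dif_pos h)).trans (smul_zero _)
  · rw [wt, if_neg h, LinkState.next, dif_neg h]
    exact (congrArg (c • ·) (dif_neg h)).trans (Finsupp.smul_single _ _ _)

theorem opE_congr [NeZero n] (hjk : j ≡ k [ZMOD n]) : opE n d β z j = opE n d β z k := by
  refine Finsupp.lhom_ext fun w c => ?_
  rw [opE_single, opE_single, wt_congr w.isLinkState hjk]
  congr 1
  have c1 := w.isLinkState.defect_congr hjk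
  have c2 := w.isLinkState.defect_congr (hjk.add_right 1)
  by_cases h : w.fn j = j ∧ w.fn (j + 1) = j + 1
  · rw [LinkState.next, LinkState.next, dif_pos h, dif_pos ⟨c1.1 h.1, c2.1 h.2⟩]
  · apply LinkState.ext_fn
    rw [LinkState.next_fn h, LinkState.next_fn (by rwa [← c1, ← c2]), joinFun_congr hjk]

theorem opOm_single (w : LinkState n d) (c : ℂ) :
    opOm n d z (Finsupp.single w c) =
      Finsupp.single (w.rot 1) (c * if w.fn 1 = 1 then (z : ℂ) else 1) :=
  (Finsupp.linearCombination_single _ _ _).trans (Finsupp.smul_single _ _ _)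

theorem opOmInv_single (w : LinkState n d) (c : ℂ) :
    opOmInv n d z (Finsupp.single w c) =
      Finsupp.single (w.rot (-1)) (c * if w.fn 0 = 0 then (z : ℂ)⁻¹ else 1) :=
  (Finsupp.linearCombination_single _ _ _).trans (Finsupp.smul_single _ _ _)

end Weight

/-! ### The Temperley--Lieb relations in the standard modules -/

section Relations

variable {n d : ℕ} {p : ℤ → ℤ} {β : ℂ} {z : ℂˣ} {i j k x y : ℤ}

/-- The two ends of the cap of `e_j` are both defects; this can be tested at any representative. -/
theorem both_iff (h : IsLinkState n d p) (hx : OnCap n j x) :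
    (p j = j ∧ p (j + 1) = j + 1) ↔ (p x = x ∧ p (capFun n j x) = capFun n j x) := by
  rcases hx.elim with ⟨hj, e⟩ | ⟨hj, e⟩ <;> rw [e, h.defect_congr hj,
    h.defect_congr (hj.add_right 1)]
  rw [sub_add_cancel, and_comm]

theorem wt_both (h : p j = j ∧ p (j + 1) = j + 1) : wt n β z j p = 0 := if_pos h

theorem next_onCap [NeZero n] {w : LinkState n d}
    (h : ¬ (w.fn j = j ∧ w.fn (j + 1) = j + 1)) (hx : OnCap n j x) :
    (w.next j).fn x = capFun n j x := by
  rw [LinkState.next_fn h, joinFun_of_onCap hx]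

theorem not_both_of_arc [NeZero n] {w : LinkState n d} (hx : OnCap n j x) (h : w.fn x ≠ x) :
    ¬ (w.fn j = j ∧ w.fn (j + 1) = j + 1) := by
  rw [both_iff w.isLinkState hx]; exact fun hc => h hc.1

theorem next_eq_self [NeZero n] {w : LinkState n d}
    (h : ∀ x, OnCap n j x → w.fn x = capFun n j x) : w.next j = w := by
  apply LinkState.ext_fn
  rw [LinkState.next_fn (not_both_of_arc (onCap_left n j)
    (by rw [h _ (onCap_left n j)]; exact capFun_ne n j j))]
  funext x
  by_cases hx : OnCap n j x
  · rw [joinFun_of_onCap hx, h x hx]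
  · refine joinFun_of_not hx fun hc => hx ?_
    have := h _ hc
    rw [w.isLinkState.involutive] at this
    rw [this]; exact hc.cap

theorem opE_mul_self [NeZero n] (j : ℤ) :
    opE n d β z j * opE n d β z j = β • opE n d β z j := by
  refine Finsupp.lhom_ext fun w c => ?_
  rw [Module.End.mul_apply, LinearMap.smul_apply, opE_single, opE_single, Finsupp.smul_single]
  by_cases h : w.fn j = j ∧ w.fn (j + 1) = j + 1
  · simp [wt_both h]
  · have h1 : ∀ x, OnCap n j x → (w.next j).fn x = capFun n j x := fun x => next_onCap h
    rw [next_eq_self h1, wt_loop (w.next j).isLinkState (onCap_left n j)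
      (h1 _ (onCap_left n j)), smul_eq_mul, mul_comm β]

/-- The caps of `e_i` and `e_k` share exactly one node, as is the case for `k = i ± 1`. -/
structure Linked (n : ℕ) (i k : ℤ) : Prop where
  left : ∀ x, OnCap n i x → (OnCap n k x ↔ ¬ OnCap n k (capFun n i x))
  right : ∀ x, OnCap n k x → (OnCap n i x ↔ ¬ OnCap n i (capFun n k x))

theorem Linked.symm (h : Linked n i k) : Linked n k i := ⟨h.right, h.left⟩

theorem linked_succ (hn : 3 ≤ n) (i : ℤ) : Linked n i (i + 1) := by
  have a : ∀ {x : ℤ}, x + 1 ≡ x [ZMOD n] ↔ False := iff_false_intro (not_succ_modEq (by omega) _)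
  have b : ∀ {x : ℤ}, x + 2 ≡ x [ZMOD n] ↔ False := iff_false_intro fun hc => by
    have h1 : (n : ℤ) ∣ 2 := by simpa using hc.symm.dvd
    have := Int.le_of_dvd (by norm_num) h1
    omega
  have a' : ∀ {x : ℤ}, x ≡ x + 1 [ZMOD n] ↔ False := Int.modEq_comm.trans a
  have b' : ∀ {x : ℤ}, x ≡ x + 2 [ZMOD n] ↔ False := Int.modEq_comm.trans b
  have e : ∀ {x : ℤ}, x + 1 + 1 = x + 2 := by intro x; ring
  have b2 : ∀ {x : ℤ}, x + 2 ≡ x + 1 [ZMOD n] ↔ False := by intro x; rw [← e]; exact a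
  constructor
  · intro x hx
    rcases hx with hx | hx
    · rw [onCap_of_modEq hx, onCap_of_modEq (capFun_modEq hx)]
      simp [OnCap, capFun, e, a', b']
    · rw [onCap_of_modEq hx, onCap_of_modEq (capFun_modEq hx)]
      simp [OnCap, capFun, e, a, a', b']
  · intro x hx
    rcases hx with hx | hx
    · rw [onCap_of_modEq hx, onCap_of_modEq (capFun_modEq hx)]
      simp [OnCap, capFun, e, b, b2]
    · rw [onCap_of_modEq hx, onCap_of_modEq (capFun_modEq hx)]
      have e' : i + 2 - 1 = i + 1 := by ring
      simp [OnCap, capFun, e, e', b, b2]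

/-- If `v` contains the short arc at the cap of `e_i`, then `e_i e_k v = v`: first `e_k` slides the
short arc to its own cap, and then `e_i` slides it back. -/
theorem next_next_of_linked [NeZero n] (hn : 2 ≤ n) (hl : Linked n i k) {v : LinkState n d}
    (hv : ∀ x, OnCap n i x → v.fn x = capFun n i x) :
    (v.next k).next i = v ∧ wt n β z k v.fn * wt n β z i (v.next k).fn = 1 := by
  -- a node `x` on both caps, its neighbour `a` on the first cap and `b` on the second
  obtain ⟨x, xi, xk⟩ : ∃ x, OnCap n i x ∧ OnCap n k x := by
    by_cases h1 : OnCap n k i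
    · exact ⟨i, onCap_left n i, h1⟩
    · refine ⟨capFun n i i, (onCap_left n i).cap, ?_⟩
      exact not_not.1 fun hc => h1 ((hl.left i (onCap_left n i)).2 hc)
  have hv' : ∀ x, OnCap n i (v.fn x) → OnCap n i x := fun x hx => by
    have := hv _ hx
    rw [v.isLinkState.involutive] at this
    rw [this]; exact hx.cap
  have vx : ∀ {x}, OnCap n i x → v.fn x ≠ x := fun hx => by
    rw [hv _ hx]; exact capFun_ne n i _
  have h1 : ¬ (v.fn k = k ∧ v.fn (k + 1) = k + 1) := not_both_of_arc xk (vx xi)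
  have uk : ∀ y, OnCap n k y → (v.next k).fn y = capFun n k y := fun y => next_onCap h1
  have ux : ∀ {y}, OnCap n k y → (v.next k).fn y ≠ y := fun hy => by
    rw [uk _ hy]; exact capFun_ne n k _
  have h2 : ¬ ((v.next k).fn i = i ∧ (v.next k).fn (i + 1) = i + 1) := not_both_of_arc xi (ux xk)
  -- the values of `e_k v` at the free end of the first cap
  have ua : ∀ y, OnCap n i y → OnCap n k y →
      (v.fn (capFun n k y) = capFun n k y → (v.next k).fn (capFun n i y) = capFun n i y) ∧
      (v.fn (capFun n k y) ≠ capFun n k y →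
        (v.next k).fn (capFun n i y) = v.fn (capFun n k y) ∧
          v.fn (capFun n k y) ≠ capFun n i y) := by
    intro y yi yk
    have ak := (hl.left y yi).1 yk
    have va : v.fn (capFun n i y) = y := by rw [hv _ yi.cap, capFun_cap hn yi]
    refine ⟨fun hb => ?_, fun hb => ⟨?_, fun hc => ?_⟩⟩
    · rw [LinkState.next_fn h1, joinFun_of_defect ak (by rwa [va]) (by rwa [va])]
    · rw [LinkState.next_fn h1, joinFun_of_arc ak (by rwa [va]) (by rwa [va]), va]
    · have : capFun n k y = y := by rw [← v.isLinkState.involutive (capFun n k y), hc, va]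
      exact capFun_ne n k y this
  constructor
  · apply LinkState.ext_fn
    rw [LinkState.next_fn h2]
    funext m
    by_cases mi : OnCap n i m
    · rw [joinFun_of_onCap mi, hv m mi]
    by_cases mk : OnCap n k m
    · have yi : OnCap n i (capFun n k m) := by
        exact not_not.1 fun hc => mi ((hl.right m mk).2 hc)
      have um := uk m mk
      obtain ⟨c1, c2⟩ := ua (capFun n k m) yi mk.cap
      rw [capFun_cap hn mk] at c1 c2
      by_cases vm : v.fn m = m
      · rw [joinFun_of_defect mi (by rwa [um]) (by rw [um]; exact c1 vm), vm]
      · obtain ⟨c3, c4⟩ := c2 vm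
        rw [joinFun_of_arc mi (by rwa [um]) (by rw [um, c3]; exact c4), um, c3]
    by_cases vk : OnCap n k (v.fn m)
    · have bi : ¬ OnCap n i (v.fn m) := fun hc => mi (hv' _ hc)
      have yi : OnCap n i (capFun n k (v.fn m)) := by
        exact not_not.1 fun hc => bi ((hl.right _ vk).2 hc)
      have um : (v.next k).fn m = capFun n i (capFun n k (v.fn m)) := by
        rw [LinkState.next_fn h1, joinFun_of_arc mk vk (vx yi), hv _ yi]
      have uy := uk _ vk.cap
      rw [capFun_cap hn vk] at uy
      rw [joinFun_of_arc mi (by rw [um]; exact yi.cap)]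
      · rw [um, capFun_cap hn yi, uy]
      · rw [um, capFun_cap hn yi]; exact ux vk.cap
    · have um : (v.next k).fn m = v.fn m := by
        rw [LinkState.next_fn h1, joinFun_of_not mk vk]
      rw [joinFun_of_not mi (by rw [um]; exact fun hc => mi (hv' _ hc)), um]
  · have ab : ¬ capFun n i x ≡ capFun n k x [ZMOD n] := fun hc => by
      have := (hl.left x xi).1 xk
      rw [onCap_of_modEq hc] at this
      exact this xk.cap
    obtain ⟨c1, c2⟩ := ua x xi xk
    have e1 := hv x xi
    have e2 := uk x xk
    by_cases hb : v.fn (capFun n k x) = capFun n k x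
    · rw [wt_defect hn v.isLinkState xk.cap hb (by rw [capFun_cap hn xk]; exact vx xi),
        wt_defect hn (v.next k).isLinkState xi.cap (c1 hb)
          (by rw [capFun_cap hn xi]; exact ux xk), capFun_cap hn xk, capFun_cap hn xi, e1, e2,
        ← zpow_add₀ z.ne_zero]
      simp
    · obtain ⟨c3, c4⟩ := c2 hb
      rw [wt_one v.isLinkState xk (vx xi) hb (by rwa [e1]),
        wt_one (v.next k).isLinkState xi (ux xk) (by rw [c3]; exact c4)
          (by rw [e2]; exact fun hc => ab hc.symm), mul_one]

theorem opE_cubic [NeZero n] (hn : 2 ≤ n) (hl : Linked n i k) :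
    opE n d β z i * opE n d β z k * opE n d β z i = opE n d β z i := by
  refine Finsupp.lhom_ext fun w c => ?_
  rw [Module.End.mul_apply, Module.End.mul_apply, opE_single, opE_single, opE_single]
  by_cases h : w.fn i = i ∧ w.fn (i + 1) = i + 1
  · simp [wt_both h]
  · obtain ⟨e1, e2⟩ := next_next_of_linked (β := β) (z := z) hn hl (v := w.next i)
      fun x => next_onCap h
    rw [e1, mul_assoc, e2, mul_one]

/-- Disjoint caps can be attached in any order. -/
theorem joinFun_comm (hn : 2 ≤ n) (h : IsLinkState n d p)
    (hd : ∀ x, OnCap n i x → ¬ OnCap n k x) :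
    joinFun n i (joinFun n k p) = joinFun n k (joinFun n i p) := by
  have hd' : ∀ x, OnCap n k x → ¬ OnCap n i x := fun x h1 h2 => hd x h2 h1
  -- the path from `m` enters the cap of `e_k`, and then possibly that of `e_i`
  have key : ∀ i k : ℤ, (∀ x, OnCap n i x → ¬ OnCap n k x) → ∀ m, ¬ OnCap n i m → ¬ OnCap n k m →
      OnCap n k (p m) → joinFun n i (joinFun n k p) m = joinFun n k (joinFun n i p) m := by
    intro i k hd m mi mk bk
    have hd' : ∀ x, OnCap n k x → ¬ OnCap n i x := fun x h1 h2 => hd x h2 h1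
    have rb : joinFun n i p m = p m := joinFun_of_not mi (hd' _ bk)
    have b'i : ¬ OnCap n i (capFun n k (p m)) := hd' _ bk.cap
    by_cases b1 : p (capFun n k (p m)) = capFun n k (p m)
    · have qm := joinFun_of_defect mk bk b1
      have rb' : joinFun n i p (capFun n k (p m)) = capFun n k (p m) := by
        rw [joinFun_of_not b'i (by rwa [b1]), b1]
      rw [joinFun_of_not mi (by rwa [qm]), qm, joinFun_of_defect mk (by rwa [rb]) (by rwa [rb])]
    · have qm := joinFun_of_arc mk bk b1
      by_cases ci : OnCap n i (p (capFun n k (p m)))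
      · set b' := capFun n k (p m)
        set c' := capFun n i (p b')
        have c'k : ¬ OnCap n k c' := hd _ ci.cap
        by_cases c1 : p c' = c'
        · have qc : joinFun n k p c' = c' := by rw [joinFun_of_not c'k (by rwa [c1]), c1]
          have rb' : joinFun n i p b' = b' := joinFun_of_defect b'i ci c1
          rw [joinFun_of_defect mi (by rwa [qm]) (by rwa [qm]),
            joinFun_of_defect mk (by rwa [rb]) (by rwa [rb])]
        · have rb' : joinFun n i p b' = p c' := joinFun_of_arc b'i ci c1
          have ek : ¬ OnCap n k (p c') := fun hc => by
            rcases bk.modEq_or hc with h1 | h1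
            · have := modEq_p h h1
              rw [h.involutive, h.involutive] at this
              exact mi ((onCap_of_modEq this).1 ci.cap)
            · have := modEq_p h h1
              rw [h.involutive] at this
              exact capFun_not_modEq hn i (p b') this
          have qc : joinFun n k p c' = p c' := joinFun_of_not c'k ek
          have e1 : p c' ≠ b' := fun hc => ek (hc ▸ bk.cap)
          rw [joinFun_of_arc mi (by rwa [qm]) (by rw [qm, qc]; exact c1), qm, qc,
            joinFun_of_arc mk (by rwa [rb]) (by rw [rb, rb']; exact e1), rb, rb']
      · have rb' : joinFun n i p (capFun n k (p m)) = p (capFun n k (p m)) := joinFun_of_not b'i ci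
        rw [joinFun_of_not mi (by rwa [qm]), qm,
          joinFun_of_arc mk (by rwa [rb]) (by rwa [rb, rb']), rb, rb']
  funext m
  by_cases mi : OnCap n i m
  · rw [joinFun_of_onCap mi, joinFun_of_not (hd _ mi), joinFun_of_onCap mi]
    rw [joinFun_of_onCap mi]; exact hd _ mi.cap
  by_cases mk : OnCap n k m
  · rw [joinFun_of_onCap mk, joinFun_of_not (hd' _ mk), joinFun_of_onCap mk]
    rw [joinFun_of_onCap mk]; exact hd' _ mk.cap
  by_cases bk : OnCap n k (p m)
  · exact key i k hd m mi mk bk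
  by_cases bi : OnCap n i (p m)
  · exact (key k i hd' m mk mi bi).symm
  have q1 : joinFun n k p m = p m := joinFun_of_not mk bk
  have q2 : joinFun n i p m = p m := joinFun_of_not mi bi
  exact (joinFun_of_not mi (by rwa [q1])).trans
    (q1.trans (q2.symm.trans (joinFun_of_not mk (by rwa [q2])).symm))

/-- The weight of two disjoint caps connected by an arc from `b` to `p b`. The right-hand side is
symmetric in the two caps. -/
theorem wt_mul_wt [NeZero n] (hn : 2 ≤ n) {w : LinkState n d} {b b' c' : ℤ}
    (hd : ∀ x, OnCap n i x → ¬ OnCap n k x) (hb : OnCap n k b) (hc : OnCap n i (w.fn b))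
    (eb : b' = capFun n k b) (ec : c' = capFun n i (w.fn b)) :
    wt n β z k w.fn * wt n β z i (w.next k).fn =
      if w.fn b' = b' then
        if w.fn c' = c' then 0 else (z : ℂ) ^ (cell n b' - cell n (w.fn c'))
      else if w.fn c' = c' then (z : ℂ) ^ (cell n c' - cell n (w.fn b'))
      else if w.fn b' = c' then β
      else if w.fn b' ≡ c' [ZMOD n] then (z : ℂ) + (z : ℂ)⁻¹ else 1 := by
  subst eb ec
  have h := w.isLinkState
  have hq := (w.next k).isLinkState
  set p := w.fn with hp
  set c := p b with hcb
  have pc : p c = b := h.involutive b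
  have cb : p b ≠ b := fun h1 => hd _ hc (by rwa [hcb, h1])
  have hB : ¬ (p k = k ∧ p (k + 1) = k + 1) := not_both_of_arc hb cb
  have qval : (w.next k).fn = joinFun n k p := LinkState.next_fn hB
  set q := (w.next k).fn
  have ck := hd _ hc
  have c'k := hd _ hc.cap
  have hnc : ¬ p b ≡ capFun n k b [ZMOD n] := fun h1 => ck ((onCap_of_modEq h1).2 hb.cap)
  have pc'b : ¬ p (capFun n i c) ≡ b [ZMOD n] := fun h1 => by
    have := modEq_p h h1
    rw [h.involutive] at this
    exact capFun_not_modEq hn i c this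
  -- the value of `q` at the node `c'` if the partner of `c'` is not on the first cap
  have qc' : ¬ p (capFun n i c) ≡ capFun n k b [ZMOD n] → q (capFun n i c) = p (capFun n i c) :=
    fun h1 => by
      rw [qval, joinFun_of_not c'k fun h2 => (hb.modEq_or h2).elim pc'b h1]
  by_cases h1 : p (capFun n k b) = capFun n k b
  · have qc : q c = c := by
      rw [qval, joinFun_of_defect ck (by rwa [pc]) (by rwa [pc])]
    have h3 : ¬ p (capFun n i c) ≡ capFun n k b [ZMOD n] := fun h3 => by
      have := modEq_p h h3
      rw [h.involutive, h1] at this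
      exact c'k ((onCap_of_modEq this).2 hb.cap)
    rw [if_pos h1]
    by_cases h2 : p (capFun n i c) = capFun n i c
    · rw [if_pos h2, wt_zero hq hc qc (by rw [qc' h3, h2]), mul_zero]
    · rw [if_neg h2, wt_defect hn h hb.cap h1 (by rwa [capFun_cap hn hb]), capFun_cap hn hb,
        wt_defect hn hq hc qc (by rwa [qc' h3]), qc' h3, ← zpow_add₀ z.ne_zero]
      congr 1; ring
  · have qc : q c = p (capFun n k b) := by
      rw [qval, joinFun_of_arc ck (by rwa [pc]) (by rwa [pc]), pc]
    have qcc : q c ≠ c := fun h2 => by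
      have := h.injective (qc.symm.trans (h2.trans hcb))
      exact capFun_ne n k b this
    rw [if_neg h1, wt_one h hb cb h1 hnc, one_mul]
    by_cases h2 : p (capFun n i c) = capFun n i c
    · have h3 : ¬ p (capFun n i c) ≡ capFun n k b [ZMOD n] := fun h3 =>
        c'k ((onCap_of_modEq (h2 ▸ h3)).2 hb.cap)
      rw [if_pos h2, wt_defect hn hq hc.cap (by rw [qc' h3, h2]) (by rwa [capFun_cap hn hc]),
        capFun_cap hn hc, qc]
    · rw [if_neg h2]
      by_cases h4 : p (capFun n k b) = capFun n i c
      · rw [if_pos h4, wt_loop hq hc (by rw [qc, h4])]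
      rw [if_neg h4]
      by_cases h5 : p (capFun n k b) ≡ capFun n i c [ZMOD n]
      · rw [if_pos h5, wt_noncontractible hn hq hc (by rwa [qc]) (by rwa [qc])]
      · have h3 : ¬ p (capFun n i c) ≡ capFun n k b [ZMOD n] := fun h3 => h5 (by
          rw [← modEq_p_iff h, h.involutive]; exact h3.symm)
        rw [if_neg h5, wt_one hq hc qcc (by rwa [qc' h3]) (by rwa [qc])]

theorem wt_mul_wt_comm [NeZero n] (hn : 2 ≤ n) {w : LinkState n d}
    (hd : ∀ x, OnCap n i x → ¬ OnCap n k x) :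
    wt n β z k w.fn * wt n β z i (w.next k).fn = wt n β z i w.fn * wt n β z k (w.next i).fn := by
  have h := w.isLinkState
  have hd' : ∀ x, OnCap n k x → ¬ OnCap n i x := fun x h1 h2 => hd x h2 h1
  by_cases hx : ∃ b, OnCap n k b ∧ OnCap n i (w.fn b)
  · obtain ⟨b, hb, hc⟩ := hx
    rw [wt_mul_wt hn hd hb hc rfl rfl,
      wt_mul_wt hn hd' hc (by rwa [h.involutive]) rfl (by rw [h.involutive])]
    set b' := capFun n k b
    set c' := capFun n i (w.fn b)
    have e1 : w.fn b' = c' ↔ w.fn c' = b' :=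
      ⟨fun e => by rw [← e, h.involutive], fun e => by rw [← e, h.involutive]⟩
    have e2 : w.fn b' ≡ c' [ZMOD n] ↔ w.fn c' ≡ b' [ZMOD n] := by
      rw [← modEq_p_iff h, h.involutive]; exact Int.modEq_comm
    simp only [e1, e2]
    split_ifs <;> rfl
  · -- no arc connects the two caps, so that neither of them sees the other
    push Not at hx
    have one : ∀ i k : ℤ, (∀ x, OnCap n i x → ¬ OnCap n k x) →
        (∀ b, OnCap n k b → ¬ OnCap n i (w.fn b)) →
        wt n β z i (w.next k).fn = wt n β z i w.fn := by
      intro i k hd hx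
      by_cases hB : w.fn k = k ∧ w.fn (k + 1) = k + 1
      · rw [LinkState.next, dif_pos hB]
      have qv : ∀ y, OnCap n i y → (w.next k).fn y = w.fn y := fun y hy => by
        rw [LinkState.next_fn hB]
        refine joinFun_of_not (hd y hy) fun hc => hx _ hc (by rwa [h.involutive])
      simp only [wt, joinWeight, qv _ (onCap_left n i), qv _ (onCap_right n i)]
    rw [one i k hd hx, one k i hd' fun b hb hc => hx _ hc (by rwa [h.involutive]), mul_comm]

theorem opE_comm [NeZero n] (hn : 2 ≤ n) (hd : ∀ x, OnCap n i x → ¬ OnCap n k x) :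
    opE n d β z i * opE n d β z k = opE n d β z k * opE n d β z i := by
  refine Finsupp.lhom_ext fun w c => ?_
  rw [Module.End.mul_apply, Module.End.mul_apply, opE_single, opE_single, opE_single, opE_single,
    mul_assoc, mul_assoc]
  have hw := wt_mul_wt_comm (β := β) (z := z) hn (w := w) hd
  by_cases h0 : wt n β z k w.fn * wt n β z i (w.next k).fn = 0
  · rw [← hw, h0]; simp
  have h0' := h0
  rw [hw] at h0'
  rw [hw]
  congr 1
  apply LinkState.ext_fn
  have nb : ∀ {j : ℤ} {p : ℤ → ℤ}, wt n β z j p ≠ 0 → ¬ (p j = j ∧ p (j + 1) = j + 1) :=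
    fun h1 h2 => h1 (wt_both h2)
  rw [LinkState.next_fn (nb (right_ne_zero_of_mul h0)), LinkState.next_fn (nb (left_ne_zero_of_mul h0)),
    LinkState.next_fn (nb (right_ne_zero_of_mul h0')),
    LinkState.next_fn (nb (left_ne_zero_of_mul h0'))]
  exact joinFun_comm hn w.isLinkState hd

/-- On a single node there is only the defect, so that `e_0 = 0`. -/
theorem opE_of_one [NeZero n] (hn : n = 1) (j : ℤ) : opE n d β z j = 0 := by
  refine Finsupp.lhom_ext fun w c => ?_
  have h := w.isLinkState
  have key : ∀ x, w.fn x = x := fun x => by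
    subst hn
    have h1 := h.span x
    have h2 := h.span (w.fn x)
    rw [h.involutive] at h2
    push_cast at h1 h2; omega
  rw [opE_single, wt_both ⟨key _, key _⟩]
  simp

end Relations

/-! ### Rotation -/

section Rotation

variable {n d : ℕ} {p : ℤ → ℤ} {β : ℂ} {z : ℂˣ} {i j k x y : ℤ}

theorem LinkState.rot_fn (s : ℤ) (w : LinkState n d) (x : ℤ) : (w.rot s).fn x = w.fn (x + s) - s :=
  rfl

theorem LinkState.rot_rot (s t : ℤ) (w : LinkState n d) : (w.rot s).rot t = w.rot (s + t) := by
  apply LinkState.ext_fn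
  funext x
  simp only [LinkState.rot_fn]
  rw [show x + t + s = x + (s + t) by ring]; ring

theorem LinkState.rot_zero (w : LinkState n d) : w.rot 0 = w := by
  apply LinkState.ext_fn
  funext x
  simp [LinkState.rot_fn]

theorem LinkState.rot_period (w : LinkState n d) : w.rot n = w := by
  apply LinkState.ext_fn
  funext x
  rw [LinkState.rot_fn, w.isLinkState.periodic]; ring

theorem opOmInv_mul_opOm : opOmInv n d z * opOm n d z = 1 := by
  refine Finsupp.lhom_ext fun w c => ?_
  rw [Module.End.mul_apply, opOm_single, opOmInv_single, LinkState.rot_rot, Module.End.one_apply]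
  have : (w.rot 1).fn 0 = 0 ↔ w.fn 1 = 1 := by rw [LinkState.rot_fn, zero_add]; omega
  simp only [this, add_neg_cancel, LinkState.rot_zero]
  split_ifs <;> simp

theorem opOm_mul_opOmInv : opOm n d z * opOmInv n d z = 1 := by
  refine Finsupp.lhom_ext fun w c => ?_
  rw [Module.End.mul_apply, opOmInv_single, opOm_single, LinkState.rot_rot, Module.End.one_apply]
  have : (w.rot (-1)).fn 1 = 1 ↔ w.fn 0 = 0 := by rw [LinkState.rot_fn, add_neg_cancel]; omega
  simp only [this, neg_add_cancel, LinkState.rot_zero]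
  split_ifs <;> simp

theorem modEq_shift : x + 1 ≡ j [ZMOD n] ↔ x ≡ j - 1 [ZMOD n] :=
  ⟨fun h => by simpa using h.sub_right 1, fun h => by simpa using h.add_right 1⟩

theorem onCap_shift : OnCap n (j - 1) x ↔ OnCap n j (x + 1) := by
  simp only [OnCap, modEq_shift, sub_add_cancel, add_sub_cancel_right]

theorem capFun_shift : capFun n (j - 1) x = capFun n j (x + 1) - 1 := by
  simp only [capFun, modEq_shift]
  split_ifs <;> ring

theorem joinFun_rot : joinFun n (j - 1) (rotFun 1 p) = rotFun 1 (joinFun n j p) := by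
  funext x
  have e1 : rotFun 1 p x + 1 = p (x + 1) := by simp [rotFun]
  have e2 : ∀ y, rotFun 1 p (capFun n (j - 1) y) = capFun n (j - 1) y ↔
      p (capFun n j (y + 1)) = capFun n j (y + 1) := fun y => by
    rw [capFun_shift, rotFun, sub_add_cancel]; omega
  by_cases h1 : OnCap n (j - 1) x
  · rw [joinFun_of_onCap h1, rotFun, joinFun_of_onCap (onCap_shift.1 h1), capFun_shift]
  by_cases h2 : OnCap n (j - 1) (rotFun 1 p x)
  · have h2' := h2
    rw [onCap_shift, e1] at h2'
    by_cases h3 : rotFun 1 p (capFun n (j - 1) (rotFun 1 p x)) = capFun n (j - 1) (rotFun 1 p x)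
    · have h3' := h3
      rw [e2, e1] at h3'
      rw [joinFun_of_defect h1 h2 h3, rotFun, joinFun_of_defect (by rwa [← onCap_shift]) h2' h3']
      ring
    · have h3' := h3
      rw [e2, e1] at h3'
      rw [joinFun_of_arc h1 h2 h3]
      simp only [rotFun] at e1 ⊢
      rw [joinFun_of_arc (by rwa [← onCap_shift]) h2' h3', capFun_shift, e1, sub_add_cancel]
  · rw [joinFun_of_not h1 h2, rotFun, rotFun, joinFun_of_not (by rwa [← onCap_shift])]
    rwa [← e1, ← onCap_shift]

theorem cell_sub_one [NeZero n] (x : ℤ) :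
    cell n (x - 1) = cell n x - if x ≡ 1 [ZMOD n] then 1 else 0 := by
  have hn : (0 : ℤ) < n := by exact_mod_cast NeZero.pos n
  have e := Int.emod_add_mul_ediv (x - 1) n
  have e' := Int.emod_add_mul_ediv (x - 1 - 1) n
  have l1 := Int.emod_nonneg (x - 1) hn.ne'
  have l2 := Int.emod_lt_of_pos (x - 1) hn
  have l3 := Int.emod_nonneg (x - 1 - 1) hn.ne'
  have l4 := Int.emod_lt_of_pos (x - 1 - 1) hn
  have hx : x ≡ 1 [ZMOD n] ↔ (x - 1) % n = 0 := by
    rw [← Int.dvd_iff_emod_eq_zero, Int.modEq_comm, Int.modEq_iff_dvd]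
  simp only [cell, hx]
  split_ifs with h
  · refine (Int.ediv_eq_iff_of_pos hn).2 ?_
    constructor <;> nlinarith
  · refine (Int.ediv_eq_iff_of_pos hn).2 ?_
    have : 0 < (x - 1) % n := by omega
    constructor <;> nlinarith

/-- If `e_j` meets the defect `x`, this defect moves to the partner of the other end of the cap. -/
theorem next_fixed_of_defect [NeZero n] (hn : 2 ≤ n) {w : LinkState n d} (hx : OnCap n j x)
    (h1 : w.fn x = x) (h2 : w.fn (capFun n j x) ≠ capFun n j x) (m : ℤ) :
    (w.next j).fn m = m ↔ ¬ m ≡ x [ZMOD n] ∧ (w.fn m = m ∨ w.fn (capFun n j x) ≡ m [ZMOD n]) := by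
  have h := w.isLinkState
  have hB : ¬ (w.fn j = j ∧ w.fn (j + 1) = j + 1) := by
    rw [both_iff h hx]; exact fun hc => h2 hc.2
  rw [LinkState.next_fn hB]
  have e0 : w.fn (capFun n j x) ≡ m [ZMOD n] ↔ w.fn m ≡ capFun n j x [ZMOD n] := by
    rw [← modEq_p_iff h, h.involutive]; exact Int.modEq_comm
  have e1 : w.fn (capFun n j x) ≡ m [ZMOD n] → ¬ m ≡ x [ZMOD n] := fun a b => by
    have := modEq_p h (a.trans b)
    rw [h.involutive, h1] at this
    exact capFun_not_modEq hn j x this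
  have e2 : m ≡ capFun n j x [ZMOD n] → ¬ (w.fn m = m ∨ w.fn (capFun n j x) ≡ m [ZMOD n]) := by
    rintro a (b | b)
    · exact h2 ((h.defect_congr a).1 b)
    · exact h2 (modEq_self_p h (b.trans a))
  rcases hx.elim with ⟨hj, e⟩ | ⟨hj, e⟩ <;> rw [e] at h2 e0 e1 e2 ⊢ <;>
    rw [joinFun_congr hj, joinFun_fixed h] <;> rw [e0] at e1 e2 ⊢
  · tauto
  · rw [sub_add_cancel]; tauto

theorem next_fixed_of_not_defect [NeZero n] {w : LinkState n d}
    (h1 : w.fn j ≠ j) (h2 : w.fn (j + 1) ≠ j + 1) (m : ℤ) :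
    (w.next j).fn m = m ↔ w.fn m = m := by
  have h := w.isLinkState
  rw [LinkState.next_fn fun hc => h1 hc.1, joinFun_fixed h]
  have e1 : m ≡ j [ZMOD n] → w.fn m ≠ m := fun a b => h1 ((h.defect_congr a).1 b)
  have e2 : m ≡ j + 1 [ZMOD n] → w.fn m ≠ m := fun a b => h2 ((h.defect_congr a).1 b)
  tauto

theorem LinkState.rot_one_sub (w : LinkState n d) (x : ℤ) :
    (w.rot 1).fn (x - 1) = w.fn x - 1 := by
  rw [LinkState.rot_fn, sub_add_cancel]

/-- Both sides count the crossings of the boundary by the defects under `Ω e_j = e_{j-1} Ω`. -/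
theorem wt_rot [NeZero n] (hn : 2 ≤ n) {w : LinkState n d}
    (hB : ¬ (w.fn j = j ∧ w.fn (j + 1) = j + 1)) :
    (if w.fn 1 = 1 then (z : ℂ) else 1) * wt n β z (j - 1) (w.rot 1).fn =
      wt n β z j w.fn * if (w.next j).fn 1 = 1 then (z : ℂ) else 1 := by
  have h := w.isLinkState
  have hr := (w.rot 1).isLinkState
  have ro : ∀ {x}, OnCap n j x → OnCap n (j - 1) (x - 1) := fun hx => by
    rwa [onCap_shift, sub_add_cancel]
  have rc : ∀ x, capFun n (j - 1) (x - 1) = capFun n j x - 1 := fun x => by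
    rw [capFun_shift, sub_add_cancel]
  by_cases hD : ∃ x, OnCap n j x ∧ w.fn x = x
  · obtain ⟨x, hx, h1⟩ := hD
    have h2 : w.fn (capFun n j x) ≠ capFun n j x := fun hc => hB ((both_iff h hx).2 ⟨h1, hc⟩)
    have hq := next_fixed_of_defect hn hx h1 h2 1
    rw [wt_defect hn h hx h1 h2, wt_defect hn hr (ro hx) (by rw [w.rot_one_sub, h1])
      (by rw [rc, w.rot_one_sub]; omega), rc, w.rot_one_sub, cell_sub_one, cell_sub_one]
    set y := w.fn (capFun n j x)
    have z0 := z.ne_zero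
    have py : w.fn y = capFun n j x := h.involutive _
    by_cases c1 : x ≡ 1 [ZMOD n]
    · have c2 : ¬ y ≡ 1 [ZMOD n] := fun hc => by
        have := modEq_p h (hc.trans c1.symm)
        rw [py, h1] at this
        exact capFun_not_modEq hn j x this
      have d1 : w.fn 1 = 1 := (h.defect_congr c1).1 h1
      have d2 : ¬ (w.next j).fn 1 = 1 := by rw [hq]; exact fun hc => hc.1 c1.symm
      rw [if_pos c1, if_neg c2, if_pos d1, if_neg d2, mul_one, ← zpow_one_add₀ z0]
      congr 1; ring
    · by_cases c2 : y ≡ 1 [ZMOD n]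
      · have d1 : w.fn 1 ≠ 1 := fun hc => by
          have := (h.defect_congr c2).2 hc
          rw [py] at this
          exact h2 this.symm
        have d2 : (w.next j).fn 1 = 1 := hq.2 ⟨fun hc => c1 hc.symm, Or.inr c2⟩
        rw [if_neg c1, if_pos c2, if_neg d1, if_pos d2, one_mul, ← zpow_add_one₀ z0]
        congr 1; ring
      · have d2 : (w.next j).fn 1 = 1 ↔ w.fn 1 = 1 := by
          rw [hq, Int.modEq_comm]; tauto
        simp only [if_neg c1, if_neg c2, d2, sub_zero]
        rw [mul_comm]
  · push Not at hD
    have hj := onCap_left n j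
    simp only [next_fixed_of_not_defect (hD j hj) (hD _ (onCap_right n j))]
    rw [mul_comm]
    congr 1
    have e1 : (w.rot 1).fn (j - 1) = capFun n (j - 1) (j - 1) ↔ w.fn j = capFun n j j := by
      rw [rc, w.rot_one_sub]; omega
    have e2 : (w.rot 1).fn (j - 1) ≡ capFun n (j - 1) (j - 1) [ZMOD n] ↔
        w.fn j ≡ capFun n j j [ZMOD n] := by
      rw [rc, w.rot_one_sub]
      exact ⟨fun h => by simpa using h.add_right 1, fun h => h.sub_right 1⟩
    by_cases c1 : w.fn j = capFun n j j
    · rw [wt_loop h hj c1, wt_loop hr (ro hj) (e1.2 c1)]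
    by_cases c2 : w.fn j ≡ capFun n j j [ZMOD n]
    · rw [wt_noncontractible hn h hj c1 c2,
        wt_noncontractible hn hr (ro hj) (by rwa [Ne, e1]) (e2.2 c2)]
    · have g1 := hD j hj
      have g2 := hD _ hj.cap
      rw [wt_one h hj g1 g2 c2, wt_one hr (ro hj) (by rw [w.rot_one_sub]; omega)
        (by rw [rc, w.rot_one_sub]; omega) (by rwa [e2])]

theorem opOm_mul_opE [NeZero n] (j : ℤ) :
    opOm n d z * opE n d β z j = opE n d β z (j - 1) * opOm n d z := by
  by_cases hn : n = 1
  · simp [opE_of_one hn]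
  have hn2 : 2 ≤ n := by have := NeZero.pos n; omega
  refine Finsupp.lhom_ext fun w c => ?_
  rw [Module.End.mul_apply, Module.End.mul_apply, opE_single, opOm_single, opOm_single, opE_single]
  have hB' : ((w.rot 1).fn (j - 1) = j - 1 ∧ (w.rot 1).fn (j - 1 + 1) = j - 1 + 1) ↔
      (w.fn j = j ∧ w.fn (j + 1) = j + 1) := by
    rw [show j - 1 + 1 = j + 1 - 1 by ring, w.rot_one_sub, w.rot_one_sub]; omega
  by_cases hB : w.fn j = j ∧ w.fn (j + 1) = j + 1
  · rw [wt_both hB, wt_both (hB'.2 hB)]; simp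
  · rw [mul_assoc, mul_assoc, wt_rot hn2 hB]
    congr 1
    apply LinkState.ext_fn
    rw [LinkState.next_fn (by rwa [hB'])]
    change rotFun 1 (w.next j).fn = joinFun n (j - 1) (rotFun 1 w.fn)
    rw [LinkState.next_fn hB, joinFun_rot]

open Classical in
/-- Under `Ω ^ k` the defects among the nodes `1, …, k` cross the boundary. -/
theorem opOm_pow_single (k : ℕ) (w : LinkState n d) (c : ℂ) :
    (opOm n d z ^ k) (Finsupp.single w c) = Finsupp.single (w.rot k)
      (c * (z : ℂ) ^ ((Finset.range k).filter fun t : ℕ => w.fn (t + 1) = t + 1).card) := by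
  induction k with
  | zero => simp [LinkState.rot_zero]
  | succ k ih =>
    have e : (w.rot k).fn 1 = 1 ↔ w.fn (k + 1) = k + 1 := by
      rw [LinkState.rot_fn, add_comm 1 (k : ℤ)]; omega
    rw [pow_succ', Module.End.mul_apply, ih, opOm_single, LinkState.rot_rot, Finset.range_add_one,
      Finset.filter_insert]
    simp only [e]
    split_ifs with h
    · rw [Finset.card_insert_of_notMem (by simp), pow_succ]
      push_cast
      rw [mul_assoc]
    · push_cast
      rw [mul_one]

/-- A full turn moves each of the `d` defects across the boundary once. -/
theorem opOm_pow_n [NeZero n] : opOm n d z ^ n = ((z : ℂ) ^ d) • 1 := by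
  classical
  refine Finsupp.lhom_ext fun w c => ?_
  rw [opOm_pow_single, w.rot_period, LinearMap.smul_apply, Module.End.one_apply,
    Finsupp.smul_single, smul_eq_mul, mul_comm]
  congr 3
  have h := w.isLinkState
  refine Eq.trans ?_ h.defects
  rw [← Set.ncard_coe_finset]
  refine Set.ncard_congr (fun t _ => ((t + 1 : ℤ) : ZMod n)) ?_ ?_ ?_
  · intro t ht
    exact ⟨t + 1, rfl, by simpa using (Finset.mem_filter.1 ht).2⟩
  · intro s t hs ht hst
    rw [ZMod.intCast_eq_intCast_iff] at hst
    have hs' := Finset.mem_range.1 (Finset.mem_filter.1 hs).1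
    have ht' := Finset.mem_range.1 (Finset.mem_filter.1 ht).1
    rcases int_modEq_cases hst with h1 | h1 | h1 <;> omega
  · rintro x ⟨i, rfl, hi⟩
    have hn : (0 : ℤ) < n := by exact_mod_cast NeZero.pos n
    have l1 := Int.emod_nonneg (i - 1) hn.ne'
    have l2 := Int.emod_lt_of_pos (i - 1) hn
    have e : ((i - 1) % n + 1 : ℤ) ≡ i [ZMOD n] := by
      simpa using (Int.mod_modEq (i - 1) n).add_right 1
    refine ⟨((i - 1) % n).toNat, ?_, ?_⟩
    · simp only [Finset.coe_filter, Finset.mem_range, Set.mem_ofPred_eq, Int.toNat_of_nonneg l1]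
      exact ⟨by omega, (h.defect_congr e).2 hi⟩
    · rw [Int.toNat_of_nonneg l1, ZMod.intCast_eq_intCast_iff]; exact e

end Rotation

/-! ### The descending product of generators -/

section Descending

variable {n d : ℕ} {p : ℤ → ℤ} {β : ℂ} {z : ℂˣ} {i j k x y : ℤ}

/-- Representatives modulo `n` in `{1, …, n}` are unique. -/
theorem eq_of_add_mul_eq {n x y s : ℤ} (hx : 1 ≤ x ∧ x ≤ n) (hy : 1 ≤ y ∧ y ≤ n)
    (h : x + n * s = y) : x = y ∧ n * s = 0 := by
  have hs : s = 0 := by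
    rcases lt_trichotomy s 0 with h1 | h1 | h1
    · nlinarith
    · exact h1
    · nlinarith
  subst hs; simp at h ⊢; exact h

theorem exists_rep [NeZero n] (x : ℤ) : ∃ y s : ℤ, 1 ≤ y ∧ y ≤ n ∧ x = y + n * s := by
  have hn : (0 : ℤ) < n := by exact_mod_cast NeZero.pos n
  refine ⟨(x - 1) % n + 1, (x - 1) / n, ?_, ?_, ?_⟩
  · have := Int.emod_nonneg (x - 1) hn.ne'; omega
  · have := Int.emod_lt_of_pos (x - 1) hn; omega
  · have := Int.emod_add_mul_ediv (x - 1) n; linarith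

theorem onCap_iff_of_range {s : ℤ} (hx : 1 ≤ x ∧ x ≤ n) (hj : 1 ≤ j ∧ j + 1 ≤ n) :
    OnCap n j (x + n * s) ↔ x = j ∨ x = j + 1 := by
  have key : ∀ {y : ℤ}, 1 ≤ y ∧ y ≤ n → (x + n * s ≡ y [ZMOD n] ↔ x = y) := by
    intro y hy
    constructor
    · intro h
      obtain ⟨m, hm⟩ := h.dvd
      exact (eq_of_add_mul_eq hx hy (s := s + m) (by linarith)).1
    · rintro rfl; simp
  rw [OnCap, key (by omega), key (by omega)]

theorem capFun_left {s : ℤ} : capFun n j (j + n * s) = j + 1 + n * s := by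
  simp [capFun]; ring

theorem capFun_right (hn : 2 ≤ n) {s : ℤ} : capFun n j (j + 1 + n * s) = j + n * s := by
  rw [← capFun_left, capFun_cap hn]
  exact Or.inl (by simp)

/-- The link state obtained from `v`, in which the nodes `1` and `2` are connected, by sliding this
short arc to the nodes `m` and `m + 1`: the nodes `3, …, m + 1` move two steps to the left. -/
structure IsSlide (v u : LinkState n d) (m : ℤ) : Prop where
  arc : u.fn m = m + 1
  rest : ∀ r r' s : ℤ, 3 ≤ r → r ≤ n → 3 ≤ r' → r' ≤ n → v.fn r = r' + n * s →
    u.fn (if r ≤ m + 1 then r - 2 else r) = (if r' ≤ m + 1 then r' - 2 else r') + n * s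

/-- Since `m` and `m + 2` lie in the box, a defect at `m + 2` moves without crossing the boundary,
and the weight is `1`. -/
theorem IsSlide.next [NeZero n] {v u : LinkState n d} {m : ℤ} (h : IsSlide v u m) (h1 : 1 ≤ m)
    (hv : v.fn 1 = 2) (hm : m + 2 ≤ n) :
    IsSlide v (u.next (m + 1)) (m + 1) ∧ wt n β z (m + 1) u.fn = 1 := by
  have hn : 2 ≤ n := by omega
  have hu := u.isLinkState
  have hvl := v.isLinkState
  have am : u.fn (m + 1) = m := by rw [← h.arc, hu.involutive]
  have hB : ¬ (u.fn (m + 1) = m + 1 ∧ u.fn (m + 1 + 1) = m + 1 + 1) := by omega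
  have e := LinkState.next_fn hB
  have onc := onCap_left n (m + 1)
  have onc2 : OnCap n (m + 1) (m + 2) := Or.inr (by rw [add_assoc]; rfl)
  have cm : ∀ s : ℤ, capFun n (m + 1) (m + 1 + n * s) = m + 2 + n * s := fun s => by
    rw [capFun_left]; ring
  have cm2 : ∀ s : ℤ, capFun n (m + 1) (m + 2 + n * s) = m + 1 + n * s := fun s => by
    rw [show m + 2 = m + 1 + 1 by ring, capFun_right hn]
  have cm0 : capFun n (m + 1) (m + 1) = m + 2 := by simpa using cm 0
  -- the partner of `m + 2` in terms of the partner of `m + 2` in `v`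
  obtain ⟨r0, s0, hr1, hr2, hr⟩ := exists_rep (n := n) (v.fn (m + 2))
  have hr3 : 3 ≤ r0 := by
    by_contra hc
    have p0 := hvl.periodic_mul r0 s0
    rw [← hr, hvl.involutive] at p0
    have v2 : v.fn 2 = 1 := by rw [← hv, hvl.involutive]
    obtain rfl | rfl : r0 = 1 ∨ r0 = 2 := by omega
    · rw [hv] at p0
      have := eq_of_add_mul_eq (n := n) (x := 2) (y := m + 2) (by omega) (by omega) p0.symm
      omega
    · rw [v2] at p0
      have := eq_of_add_mul_eq (n := n) (x := 1) (y := m + 2) (by omega) (by omega) p0.symm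
      omega
  have u2 := h.rest _ _ _ (by omega) hm hr3 hr2 hr
  rw [if_neg (by omega)] at u2
  have onm : ¬ OnCap n (m + 1) m := by
    have := onCap_iff_of_range (n := n) (x := m) (j := m + 1) (s := 0) (by omega) (by omega)
    rw [mul_zero, add_zero] at this
    rw [this]; omega
  refine ⟨⟨?_, ?_⟩, ?_⟩
  · rw [next_onCap hB onc, cm0]; ring
  · intro r r' s hr1 hr2 hr1' hr2' hrr
    rw [e]
    have old := h.rest r r' s hr1 hr2 hr1' hr2' hrr
    by_cases c1 : r = m + 2
    · subst c1
      rw [if_neg (by omega)] at old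
      rw [if_pos (by omega), show m + 2 - 2 = m by ring]
      by_cases c2 : r' = m + 2
      · subst c2
        rw [if_neg (by omega)] at old
        rw [if_pos (by omega)]
        have s0 : n * s = 0 := by
          have := modEq_self_p hvl (a := m + 2) (by rw [hrr]; simp)
          linarith
        rw [s0, add_zero] at old ⊢
        rw [joinFun_of_defect onm (by rwa [h.arc]) (by rwa [h.arc, cm0])]; ring
      · rw [joinFun_of_arc onm (by rwa [h.arc]), h.arc, cm0, old]
        · split_ifs <;> first | rfl | omega
        · rw [h.arc, cm0, old]
          intro hc
          have := eq_of_add_mul_eq (n := n) (y := m + 2) (by split_ifs <;> omega) (by omega) hc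
          split_ifs at this <;> omega
    · have e1 : (if r ≤ m + 1 + 1 then r - 2 else r) = if r ≤ m + 1 then r - 2 else r := by
        split_ifs <;> omega
      rw [e1]
      set x := if r ≤ m + 1 then r - 2 else r with hx
      have hxr : 1 ≤ x ∧ x ≤ n ∧ x ≠ m + 1 ∧ x ≠ m + 1 + 1 := by
        rw [hx]; split_ifs <;> omega
      have xo : ¬ OnCap n (m + 1) x := by
        have := onCap_iff_of_range (n := n) (x := x) (j := m + 1) (s := 0) (by omega) (by omega)
        rw [mul_zero, add_zero] at this
        rw [this]; omega
      by_cases c2 : r' = m + 2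
      · subst c2
        rw [if_neg (by omega)] at old
        rw [if_pos (by omega)]
        have o2 : OnCap n (m + 1) (u.fn x) := by
          rw [old, onCap_iff_of_range (by omega) (by omega)]; omega
        have p1 : u.fn (m + 1 + n * s) = m + n * s := by rw [hu.periodic_mul, am]
        rw [joinFun_of_arc xo o2] <;> rw [old, cm2, p1] <;> omega
      · have e2 : (if r' ≤ m + 1 + 1 then r' - 2 else r') = if r' ≤ m + 1 then r' - 2 else r' := by
          split_ifs <;> omega
        rw [e2, ← old]
        refine joinFun_of_not xo ?_
        rw [old, onCap_iff_of_range (by split_ifs <;> omega) (by omega)]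
        split_ifs <;> omega
  · by_cases c : u.fn (m + 2) = m + 2
    · rw [wt_defect hn hu onc2 c]
      · have := cm2 0
        rw [mul_zero, add_zero, add_zero] at this
        have c0 : ∀ {t : ℤ}, 1 ≤ t → t ≤ n → cell n t = 0 := fun a b =>
          Int.ediv_eq_zero_of_lt (by omega) (by omega)
        rw [this, am, c0 (by omega) hm, c0 h1 (by omega)]
        simp
      · have := cm2 0
        rw [mul_zero, add_zero, add_zero] at this
        rw [this, am]; omega
    · refine wt_one hu onc (by omega) (by rwa [cm0]) ?_
      rw [am, cm0]
      intro hc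
      exact onm ((onCap_of_modEq hc).2 onc2)

theorem IsSlide.eq_rot [NeZero n] {v u : LinkState n d} (hn : 2 ≤ n) (hv : v.fn 1 = 2)
    (h : IsSlide v u (n - 1)) : u = v.rot 2 := by
  have hu := u.isLinkState
  have hvl := v.isLinkState
  apply LinkState.ext_fn
  funext x
  obtain ⟨y, s, h1, h2, rfl⟩ := exists_rep (n := n) x
  rw [hu.periodic_mul, (v.rot 2).isLinkState.periodic_mul]
  congr 1
  rw [LinkState.rot_fn]
  have v2 : v.fn 2 = 1 := by rw [← hv, hvl.involutive]
  have a := h.arc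
  by_cases c1 : y = n - 1
  · have := hvl.periodic 1
    subst c1
    rw [show (n : ℤ) - 1 + 2 = 1 + n by ring, this, hv, a]; ring
  by_cases c2 : y = n
  · have := hvl.periodic 2
    have b := hu.involutive (n - 1)
    rw [a, show (n : ℤ) - 1 + 1 = n by ring] at b
    rw [c2, show (n : ℤ) + 2 = 2 + n by ring, this, v2, b]; ring
  · obtain ⟨r, s, r1, r2, hr⟩ := exists_rep (n := n) (v.fn (y + 2))
    have hr3 : 3 ≤ r := by
      by_contra hc
      have p0 := hvl.periodic_mul r s
      rw [← hr, hvl.involutive] at p0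
      obtain rfl | rfl : r = 1 ∨ r = 2 := by omega
      · rw [hv] at p0
        have := eq_of_add_mul_eq (n := n) (x := 2) (y := y + 2) (by omega) (by omega) p0.symm
        omega
      · rw [v2] at p0
        have := eq_of_add_mul_eq (n := n) (x := 1) (y := y + 2) (by omega) (by omega) p0.symm
        omega
    have := h.rest _ _ _ (by omega) (by omega) hr3 r2 hr
    rw [if_pos (by omega), if_pos (by omega), show y + 2 - 2 = y by ring] at this
    rw [this, hr]; ring

/-- The product `e_m ⋯ e_2 e_1` slides the short arc made by `e_1` to the nodes `m`, `m + 1`. -/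
theorem descending_single [NeZero n] (w : LinkState n d)
    (hB : ¬ (w.fn 1 = 1 ∧ w.fn (1 + 1) = 1 + 1)) (c : ℂ) (m : ℕ) (hm : m + 2 ≤ n) :
    ∃ u : LinkState n d, IsSlide (w.next 1) u (m + 1) ∧
      (((List.range (m + 1)).reverse.map fun k : ℕ => opE n d β z ((k + 1 : ℕ) : ℤ)).prod)
        (Finsupp.single w c) = Finsupp.single u (c * wt n β z 1 w.fn) := by
  have hv : (w.next 1).fn 1 = 2 := by rw [next_onCap hB (onCap_left n 1)]; simp [capFun]
  induction m with
  | zero =>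
    refine ⟨w.next 1, ⟨by simpa using hv, ?_⟩, ?_⟩
    · intro r r' s h1 _ h2 _ h3
      rw [if_neg (by push_cast; omega), if_neg (by push_cast; omega), h3]
    · simp [opE_single]
  | succ m ih =>
    obtain ⟨u, h1, h2⟩ := ih (by omega)
    obtain ⟨h3, h4⟩ := h1.next (β := β) (z := z) (by omega) hv (by omega)
    refine ⟨u.next (m + 1 + 1), by push_cast; exact h3, ?_⟩
    rw [List.range_succ, List.reverse_append, List.map_append, List.prod_append,
      Module.End.mul_apply, h2]
    simp only [List.reverse_cons, List.reverse_nil, List.nil_append, List.map_cons, List.map_nil,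
      List.prod_cons, List.prod_nil, mul_one]
    push_cast
    rw [opE_single, h4, mul_one]

theorem opOm_sq_mul_opE [NeZero n] (hn : 2 ≤ n) :
    opOm n d z ^ 2 * opE n d β z 1 =
      ((List.range (n - 1)).reverse.map fun k : ℕ => opE n d β z ((k + 1 : ℕ) : ℤ)).prod := by
  refine Finsupp.lhom_ext fun w c => ?_
  rw [Module.End.mul_apply, opE_single]
  obtain ⟨m, rfl⟩ : ∃ m, n = m + 2 := ⟨n - 2, by omega⟩
  rw [show m + 2 - 1 = m + 1 by omega]
  by_cases hB : w.fn 1 = 1 ∧ w.fn (1 + 1) = 1 + 1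
  · rw [List.range_succ_eq_map, List.reverse_cons, List.map_append, List.prod_append,
      Module.End.mul_apply]
    simp [opE_single, wt_both hB]
  · obtain ⟨u, h1, h2⟩ := descending_single (β := β) (z := z) w hB c m le_rfl
    have hv : (w.next 1).fn 1 = 2 := by rw [next_onCap hB (onCap_left _ 1)]; simp [capFun]
    have e1 : (w.next 1).fn 1 ≠ 1 := by omega
    have e2 : ((w.next 1).rot 1).fn 1 ≠ 1 := by
      have : (w.next 1).fn 2 = 1 := by rw [← hv, (w.next 1).isLinkState.involutive]
      rw [LinkState.rot_fn, show (1 : ℤ) + 1 = 2 by norm_num, this]; norm_num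
    have h1' : IsSlide (w.next 1) u (((m + 2 : ℕ) : ℤ) - 1) := by
      rw [show ((m + 2 : ℕ) : ℤ) - 1 = m + 1 by push_cast; ring]; exact h1
    rw [h2, pow_two, Module.End.mul_apply, opOm_single, opOm_single, LinkState.rot_rot, if_neg e1,
      if_neg e2, mul_one, mul_one, h1'.eq_rot hn hv]
    norm_num

end Descending

/-! ### The standard modules as modules over presented algebras -/

section Presented

/-- An action of the generators extends to the presented algebra if and only if it satisfies the
relations. -/
theorem exists_presented_hom_iff {X M : Type} [AddCommGroup M] [Module ℂ M]
    (r : FreeAlgebra ℂ X → FreeAlgebra ℂ X → Prop) (f : X → Module.End ℂ M) :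
    (∃ ρ : Presented r →ₐ[ℂ] Module.End ℂ M, ∀ x, ρ (Presented.gen r x) = f x) ↔
      ∀ a b, r a b → FreeAlgebra.lift ℂ f a = FreeAlgebra.lift ℂ f b := by
  constructor
  · rintro ⟨ρ, hρ⟩ a b hab
    have e : ρ.comp (RingQuot.mkAlgHom ℂ r) = FreeAlgebra.lift ℂ f := by
      apply FreeAlgebra.hom_ext
      funext x
      simpa [Presented.gen] using hρ x
    rw [← e, AlgHom.comp_apply, AlgHom.comp_apply, RingQuot.mkAlgHom_rel ℂ hab]
  · intro h
    refine ⟨RingQuot.liftAlgHom ℂ ⟨FreeAlgebra.lift ℂ f, fun a b hab => h a b hab⟩, fun x => ?_⟩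
    simp [Presented.gen]

variable {A B : Type} [Ring A] [Algebra ℂ A] [Ring B] [Algebra ℂ B] {n : ℕ} {β : ℂ}

theorem map_descProd (f : A →ₐ[ℂ] B) (e : ZMod n → A) (m : ℕ) :
    f (descProd n e m) = descProd n (fun j => f (e j)) m := by
  simp [descProd, map_list_prod, Function.comp_def]

theorem map_descProdOne (f : A →ₐ[ℂ] B) (e : ZMod n → A) :
    f (descProdOne n e) = descProdOne n fun j => f (e j) := by
  simp [descProdOne, map_list_prod, Function.comp_def]

theorem map_evenProd (f : A →ₐ[ℂ] B) (e : ZMod n → A) :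
    f (evenProd n e) = evenProd n fun j => f (e j) := by
  simp [evenProd, map_list_prod, Function.comp_def]

theorem map_oddProd (f : A →ₐ[ℂ] B) (e : ZMod n → A) :
    f (oddProd n e) = oddProd n fun j => f (e j) := by
  simp [oddProd, map_list_prod, Function.comp_def]

theorem PeriodicRel.map (f : A →ₐ[ℂ] B) {e : ZMod n → A} {a b : A} (h : PeriodicRel n β e a b) :
    PeriodicRel n β (fun j => f (e j)) (f a) (f b) := by
  cases h with
  | square j => simpa using PeriodicRel.square (e := fun j => f (e j)) j
  | cubic_succ hn j => simpa using PeriodicRel.cubic_succ (e := fun j => f (e j)) hn j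
  | cubic_pred hn j => simpa using PeriodicRel.cubic_pred (e := fun j => f (e j)) hn j
  | comm i j h0 h1 h2 => simpa using PeriodicRel.comm (e := fun j => f (e j)) i j h0 h1 h2
  | none hn j => simpa using PeriodicRel.none (e := fun j => f (e j)) hn j

theorem AffineRel.map (f : A →ₐ[ℂ] B) {e : ZMod n → A} {Om OmInv a b : A}
    (h : AffineRel n β e Om OmInv a b) :
    AffineRel n β (fun j => f (e j)) (f Om) (f OmInv) (f a) (f b) := by
  cases h with
  | periodic h => exact .periodic (h.map f)
  | conj j =>
    simpa using AffineRel.conj (e := fun j => f (e j)) (Om := f Om) (OmInv := f OmInv) j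
  | mul_inv =>
    simpa using AffineRel.mul_inv (e := fun j => f (e j)) (Om := f Om) (OmInv := f OmInv)
  | inv_mul =>
    simpa using AffineRel.inv_mul (e := fun j => f (e j)) (Om := f Om) (OmInv := f OmInv)
  | square hn =>
    simpa [map_descProdOne] using
      AffineRel.square (e := fun j => f (e j)) (Om := f Om) (OmInv := f OmInv) hn

end Presented

section Action

variable {n d : ℕ} {β : ℂ} {z : ℂˣ}

/-- The action of the generator `e_j`, with `j` an integer modulo `n`. -/
noncomputable def actE (n d : ℕ) [NeZero n] (β : ℂ) (z : ℂˣ) (j : ZMod n) :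
    Module.End ℂ (StdSpace n d) :=
  opE n d β z (j.val : ℤ)

theorem actE_intCast [NeZero n] (i : ℤ) : actE n d β z (i : ZMod n) = opE n d β z i := by
  refine opE_congr ?_
  rw [ZMod.val_intCast]
  exact Int.mod_modEq i n

theorem actE_natCast [NeZero n] (i : ℕ) : actE n d β z (i : ZMod n) = opE n d β z i := by
  exact_mod_cast actE_intCast (n := n) (i : ℤ)

theorem not_onCap_of_ne {i k : ℤ} (h0 : (i : ZMod n) ≠ k) (h1 : (i : ZMod n) ≠ k + 1)
    (h2 : (k : ZMod n) ≠ i + 1) (x : ℤ) (hi : OnCap n i x) : ¬ OnCap n k x := by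
  simp only [OnCap, ← ZMod.intCast_eq_intCast_iff] at hi ⊢
  push_cast at hi ⊢
  rintro (hk | hk) <;> rcases hi with hi | hi <;> rw [hi] at hk
  · exact h0 hk
  · exact h2 hk.symm
  · exact h1 hk
  · exact h0 (add_right_cancel hk)

theorem periodicRel_actE [NeZero n] {a b : Module.End ℂ (StdSpace n d)}
    (h : PeriodicRel n β (actE n d β z) a b) : a = b := by
  cases h with
  | square j =>
    obtain ⟨i, rfl⟩ := ZMod.intCast_surjective j
    rw [actE_intCast, opE_mul_self]
  | cubic_succ hn j =>
    obtain ⟨i, rfl⟩ := ZMod.intCast_surjective j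
    rw [show (i : ZMod n) + 1 = ((i + 1 : ℤ) : ZMod n) by push_cast; rfl, actE_intCast,
      actE_intCast, opE_cubic (by omega) (linked_succ hn i)]
  | cubic_pred hn j =>
    obtain ⟨i, rfl⟩ := ZMod.intCast_surjective j
    have hl := linked_succ hn (i - 1)
    rw [sub_add_cancel] at hl
    rw [show (i : ZMod n) - 1 = ((i - 1 : ℤ) : ZMod n) by push_cast; rfl, actE_intCast,
      actE_intCast, opE_cubic (by omega) hl.symm]
  | comm i j h0 h1 h2 =>
    obtain ⟨i, rfl⟩ := ZMod.intCast_surjective i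
    obtain ⟨j, rfl⟩ := ZMod.intCast_surjective j
    rw [actE_intCast, actE_intCast]
    by_cases hn : n = 1
    · simp [opE_of_one hn]
    · have hn2 : 2 ≤ n := by have := NeZero.pos n; omega
      exact opE_comm hn2 (not_onCap_of_ne h0 h1 h2)
  | none hn j => exact opE_of_one hn _

theorem opOm_mul_actE [NeZero n] (j : ZMod n) :
    opOm n d z * actE n d β z j = actE n d β z (j - 1) * opOm n d z := by
  obtain ⟨i, rfl⟩ := ZMod.intCast_surjective j
  rw [show (i : ZMod n) - 1 = ((i - 1 : ℤ) : ZMod n) by push_cast; rfl, actE_intCast,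
    actE_intCast, opOm_mul_opE]

theorem opOm_sq_mul_actE [NeZero n] (hn : 2 ≤ n) :
    opOm n d z ^ 2 * actE n d β z 1 = descProdOne n (actE n d β z) := by
  have := actE_intCast (n := n) (d := d) (β := β) (z := z) 1
  rw [Int.cast_one] at this
  rw [this, opOm_sq_mul_opE hn]
  simp only [descProdOne, actE_natCast]

theorem affineRel_actE [NeZero n] {a b : Module.End ℂ (StdSpace n d)}
    (h : AffineRel n β (actE n d β z) (opOm n d z) (opOmInv n d z) a b) : a = b := by
  cases h with
  | periodic h => exact periodicRel_actE h
  | conj j => rw [opOm_mul_actE, mul_assoc, opOm_mul_opOmInv, mul_one]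
  | mul_inv => exact opOm_mul_opOmInv
  | inv_mul => exact opOmInv_mul_opOm
  | square hn => exact opOm_sq_mul_actE hn

theorem lift_aTLRel [NeZero n] (s : Label) {a b : FreeAlgebra ℂ (AffineGen n)} (h : aTLRel n β a b) :
    FreeAlgebra.lift ℂ (affineAct n β s) a = FreeAlgebra.lift ℂ (affineAct n β s) b := by
  have := h.map (FreeAlgebra.lift ℂ (affineAct n β s))
  simp only [aE, aOm, aOmInv, FreeAlgebra.lift_ι_apply] at this
  exact affineRel_actE this

theorem lift_pTLRel [NeZero n] (s : Label) {a b : FreeAlgebra ℂ (ZMod n)}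
    (h : PeriodicRel n β (pE n) a b) :
    FreeAlgebra.lift ℂ (periodicAct n β s) a = FreeAlgebra.lift ℂ (periodicAct n β s) b := by
  have := h.map (FreeAlgebra.lift ℂ (periodicAct n β s))
  simp only [pE, FreeAlgebra.lift_ι_apply] at this
  exact periodicRel_actE this

end Action

/-! ### Unwinding around the cylinder -/

section Unwind

variable {A : Type} [Ring A] {n : ℕ} {e : ZMod n → A} {Om OmInv : A}

/-- The descending product `e_{a+m-1} ⋯ e_{a+1} e_a`. -/
def descFrom (e : ZMod n → A) (a : ZMod n) (m : ℕ) : A :=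
  ((List.range m).reverse.map fun k : ℕ => e (a + k)).prod

theorem descFrom_one (a : ZMod n) : descFrom e a 1 = e a := by
  simp [descFrom]

theorem descFrom_succ (a : ZMod n) (m : ℕ) :
    descFrom e a (m + 1) = e (a + m) * descFrom e a m := by
  simp [descFrom, List.range_succ]

theorem descFrom_add (a : ZMod n) (m l : ℕ) :
    descFrom e a (m + l) = descFrom e (a + m) l * descFrom e a m := by
  induction l with
  | zero => simp [descFrom]
  | succ l ih =>
    rw [← add_assoc, descFrom_succ, ih, descFrom_succ, mul_assoc]
    push_cast
    rw [add_assoc]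

theorem mul_descFrom (hc : ∀ j, Om * e j = e (j - 1) * Om) (a : ZMod n) (m : ℕ) :
    Om * descFrom e a m = descFrom e (a - 1) m * Om := by
  induction m with
  | zero => simp [descFrom]
  | succ m ih =>
    rw [descFrom_succ, descFrom_succ, ← mul_assoc, hc, mul_assoc, ih, ← mul_assoc]
    congr 3; ring

theorem sq_mul_descFrom (hc : ∀ j, Om * e j = e (j - 1) * Om) (a : ZMod n) (m : ℕ) :
    Om ^ 2 * descFrom e (a + 2) m = descFrom e a m * Om ^ 2 := by
  rw [pow_two, mul_assoc, mul_descFrom hc, ← mul_assoc, mul_descFrom hc, mul_assoc]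
  congr 2; ring

/-- The relation `Ω² e_1 = e_{n-1} ⋯ e_1`, rotated. -/
theorem sq_mul_eq_descFrom [NeZero n] (hc : ∀ j, Om * e j = e (j - 1) * Om)
    (hi : Om * OmInv = 1) (hs : Om ^ 2 * e 1 = descProdOne n e) (a : ZMod n) :
    Om ^ 2 * e a = descFrom e a (n - 1) := by
  have key : ∀ t : ℕ, Om ^ 2 * e (1 - t) = descFrom e (1 - t) (n - 1) := by
    intro t
    induction t with
    | zero =>
      rw [Nat.cast_zero, sub_zero, hs]
      simp only [descProdOne, descFrom, Nat.cast_add, Nat.cast_one, add_comm]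
    | succ t ih =>
      have h1 : Om ^ 2 * e (1 - (t : ZMod n) - 1) * Om = descFrom e (1 - t - 1) (n - 1) * Om := by
        rw [mul_assoc, ← hc, ← mul_descFrom hc, ← ih]; noncomm_ring
      have h2 := congrArg (· * OmInv) h1
      simp only [mul_assoc, hi, mul_one] at h2
      rw [show (1 : ZMod n) - ((t + 1 : ℕ) : ZMod n) = 1 - t - 1 by push_cast; ring]
      exact h2
  have := key (1 - a).val
  rwa [ZMod.natCast_val, ZMod.cast_id, sub_sub_cancel] at this

/-- Here `descProd n e n = Ω² e_1 e_0`, and the factors `Ω²` are moved to the left. -/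
theorem mul_descProd_pow [NeZero n] (hc : ∀ j, Om * e j = e (j - 1) * Om)
    (hi : Om * OmInv = 1) (hs : Om ^ 2 * e 1 = descProdOne n e) (k : ℕ) :
    e 0 * descProd n e n ^ k = Om ^ (2 * k) * descFrom e 0 (2 * k + 1) := by
  have hD : descProd n e n = Om ^ 2 * (e 1 * e 0) := by
    have h1 : descProd n e n = descFrom e 0 n := by simp [descProd, descFrom]
    have h2 := descFrom_add (e := e) 0 1 (n - 1)
    rw [Nat.add_sub_cancel' (NeZero.one_le), descFrom_one, Nat.cast_one, zero_add] at h2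
    rw [h1, h2, ← mul_assoc, sq_mul_eq_descFrom hc hi hs]
  induction k with
  | zero => simp [descFrom_one]
  | succ k ih =>
    have h1 := descFrom_add (e := e) 0 2 (2 * k + 1)
    have h2 : descFrom e 0 2 = e 1 * e 0 := by simp [descFrom, List.range_succ]
    rw [show 2 * (k + 1) + 1 = 2 + (2 * k + 1) by ring, h1, h2, pow_succ, ← mul_assoc, ih, hD,
      show 2 * (k + 1) = 2 * k + 2 by ring, pow_add]
    have h3 := sq_mul_descFrom hc 0 (2 * k + 1)
    push_cast
    calc _ = Om ^ (2 * k) * (descFrom e 0 (2 * k + 1) * Om ^ 2) * (e 1 * e 0) := by noncomm_ring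
      _ = _ := by rw [← h3]; noncomm_ring

theorem unwind_even [NeZero n] (hc : ∀ j, Om * e j = e (j - 1) * Om)
    (hi : Om * OmInv = 1) (hs : Om ^ 2 * e 1 = descProdOne n e) (hn : Even n) :
    e 0 * descProd n e n ^ ((n - 2) / 2) = Om ^ n * e 0 := by
  have h0 := NeZero.pos n
  obtain ⟨h, hh⟩ := hn
  rw [mul_descProd_pow hc hi hs, show 2 * ((n - 2) / 2) + 1 = n - 1 by omega,
    ← sq_mul_eq_descFrom hc hi hs, ← mul_assoc, ← pow_add]
  congr 2; omega

theorem unwind_odd [NeZero n] (hc : ∀ j, Om * e j = e (j - 1) * Om)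
    (hi : Om * OmInv = 1) (hs : Om ^ 2 * e 1 = descProdOne n e) (hn : 2 ≤ n) :
    e 0 * descProd n e n ^ (n - 2) = Om ^ (2 * n) * e 0 := by
  have e1 : descFrom e ((n - 1 : ℕ) : ZMod n) (n - 2) * Om ^ 2 =
      Om ^ 2 * descFrom e 1 (n - 2) := by
    rw [← sq_mul_descFrom hc]
    congr 2
    rw [Nat.cast_sub (by omega), ZMod.natCast_self]; push_cast; ring
  have e2 : descFrom e 1 (n - 2) * e 0 = Om ^ 2 * e 0 := by
    have h2 := descFrom_add (e := e) 0 1 (n - 2)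
    rw [descFrom_one, Nat.cast_one, zero_add, show 1 + (n - 2) = n - 1 by omega] at h2
    rw [← h2, sq_mul_eq_descFrom hc hi hs]
  rw [mul_descProd_pow hc hi hs, show 2 * (n - 2) + 1 = (n - 1) + (n - 2) by omega, descFrom_add,
    zero_add, ← sq_mul_eq_descFrom hc hi hs, ← mul_assoc (descFrom e _ _), e1, mul_assoc, e2,
    ← mul_assoc, ← mul_assoc, ← pow_add, ← pow_add]
  congr 2; omega

end Unwind

/-! ### Link states with short arcs -/

section ShortArcs

variable {n d : ℕ} {β : ℂ} {z : ℂˣ} {i j k x y : ℤ}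

/-- The connections in which the nodes `1, 2`, the nodes `3, 4` and so on are connected, up to the
nodes `n - d - 1` and `n - d`, and the other nodes are defects. -/
def arcFun (n d : ℕ) (x : ℤ) : ℤ :=
  if (x - 1) % n < n - d then if (x - 1) % n % 2 = 0 then x + 1 else x - 1 else x

theorem arcFun_rep {s : ℤ} (hy : 1 ≤ y ∧ y ≤ n) :
    arcFun n d (y + n * s) =
      (if y ≤ n - d then if y % 2 = 1 then y + 1 else y - 1 else y) + n * s := by
  have e : (y + n * s - 1) % n = y - 1 := by
    rw [show y + (n : ℤ) * s - 1 = y - 1 + n * s by ring, Int.add_mul_emod_self_left,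
      Int.emod_eq_of_lt (by omega) (by omega)]
  unfold arcFun
  rw [e]
  split_ifs <;> omega

theorem isLinkState_arcFun [NeZero n] (hd : d ≤ n) (hp : d ≡ n [MOD 2]) :
    IsLinkState n d (arcFun n d) where
  periodic x := by
    obtain ⟨y, s, h1, h2, rfl⟩ := exists_rep (n := n) x
    rw [show y + (n : ℤ) * s + n = y + n * (s + 1) by ring, arcFun_rep ⟨h1, h2⟩,
      arcFun_rep ⟨h1, h2⟩]; ring
  involutive x := by
    have hp' : (n - d : ℤ) % 2 = 0 := by
      have := hp.symm; unfold Nat.ModEq at this; omega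
    obtain ⟨y, s, h1, h2, rfl⟩ := exists_rep (n := n) x
    rw [arcFun_rep ⟨h1, h2⟩, arcFun_rep]
    · split_ifs <;> omega
    · split_ifs <;> omega
  noncrossing x k h1 h2 := by
    unfold arcFun at h2
    split_ifs at h2 <;> omega
  defects := by
    have : {x : ZMod n | ∃ i : ℤ, (i : ZMod n) = x ∧ arcFun n d i = i} =
        (fun i : ℕ => ((i : ℤ) : ZMod n)) '' ↑(Finset.Ioc (n - d) n) := by
      ext x
      simp only [Set.mem_ofPred_eq, Set.mem_image, Finset.coe_Ioc, Set.mem_Ioc]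
      constructor
      · rintro ⟨x, rfl, hx⟩
        obtain ⟨y, s, h1, h2, rfl⟩ := exists_rep (n := n) x
        rw [arcFun_rep ⟨h1, h2⟩] at hx
        refine ⟨y.toNat, ?_, ?_⟩
        · split_ifs at hx <;> omega
        · rw [Int.toNat_of_nonneg (by omega)]; simp
      · rintro ⟨y, hy, rfl⟩
        refine ⟨y, rfl, ?_⟩
        have := arcFun_rep (n := n) (d := d) (y := y) (s := 0) (by omega)
        rw [mul_zero, add_zero, add_zero] at this
        rw [this, if_neg (by omega)]
    rw [this, Set.InjOn.ncard_image, Set.ncard_coe_finset, Nat.card_Ioc]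
    · omega
    · intro a ha b hb hab
      simp only [Finset.coe_Ioc, Set.mem_Ioc] at ha hb
      simp only [ZMod.intCast_eq_intCast_iff] at hab
      rcases int_modEq_cases hab with h | h | h <;> omega

theorem exists_linkState_arc [NeZero n] (hd : d ≤ n) (hp : d ≡ n [MOD 2]) :
    ∃ w : LinkState n d, d < n → w.fn 1 = 2 := by
  refine ⟨.of _ (isLinkState_arcFun hd hp), fun h => ?_⟩
  have := arcFun_rep (n := n) (d := d) (y := 1) (s := 0) (by omega)
  rw [mul_zero, add_zero, add_zero] at this
  rw [LinkState.of_fn, this, if_pos (by omega)]; norm_num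

theorem opE_eq_zero_of_full [NeZero n] (j : ℤ) : opE n n β z j = 0 := by
  refine Finsupp.lhom_ext fun w c => ?_
  have h := w.isLinkState
  have key : ∀ x, w.fn x = x := fun x => by
    have := h.defects
    rw [← mem_defects h.periodic x]
    have h2 : {x : ZMod n | ∃ i : ℤ, (i : ZMod n) = x ∧ w.fn i = i} = Set.univ := by
      rw [Set.eq_univ_iff_ncard, this, Nat.card_zmod]
    have : ((x : ℤ) : ZMod n) ∈ {x : ZMod n | ∃ i : ℤ, (i : ZMod n) = x ∧ w.fn i = i} := by
      rw [h2]; trivial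
    exact this
  rw [opE_single, wt_both ⟨key _, key _⟩]
  simp

theorem pos_defects_exists [NeZero n] (hd : 0 < d) (w : LinkState n d) : ∃ x, w.fn x = x := by
  have h := w.isLinkState.defects
  obtain ⟨_, x, _, hx⟩ := Set.nonempty_of_ncard_ne_zero (h.trans_ne hd.ne')
  exact ⟨x, hx⟩

theorem no_defect [NeZero n] (w : LinkState n 0) (x : ℤ) : w.fn x ≠ x := by
  intro hx
  have h := w.isLinkState.defects
  rw [Set.ncard_eq_zero (Set.toFinite _)] at h
  have : ((x : ℤ) : ZMod n) ∈ {x : ZMod n | ∃ i : ℤ, (i : ZMod n) = x ∧ w.fn i = i} := ⟨x, rfl, hx⟩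
  rw [h] at this
  exact this

theorem opOm_pow_mul_cancel {k : ℕ} {T : Module.End ℂ (StdSpace n d)}
    (h : opOm n d z ^ k * T = 0) : T = 0 := by
  induction k with
  | zero => simpa using h
  | succ k ih =>
    apply ih
    have := congrArg (opOmInv n d z * ·) h
    simpa [pow_succ', mul_assoc, ← mul_assoc (opOmInv n d z), opOmInv_mul_opOm] using this

theorem fn_eq_capFun [NeZero n] (u : LinkState n d) {j x : ℤ} (hu : u.fn j = j + 1)
    (hx : OnCap n j x) : u.fn x = capFun n j x := by
  have h := u.isLinkState
  rcases hx.elim with ⟨hj, e⟩ | ⟨hj, e⟩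
  · have := h.modEq hj; rw [e]; omega
  · have := h.modEq (hj.add_right 1)
    rw [← hu, h.involutive, sub_add_cancel, hu] at this
    rw [e]; omega

/-- The generator `e_0` does not act as zero if `n ≥ 3` and not all nodes are defects, whatever the
loop weights are: if `w` has a short arc from `1` to `2`, then `e_1 e_2 w = w`, so that `e_2` is not
zero, and `e_0` is conjugate to `e_2`. -/
theorem opE_zero_ne_zero [NeZero n] (hn : 3 ≤ n) (hd : d < n) (hp : d ≡ n [MOD 2]) :
    opE n d β z 0 ≠ 0 := by
  intro h0
  have h2 : opE n d β z 2 = 0 := by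
    apply opOm_pow_mul_cancel (z := z) (k := 2)
    rw [pow_two, mul_assoc, opOm_mul_opE, ← mul_assoc, opOm_mul_opE]
    norm_num [h0]
  obtain ⟨w, hw⟩ := exists_linkState_arc (n := n) hd.le hp
  have hw := hw hd
  have hl := linked_succ hn 1
  have hv : ∀ x, OnCap n 1 x → w.fn x = capFun n 1 x := fun x => fn_eq_capFun w hw
  have hne := (next_next_of_linked (β := β) (z := z) (by omega) hl hv).2
  have := congrArg (· (Finsupp.single w (1 : ℂ))) h2
  rw [show (1 : ℤ) + 1 = 2 by norm_num] at hne
  simp only [opE_single, one_mul, LinearMap.zero_apply, Finsupp.single_eq_zero] at this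
  rw [this, zero_mul] at hne
  exact zero_ne_one hne

end ShortArcs

/-! ### The products `E` and `F` -/

section EvenProd

variable {n d : ℕ} {β : ℂ} {z : ℂˣ} {i j k x y : ℤ}

/-- A product of generators with disjoint caps makes all their short arcs. -/
theorem prod_single [NeZero n] (l : List ℤ)
    (hl : l.Pairwise fun j k => ∀ x, OnCap n k x → ¬ OnCap n j x) (w : LinkState n d) (c : ℂ) :
    ∃ (u : LinkState n d) (c' : ℂ), (l.map (opE n d β z)).prod (Finsupp.single w c) =
      Finsupp.single u c' ∧ (c' ≠ 0 → ∀ j ∈ l, u.fn j = j + 1) := by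
  induction l with
  | nil => exact ⟨w, c, by simp, by simp⟩
  | cons j l ih =>
    obtain ⟨u, c', h1, h2⟩ := ih hl.of_cons
    refine ⟨u.next j, c' * wt n β z j u.fn, ?_, fun h0 k hk => ?_⟩
    · rw [List.map_cons, List.prod_cons, Module.End.mul_apply, h1, opE_single]
    · have hB : ¬ (u.fn j = j ∧ u.fn (j + 1) = j + 1) := fun hc =>
        right_ne_zero_of_mul h0 (wt_both hc)
      rcases List.mem_cons.1 hk with rfl | hk
      · rw [next_onCap hB (onCap_left n k)]; simp [capFun]
      · have hu := h2 (left_ne_zero_of_mul h0) k hk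
        have hd := List.rel_of_pairwise_cons hl hk
        rw [LinkState.next_fn hB, joinFun_of_not (hd _ (onCap_left n k)), hu]
        rw [hu]; exact hd _ (onCap_right n k)

/-- The even numbers `2 s, 2 s + 2, …` of which there are `m`. -/
def evens (s m : ℕ) : List ℤ := (List.range' s m).map fun k : ℕ => (2 * k : ℤ)

theorem evens_succ (s m : ℕ) : evens s (m + 1) = (2 * s : ℤ) :: evens (s + 1) m := by
  simp [evens, List.range'_succ]

theorem mem_evens {s m : ℕ} : j ∈ evens s m ↔ ∃ k : ℕ, s ≤ k ∧ k < s + m ∧ j = 2 * k := by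
  simp only [evens, List.mem_map, List.mem_range'_1]
  constructor
  · rintro ⟨k, hk, rfl⟩; exact ⟨k, hk.1, hk.2, rfl⟩
  · rintro ⟨k, h1, h2, rfl⟩; exact ⟨k, ⟨h1, h2⟩, rfl⟩

theorem not_onCap_even {a b : ℤ} (h1 : a + 1 < b) (h2 : b + 1 < a + n) (hx : OnCap n b x) :
    ¬ OnCap n a x := by
  have key : ∀ {s t : ℤ}, x ≡ s [ZMOD n] → x ≡ t [ZMOD n] → s < t → t < s + n → False := by
    intro s t hs ht h3 h4
    obtain ⟨m, hm⟩ := (hs.symm.trans ht).dvd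
    have a1 : 0 < m := by by_contra hc; nlinarith
    have a2 : m < 1 := by by_contra hc; nlinarith
    omega
  rintro (h3 | h3) <;> rcases hx with h4 | h4 <;> exact key h3 h4 (by omega) (by omega)

theorem evens_pairwise {h s m : ℕ} (hn : n = 2 * h) (hs : s + m ≤ h) :
    (evens s m).Pairwise fun j k => ∀ x, OnCap n k x → ¬ OnCap n j x := by
  rw [evens, List.pairwise_map]
  refine (List.pairwise_lt_range' (s := s) (n := m)).imp_of_mem ?_
  intro a b ha hb hab x
  rw [List.mem_range'_1] at ha hb
  exact not_onCap_even (by omega) (by omega)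

theorem evenProd_actE [NeZero n] {h : ℕ} (hn : n = 2 * h) :
    evenProd n (actE n d β z) = ((evens 0 h).map (opE n d β z)).prod := by
  subst hn
  have : 2 * h / 2 = h := by omega
  simp only [evenProd, evens, this, List.range_eq_range', List.map_map, actE_natCast]
  congr 1

theorem exists_even_rep [NeZero n] {h : ℕ} (hn : n = 2 * h) (x : ℤ) :
    ∃ j ∈ evens 0 h, OnCap n j x := by
  obtain ⟨y, s, h1, h2, hx⟩ := exists_rep (n := n) (x + 1)
  refine ⟨2 * ((y - 1) / 2), mem_evens.2 ⟨((y - 1) / 2).toNat, by omega, by omega, by omega⟩, ?_⟩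
  obtain rfl : x = y - 1 + n * s := by linarith
  rcases Int.emod_two_eq_zero_or_one (y - 1) with h3 | h3
  · left
    rw [show 2 * ((y - 1) / 2) = y - 1 by omega]; simp
  · right
    rw [show 2 * ((y - 1) / 2) + 1 = y - 1 by omega]; simp

/-- A link state with the short arcs from `0` to `1`, from `2` to `3`, …, is determined. -/
theorem eq_of_evens [NeZero n] {h : ℕ} (hn : n = 2 * h) {u v : LinkState n d}
    (hu : ∀ j ∈ evens 0 h, u.fn j = j + 1) (hv : ∀ j ∈ evens 0 h, v.fn j = j + 1) : u = v := by
  apply LinkState.ext_fn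
  funext x
  obtain ⟨j, hj, hx⟩ := exists_even_rep hn x
  rw [fn_eq_capFun u (hu j hj) hx, fn_eq_capFun v (hv j hj) hx]

/-- `E` vanishes on the standard modules with defects, since it would have to connect them. -/
theorem evenProd_eq_zero_of_pos [NeZero n] (hn : Even n) (hd : 0 < d) :
    evenProd n (actE n d β z) = 0 := by
  obtain ⟨h, hh⟩ := hn.exists_two_nsmul
  rw [smul_eq_mul] at hh
  rw [evenProd_actE hh]
  refine Finsupp.lhom_ext fun w c => ?_
  obtain ⟨u, c', h1, h2⟩ := prod_single (β := β) (z := z) _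
    (evens_pairwise (s := 0) (m := h) hh (by omega)) w c
  rw [h1]
  by_cases h0 : c' = 0
  · simp [h0]
  · obtain ⟨x, hx⟩ := pos_defects_exists hd u
    obtain ⟨j, hj, hxj⟩ := exists_even_rep hh x
    rw [fn_eq_capFun u (h2 h0 j hj) hxj] at hx
    exact absurd hx (capFun_ne n j x)

/-- `E` vanishes if all loops have weight zero: the last generator of the product closes a loop. -/
theorem evenProd_eq_zero_of_loops [NeZero n] (hn : Even n) (hβ : β = 0)
    (hz : (z : ℂ) + (z : ℂ)⁻¹ = 0) : evenProd n (actE n 0 β z) = 0 := by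
  obtain ⟨h, hh⟩ := hn.exists_two_nsmul
  rw [smul_eq_mul] at hh
  rw [evenProd_actE hh]
  have h0 := NeZero.pos n
  obtain ⟨m, rfl⟩ : ∃ m, h = m + 1 := ⟨h - 1, by omega⟩
  refine Finsupp.lhom_ext fun w c => ?_
  rw [evens_succ, List.map_cons, List.prod_cons, Module.End.mul_apply]
  obtain ⟨u, c', h1, h2⟩ := prod_single (β := β) (z := z) _
    (evens_pairwise (s := 0 + 1) (m := m) hh (by omega)) w c
  rw [h1, opE_single]
  by_cases hc : c' = 0
  · simp [hc]
  have hu := u.isLinkState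
  have n2 : 2 ≤ n := by omega
  set j : ℤ := 2 * ((0 : ℕ) : ℤ)
  have onj := onCap_left n j
  -- the partner of `j = 0` can only be congruent to `1`
  have key : u.fn j ≡ capFun n j j [ZMOD n] := by
    obtain ⟨k, hk, hx⟩ := exists_even_rep hh (u.fn j)
    rw [evens_succ, List.mem_cons] at hk
    rcases hk with rfl | hk
    · refine (onj.modEq_or hx).resolve_left fun hc => no_defect u j (modEq_self_p hu hc)
    · exfalso
      have hk' := h2 hc k hk
      have e := fn_eq_capFun u hk' hx
      rw [hu.involutive] at e
      have := (evens_pairwise (s := 0) (m := m + 1) hh (by omega))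
      rw [evens_succ] at this
      exact List.rel_of_pairwise_cons this hk _ (by rw [e]; exact hx.cap) onj
  have w0 : wt n β z j u.fn = 0 := by
    by_cases h3 : u.fn j = capFun n j j
    · rw [wt_loop hu onj h3, hβ]
    · rw [wt_noncontractible n2 hu onj h3 key, hz]
  rw [w0]; simp

end EvenProd

section LoopProducts

variable {n : ℕ} {β : ℂ} {z : ℂˣ} {i j k x y : ℤ}

/-- Over an even number `n` of nodes, the defect-free link state in which `2 k + 1` is connected to
`2 k + 2`. -/
def oddArcs (n : ℕ) [NeZero n] (hn : Even n) : LinkState n 0 :=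
  .of _ (isLinkState_arcFun (n := n) (d := 0) (Nat.zero_le _) (by
    unfold Nat.ModEq; have := Nat.even_iff.1 hn; omega))

/-- Over an even number `n` of nodes, the defect-free link state in which `2 k` is connected to
`2 k + 1`. -/
def evenArcs (n : ℕ) [NeZero n] (hn : Even n) : LinkState n 0 := (oddArcs n hn).rot 1

theorem oddArcs_fn [NeZero n] (hn : Even n) (x : ℤ) :
    (oddArcs n hn).fn x = if x % 2 = 1 then x + 1 else x - 1 := by
  obtain ⟨h, hh⟩ := hn.exists_two_nsmul
  rw [smul_eq_mul] at hh
  obtain ⟨y, s, h1, h2, rfl⟩ := exists_rep (n := n) x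
  have e : (y + n * s) % 2 = y % 2 := by
    rw [hh]; push_cast; rw [mul_assoc, Int.add_mul_emod_self_left]
  rw [oddArcs, LinkState.of_fn, arcFun_rep ⟨h1, h2⟩, if_pos (by push_cast; omega), e]
  split_ifs <;> ring

theorem evenArcs_fn [NeZero n] (hn : Even n) (x : ℤ) :
    (evenArcs n hn).fn x = if x % 2 = 0 then x + 1 else x - 1 := by
  rw [evenArcs, LinkState.rot_fn, oddArcs_fn]
  split_ifs <;> omega

theorem evenArcs_rot_one [NeZero n] (hn : Even n) : (evenArcs n hn).rot 1 = oddArcs n hn := by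
  apply LinkState.ext_fn
  funext x
  rw [LinkState.rot_fn, evenArcs_fn, oddArcs_fn]
  split_ifs <;> omega

theorem evenArcs_rot_neg_one [NeZero n] (hn : Even n) :
    (evenArcs n hn).rot (-1) = oddArcs n hn := by
  rw [evenArcs, LinkState.rot_rot, add_neg_cancel, LinkState.rot_zero]

/-- The operator `E` maps every defect-free link state to a multiple of `evenArcs`. -/
theorem evenProd_single [NeZero n] (hn : Even n) (w : LinkState n 0) (c : ℂ) :
    ∃ c', evenProd n (actE n 0 β z) (Finsupp.single w c) = Finsupp.single (evenArcs n hn) c' := by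
  obtain ⟨h, hh⟩ := hn.exists_two_nsmul
  rw [smul_eq_mul] at hh
  rw [evenProd_actE hh]
  obtain ⟨u, c', h1, h2⟩ := prod_single (β := β) (z := z) _
    (evens_pairwise (s := 0) (m := h) hh (by omega)) w c
  refine ⟨c', ?_⟩
  rw [h1]
  by_cases h0 : c' = 0
  · simp [h0]
  · rw [eq_of_evens hh (h2 h0) (v := evenArcs n hn)]
    intro j hj
    obtain ⟨k, _, _, rfl⟩ := mem_evens.1 hj
    rw [evenArcs_fn, if_pos (by omega)]

theorem evenProd_single_evenArcs [NeZero n] (hn : Even n) (c : ℂ) :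
    evenProd n (actE n 0 β z) (Finsupp.single (evenArcs n hn) c) =
      Finsupp.single (evenArcs n hn) (c * β ^ (n / 2)) := by
  obtain ⟨h, hh⟩ := hn.exists_two_nsmul
  rw [smul_eq_mul] at hh
  rw [evenProd_actE hh, show n / 2 = h by omega]
  have key : ∀ m s : ℕ, ((evens s m).map (opE n 0 β z)).prod
      (Finsupp.single (evenArcs n hn) c) = Finsupp.single (evenArcs n hn) (c * β ^ m) := by
    intro m
    induction m with
    | zero => intro s; simp [evens]
    | succ m ih =>
      intro s
      have e : (evenArcs n hn).fn (2 * s) = 2 * s + 1 := by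
        rw [evenArcs_fn, if_pos (by omega)]
      rw [evens_succ, List.map_cons, List.prod_cons, Module.End.mul_apply, ih, opE_single,
        next_eq_self fun x hx => fn_eq_capFun _ e hx,
        wt_loop (evenArcs n hn).isLinkState (onCap_left n _) (by rw [e]; simp [capFun]), pow_succ,
        mul_assoc]
  exact key h 0

/-- The generators `e_{2 s}, …, e_{n - 2}` applied to `oddArcs` only make a long arc, from
`2 s - 1` to `n`, with short arcs from `1` to `2 s - 2` to its left. -/
theorem evens_single_oddArcs [NeZero n] (hn : Even n) {h : ℕ} (hh : n = 2 * h) (c : ℂ) (m s : ℕ)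
    (hs : 1 ≤ s) (hm : s + m = h) :
    ∃ v : LinkState n 0, ((evens s m).map (opE n 0 β z)).prod (Finsupp.single (oddArcs n hn) c) =
      Finsupp.single v c ∧ v.fn (2 * s - 1) = n ∧
        ∀ k : ℤ, 1 ≤ k → k < s → v.fn (2 * k - 1) = 2 * k := by
  induction m generalizing s with
  | zero =>
    refine ⟨oddArcs n hn, by simp [evens], ?_, fun k _ _ => ?_⟩
    · rw [oddArcs_fn, if_pos (by omega)]; omega
    · rw [oddArcs_fn, if_pos (by omega)]; omega
  | succ m ih =>
    obtain ⟨v, h1, h2, h3⟩ := ih (s + 1) (by omega) (by omega)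
    push_cast at h2 h3
    have hv := v.isLinkState
    have a1 : v.fn (2 * s - 1) = 2 * s := h3 s (by omega) (by omega)
    have a2 : v.fn (2 * s) = 2 * s - 1 := by
      have := hv.involutive (2 * s - 1)
      rwa [a1] at this
    have a3 : v.fn (2 * s + 1) = n := by rw [← h2]; congr 1; ring
    have hB : ¬ (v.fn (2 * s) = 2 * s ∧ v.fn (2 * s + 1) = 2 * s + 1) := by omega
    have cap : capFun n (2 * s) (2 * s) = 2 * s + 1 := by simp [capFun]
    have onc := onCap_left n (2 * s)
    have far : ∀ x : ℤ, 1 ≤ x → x < 2 * s → ¬ OnCap n (2 * s) x := fun x b1 b2 => by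
      have := onCap_iff_of_range (n := n) (x := x) (j := 2 * s) (s := 0) (by omega) (by omega)
      rw [mul_zero, add_zero] at this
      rw [this]; omega
    have hw : wt n β z (2 * s) v.fn = 1 := by
      refine wt_one hv onc (by omega) (by rw [cap, a3]; omega) ?_
      rw [cap, a2]
      exact fun hc => far (2 * s - 1) (by omega) (by omega)
        ((onCap_of_modEq hc).2 (onCap_right n _))
    refine ⟨v.next (2 * s), ?_, ?_, ?_⟩
    · rw [evens_succ, List.map_cons, List.prod_cons, Module.End.mul_apply, h1, opE_single, hw,
        mul_one]
    · rw [LinkState.next_fn hB, joinFun_of_arc (far _ (by omega) (by omega)) (by rwa [a1]), a1,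
        cap, a3]
      rw [a1, cap, a3]; omega
    · intro k k1 k2
      have := h3 k k1 (by omega)
      rw [LinkState.next_fn hB, joinFun_of_not (far _ (by omega) (by omega)), this]
      rw [this]; exact far _ (by omega) (by omega)

/-- The last generator `e_0` of `E`, applied to `oddArcs`, closes a single loop, which is
non-contractible. -/
theorem evenProd_single_oddArcs [NeZero n] (hn : Even n) (c : ℂ) :
    evenProd n (actE n 0 β z) (Finsupp.single (oddArcs n hn) c) =
      Finsupp.single (evenArcs n hn) (c * ((z : ℂ) + (z : ℂ)⁻¹)) := by
  obtain ⟨c', hc'⟩ := evenProd_single (β := β) (z := z) hn (oddArcs n hn) c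
  obtain ⟨h, hh⟩ := hn.exists_two_nsmul
  rw [smul_eq_mul] at hh
  have h0 := NeZero.pos n
  obtain ⟨m, rfl⟩ : ∃ m, h = m + 1 := ⟨h - 1, by omega⟩
  obtain ⟨v, h1, h2, -⟩ := evens_single_oddArcs (β := β) (z := z) hn hh c m 1 le_rfl (by omega)
  have h2' : v.fn 1 = n := by rw [← h2]; norm_num
  have on1 : OnCap n (2 * ((0 : ℕ) : ℤ)) 1 := Or.inr (by simp)
  have n2 : 2 ≤ n := by omega
  have cap1 : capFun n (2 * ((0 : ℕ) : ℤ)) 1 = 0 := by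
    have := capFun_right (n := n) (j := 0) n2 (s := 0)
    simpa using this
  have hw : wt n β z (2 * ((0 : ℕ) : ℤ)) v.fn = (z : ℂ) + (z : ℂ)⁻¹ := by
    refine wt_noncontractible n2 v.isLinkState on1 ?_ ?_
    · rw [cap1, h2']; omega
    · rw [cap1, h2']; simp
  have e : evenProd n (actE n 0 β z) (Finsupp.single (oddArcs n hn) c) =
      Finsupp.single (v.next (2 * ((0 : ℕ) : ℤ))) (c * ((z : ℂ) + (z : ℂ)⁻¹)) := by
    rw [evenProd_actE hh, evens_succ, List.map_cons, List.prod_cons, Module.End.mul_apply, h1,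
      opE_single, hw]
  rw [e] at hc' ⊢
  by_cases h4 : c * ((z : ℂ) + (z : ℂ)⁻¹) = 0
  · rw [h4]; simp
  · rcases (Finsupp.single_eq_single_iff _ _ _ _).1 hc' with h5 | h5
    · rw [h5.1]
    · exact absurd h5.1 h4

theorem opOm_single_no_defect [NeZero n] (w : LinkState n 0) (c : ℂ) :
    opOm n 0 z (Finsupp.single w c) = Finsupp.single (w.rot 1) c := by
  rw [opOm_single, if_neg (no_defect w 1), mul_one]

theorem opOmInv_single_no_defect [NeZero n] (w : LinkState n 0) (c : ℂ) :
    opOmInv n 0 z (Finsupp.single w c) = Finsupp.single (w.rot (-1)) c := by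
  rw [opOmInv_single, if_neg (no_defect w 0), mul_one]

theorem even_mul_opOm_mul_even [NeZero n] (hn : Even n) :
    evenProd n (actE n 0 β z) * opOm n 0 z * evenProd n (actE n 0 β z) =
      ((z : ℂ) + (z : ℂ)⁻¹) • evenProd n (actE n 0 β z) := by
  refine Finsupp.lhom_ext fun w c => ?_
  obtain ⟨c', hc'⟩ := evenProd_single (β := β) (z := z) hn w c
  rw [Module.End.mul_apply, Module.End.mul_apply, LinearMap.smul_apply, hc',
    opOm_single_no_defect, evenArcs_rot_one, evenProd_single_oddArcs, Finsupp.smul_single,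
    smul_eq_mul, mul_comm]

theorem opOm_mul_oddProd [NeZero n] {d : ℕ} :
    opOm n d z * oddProd n (actE n d β z) = evenProd n (actE n d β z) * opOm n d z := by
  have key : ∀ l : List ℕ, opOm n d z *
      (l.map fun k : ℕ => actE n d β z ((2 * k + 1 : ℕ) : ZMod n)).prod =
      (l.map fun k : ℕ => actE n d β z ((2 * k : ℕ) : ZMod n)).prod * opOm n d z := by
    intro l
    induction l with
    | nil => simp
    | cons k l ih =>
      rw [List.map_cons, List.prod_cons, List.map_cons, List.prod_cons, ← mul_assoc,
        opOm_mul_actE, mul_assoc, ih, ← mul_assoc]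
      congr 3; push_cast; ring
  exact key _

theorem even_mul_odd_mul_even [NeZero n] (hn : Even n) :
    evenProd n (actE n 0 β z) * oddProd n (actE n 0 β z) * evenProd n (actE n 0 β z) =
      (((z : ℂ) + (z : ℂ)⁻¹) ^ 2) • evenProd n (actE n 0 β z) := by
  have hF : oddProd n (actE n 0 β z) =
      opOmInv n 0 z * (evenProd n (actE n 0 β z) * opOm n 0 z) := by
    rw [← opOm_mul_oddProd, ← mul_assoc, opOmInv_mul_opOm, one_mul]
  refine Finsupp.lhom_ext fun w c => ?_
  obtain ⟨c', hc'⟩ := evenProd_single (β := β) (z := z) hn w c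
  rw [hF, Module.End.mul_apply, Module.End.mul_apply, Module.End.mul_apply, Module.End.mul_apply,
    LinearMap.smul_apply, hc', opOm_single_no_defect, evenArcs_rot_one, evenProd_single_oddArcs,
    opOmInv_single_no_defect, evenArcs_rot_neg_one, evenProd_single_oddArcs, Finsupp.smul_single,
    smul_eq_mul]
  congr 1; ring

/-- Without defects, `E` vanishes exactly if all loops have weight zero. -/
theorem evenProd_eq_zero_iff [NeZero n] (hn : Even n) :
    evenProd n (actE n 0 β z) = 0 ↔ β = 0 ∧ (z : ℂ) + (z : ℂ)⁻¹ = 0 := by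
  constructor
  · intro h
    have h1 := evenProd_single_evenArcs (β := β) (z := z) hn 1
    have h2 := evenProd_single_oddArcs (β := β) (z := z) hn 1
    rw [h, LinearMap.zero_apply, one_mul] at h1 h2
    have h1' := Finsupp.single_eq_zero.1 h1.symm
    exact ⟨eq_zero_of_pow_eq_zero h1', Finsupp.single_eq_zero.1 h2.symm⟩
  · rintro ⟨h1, h2⟩
    exact evenProd_eq_zero_of_loops hn h1 h2

end LoopProducts

/-! ### The isomorphism between the modules with labels `z` and `-z` -/

section Sign

variable {n d : ℕ} {p : ℤ → ℤ} {β : ℂ} {z : ℂˣ} {i j k x y : ℤ}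

/-- The sign `-1` if an arc starts at `x` and crosses the boundary of the box of `x` towards the
right. -/
noncomputable def crossSign (n : ℕ) (p : ℤ → ℤ) (x : ℤ) : ℂ :=
  if cell n x < cell n (p x) then -1 else 1

/-- The sign `(-1) ^ m`, where `m` is the number of arcs, modulo `n`, that cross the boundary. -/
noncomputable def LinkState.sign [NeZero n] (w : LinkState n d) : ℂ :=
  ∏ x : ZMod n, crossSign n w.fn (x.val : ℤ)

theorem crossSign_congr [NeZero n] (h : IsLinkState n d p) (hxy : x ≡ y [ZMOD n]) :
    crossSign n p x = crossSign n p y := by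
  have := h.cell_congr hxy
  have e : cell n x < cell n (p x) ↔ cell n y < cell n (p y) := by omega
  simp only [crossSign, e]

theorem crossSign_val [NeZero n] (h : IsLinkState n d p) (x : ℤ) :
    crossSign n p ((x : ZMod n).val : ℤ) = crossSign n p x := by
  refine crossSign_congr h ?_
  rw [ZMod.val_intCast]
  exact Int.mod_modEq x n

theorem crossSign_defect (h : p x = x) : crossSign n p x = 1 := by
  rw [crossSign, h, if_neg (lt_irrefl _)]

/-- The two ends of an arc together contribute the parity of its number of crossings. -/
theorem crossSign_mul [NeZero n] (h : IsLinkState n d p) (x : ℤ) :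
    crossSign n p x * crossSign n p (p x) = (-1) ^ (cell n (p x) - cell n x) := by
  have h1 := cell_mono (n := n) (h.span x).le
  have h2 := cell_mono (n := n) (h.span (p x)).le
  rw [h.involutive] at h2
  have e : ∀ t : ℤ, cell n (t + n) = cell n t + 1 := fun t => by
    have := cell_add_mul (n := n) t 1; rwa [mul_one] at this
  rw [e] at h1 h2
  rw [crossSign, crossSign, h.involutive]
  rcases lt_trichotomy (cell n x) (cell n (p x)) with h3 | h3 | h3
  · rw [if_pos h3, if_neg (by omega), show cell n (p x) - cell n x = 1 by omega]; simp
  · rw [h3]; simp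
  · rw [if_neg (by omega), if_pos h3, show cell n (p x) - cell n x = -1 by omega]; norm_num

theorem sign_mul_self [NeZero n] (w : LinkState n d) : w.sign * w.sign = 1 := by
  rw [LinkState.sign, ← Finset.prod_mul_distrib]
  refine Finset.prod_eq_one fun x _ => ?_
  unfold crossSign
  split_ifs <;> norm_num

/-- The ratio of two signs, in terms of the nodes `s` at which the link states differ. -/
theorem sign_eq_of_eqOn [NeZero n] {v w : LinkState n d} (s : Finset (ZMod n))
    (hs : ∀ x : ℤ, (x : ZMod n) ∉ s → v.fn x = w.fn x) {a b : ℂ}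
    (ha : (∏ x ∈ s, crossSign n v.fn (x.val : ℤ)) * a =
      (∏ x ∈ s, crossSign n w.fn (x.val : ℤ)) * b) :
    v.sign * a = w.sign * b := by
  have hc : ∏ x ∈ sᶜ, crossSign n v.fn (x.val : ℤ) = ∏ x ∈ sᶜ, crossSign n w.fn (x.val : ℤ) := by
    refine Finset.prod_congr rfl fun x hx => ?_
    have := hs (x.val : ℤ) (by simpa using hx)
    rw [crossSign, crossSign, this]
  rw [LinkState.sign, LinkState.sign, ← Finset.prod_compl_mul_prod s,
    ← Finset.prod_compl_mul_prod s, hc, mul_assoc, ha, mul_assoc]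

/-- The matrix elements of `e_j` with labels `z` and `-z` differ by the change of the sign. -/
theorem sign_next_mul_wt [NeZero n] (w : LinkState n d) (j : ℤ) :
    (w.next j).sign * wt n β z j w.fn = w.sign * wt n β (-z) j w.fn := by
  by_cases hB : w.fn j = j ∧ w.fn (j + 1) = j + 1
  · simp [wt_both hB]
  have h := w.isLinkState
  have hq := (w.next j).isLinkState
  have hn : 2 ≤ n := by
    have h1 := not_modEq_of h hB
    have h2 := NeZero.pos n
    by_contra hc
    obtain rfl : n = 1 := by omega
    exact h1 (by simp)
  have qc : ∀ {x}, OnCap n j x → (w.next j).fn x = capFun n j x := fun hx => next_onCap hB hx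
  have qn : ∀ {x}, ¬ OnCap n j x → ¬ OnCap n j (w.fn x) → (w.next j).fn x = w.fn x :=
    fun h1 h2 => by rw [LinkState.next_fn hB, joinFun_of_not h1 h2]
  have zc : ∀ {a b : ℤ}, ((a : ZMod n) = b) ↔ a ≡ b [ZMOD n] := ZMod.intCast_eq_intCast_iff _ _ _
  have sq : ∀ a b : ℤ, 2 ∣ a - b → ((-1 : ℂ) ^ a = (-1) ^ b) := by
    rintro a b ⟨m, hm⟩
    rw [show a = b + 2 * m by linarith, zpow_add₀ (by norm_num), zpow_mul]; simp
  -- the nodes outside of `j`, `j + 1` and their partners keep their partners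
  have out : ∀ {x m : ℤ}, OnCap n j x → ¬ m ≡ x [ZMOD n] → ¬ m ≡ capFun n j x [ZMOD n] →
      ¬ m ≡ w.fn x [ZMOD n] → ¬ m ≡ w.fn (capFun n j x) [ZMOD n] →
      (w.next j).fn m = w.fn m := by
    intro x m hx h1 h2 h3 h4
    refine qn (fun hc => (hx.modEq_or hc).elim h1 h2) fun hc => ?_
    rcases hx.modEq_or hc with h5 | h5
    · have := modEq_p h h5
      rw [h.involutive] at this; exact h3 this
    · have := modEq_p h h5
      rw [h.involutive] at this; exact h4 this
  -- the defect at `x` moves to `y`, the partner of the other end `x'` of the cap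
  by_cases hD : ∃ x, OnCap n j x ∧ w.fn x = x
  · obtain ⟨x, hx, h1⟩ := hD
    have h2 : w.fn (capFun n j x) ≠ capFun n j x := fun hc => hB ((both_iff h hx).2 ⟨h1, hc⟩)
    have x'x := capFun_not_modEq hn j x
    set x' := capFun n j x with hx'
    have py := h.involutive x'
    set y := w.fn x' with hy
    have yx : ¬ y ≡ x [ZMOD n] := fun hc => x'x (by
      have := modEq_p h hc; rwa [py, h1] at this)
    have yx' : ¬ y ≡ x' [ZMOD n] := fun hc => h2 (modEq_self_p h hc)
    have qy : (w.next j).fn y = y := by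
      rw [next_fixed_of_defect hn hx h1 h2]
      exact ⟨yx, Or.inr rfl⟩
    rw [wt_defect hn h hx h1 h2, wt_defect hn h hx h1 h2, ← hx', ← hy]
    refine sign_eq_of_eqOn {(x : ZMod n), (x' : ZMod n), (y : ZMod n)} ?_ ?_
    · intro m hm
      simp only [Finset.mem_insert, Finset.mem_singleton, zc, not_or] at hm
      exact out hx hm.1 hm.2.1 (by rw [h1]; exact hm.1) hm.2.2
    · have m1 : (x : ZMod n) ∉ ({(x' : ZMod n), (y : ZMod n)} : Finset (ZMod n)) := by
        simp only [Finset.mem_insert, Finset.mem_singleton, zc, not_or]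
        exact ⟨fun hc => x'x hc.symm, fun hc => yx hc.symm⟩
      have m2 : (x' : ZMod n) ∉ ({(y : ZMod n)} : Finset (ZMod n)) := by
        simp only [Finset.mem_singleton, zc]
        exact fun hc => yx' hc.symm
      rw [Finset.prod_insert m1, Finset.prod_insert m2, Finset.prod_singleton,
        Finset.prod_insert m1, Finset.prod_insert m2, Finset.prod_singleton]
      simp only [crossSign_val hq, crossSign_val h]
      have a1 := crossSign_mul hq x
      have a2 := crossSign_mul h x'
      rw [qc hx, ← hx'] at a1
      rw [← hy] at a2
      rw [crossSign_defect qy, crossSign_defect h1, mul_one, one_mul, a1, a2, Units.val_neg,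
        neg_eq_neg_one_mul (z : ℂ), mul_zpow, ← mul_assoc, ← zpow_add₀ (by norm_num)]
      congr 1
      exact sq _ _ ⟨cell n x' - cell n x, by ring⟩
  push Not at hD
  have hx := onCap_left n j
  have g1 := hD j hx
  have g2 := hD _ hx.cap
  have cj : capFun n j j = j + 1 := by simp [capFun]
  by_cases c1 : w.fn j = capFun n j j
  · rw [wt_loop h hx c1, wt_loop h hx c1, next_eq_self]
    exact fun x hx => fn_eq_capFun w (by rw [c1, cj]) hx
  have x'x := capFun_not_modEq hn j j
  have a1 := crossSign_mul hq j
  have b1 := crossSign_mul h j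
  rw [qc hx] at a1
  -- a non-contractible loop crosses the boundary once more or less than the short arc
  by_cases c2 : w.fn j ≡ capFun n j j [ZMOD n]
  · rw [wt_noncontractible hn h hx c1 c2, wt_noncontractible hn h hx c1 c2]
    refine sign_eq_of_eqOn {(j : ZMod n), ((capFun n j j : ℤ) : ZMod n)} ?_ ?_
    · intro m hm
      simp only [Finset.mem_insert, Finset.mem_singleton, zc, not_or] at hm
      have c3 := modEq_p h c2
      rw [h.involutive] at c3
      exact out hx hm.1 hm.2 (fun hc => hm.2 (hc.trans c2)) fun hc => hm.1 (hc.trans c3.symm)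
    · have m1 : (j : ZMod n) ∉ ({((capFun n j j : ℤ) : ZMod n)} : Finset (ZMod n)) := by
        simp only [Finset.mem_singleton, zc]
        exact fun hc => x'x hc.symm
      rw [Finset.prod_insert m1, Finset.prod_singleton, Finset.prod_insert m1,
        Finset.prod_singleton]
      simp only [crossSign_val hq, crossSign_val h]
      rw [crossSign_congr h c2.symm, a1, b1]
      have e1 : w.fn j = j + 1 + n * (-1) := by
        have := (h.modEq_succ hn (by rwa [cj] at c2)).resolve_left (by rwa [cj] at c1)
        rw [this]; ring
      rw [e1, cell_add_mul, cj, Units.val_neg,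
        show cell n (j + 1) + -1 - cell n j = cell n (j + 1) - cell n j - 1 by ring,
        zpow_sub_one₀ (by norm_num), inv_neg]
      norm_num
      ring
  -- the arcs from the two ends of the cap are joined to one arc
  · rw [wt_one h hx g1 g2 c2, wt_one h hx g1 g2 c2]
    have b2 := crossSign_mul h (capFun n j j)
    have px := h.involutive j
    set x' := capFun n j j with hx'
    have nx : ¬ OnCap n j (w.fn j) := fun hc => (hx.modEq_or hc).elim
      (fun hc => g1 (modEq_self_p h hc)) c2
    have nx' : ¬ OnCap n j (w.fn x') := fun hc => (hx.modEq_or hc).elim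
      (fun hc => c2 (by
        have := modEq_p h hc
        rw [h.involutive] at this; exact this.symm)) fun hc => g2 (modEq_self_p h hc)
    have yy : ¬ w.fn j ≡ w.fn x' [ZMOD n] := fun hc => x'x ((modEq_p_iff h).1 hc).symm
    have qy : (w.next j).fn (w.fn j) = w.fn x' := by
      rw [LinkState.next_fn hB, joinFun_of_arc nx (by rwa [px]) (by rwa [px]), px]
    have a2 := crossSign_mul hq (w.fn j)
    rw [qy] at a2
    refine sign_eq_of_eqOn
      {(j : ZMod n), (x' : ZMod n), ((w.fn j : ℤ) : ZMod n), ((w.fn x' : ℤ) : ZMod n)} ?_ ?_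
    · intro m hm
      simp only [Finset.mem_insert, Finset.mem_singleton, zc, not_or] at hm
      exact out hx hm.1 hm.2.1 hm.2.2.1 hm.2.2.2
    · have ne : ∀ {a b : ℤ}, OnCap n j a → ¬ OnCap n j b → ¬ a ≡ b [ZMOD n] :=
        fun h1 h2 h3 => h2 ((onCap_of_modEq h3).1 h1)
      have m1 : (j : ZMod n) ∉ ({(x' : ZMod n), ((w.fn j : ℤ) : ZMod n),
          ((w.fn x' : ℤ) : ZMod n)} : Finset (ZMod n)) := by
        simp only [Finset.mem_insert, Finset.mem_singleton, zc, not_or]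
        exact ⟨fun hc => x'x hc.symm, ne hx nx, ne hx nx'⟩
      have m2 : (x' : ZMod n) ∉ ({((w.fn j : ℤ) : ZMod n),
          ((w.fn x' : ℤ) : ZMod n)} : Finset (ZMod n)) := by
        simp only [Finset.mem_insert, Finset.mem_singleton, zc, not_or]
        exact ⟨ne hx.cap nx, ne hx.cap nx'⟩
      have m3 : ((w.fn j : ℤ) : ZMod n) ∉ ({((w.fn x' : ℤ) : ZMod n)} : Finset (ZMod n)) := by
        simpa only [Finset.mem_singleton, zc] using yy
      rw [Finset.prod_insert m1, Finset.prod_insert m2, Finset.prod_insert m3,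
        Finset.prod_singleton, Finset.prod_insert m1, Finset.prod_insert m2,
        Finset.prod_insert m3, Finset.prod_singleton]
      simp only [crossSign_val hq, crossSign_val h]
      congr 1
      calc _ = (crossSign n (w.next j).fn j * crossSign n (w.next j).fn x') *
            (crossSign n (w.next j).fn (w.fn j) * crossSign n (w.next j).fn (w.fn x')) := by ring
        _ = (crossSign n w.fn j * crossSign n w.fn (w.fn j)) *
            (crossSign n w.fn x' * crossSign n w.fn (w.fn x')) := by
          rw [a1, a2, b1, b2, ← zpow_add₀ (by norm_num), ← zpow_add₀ (by norm_num)]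
          exact sq _ _ ⟨cell n x' - cell n (w.fn j), by ring⟩
        _ = _ := by ring

/-- The sign change of the link states with an odd number of arcs across the boundary. -/
noncomputable def signMap (n d : ℕ) [NeZero n] : Module.End ℂ (StdSpace n d) :=
  Finsupp.linearCombination ℂ fun w : LinkState n d => Finsupp.single w w.sign

theorem signMap_single [NeZero n] (w : LinkState n d) (c : ℂ) :
    signMap n d (Finsupp.single w c) = Finsupp.single w (c * w.sign) :=
  (Finsupp.linearCombination_single _ _ _).trans (Finsupp.smul_single _ _ _)

theorem signMap_mul_self [NeZero n] : signMap n d * signMap n d = 1 := by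
  refine Finsupp.lhom_ext fun w c => ?_
  rw [Module.End.mul_apply, signMap_single, signMap_single, mul_assoc, sign_mul_self, mul_one,
    Module.End.one_apply]

theorem signMap_mul_opE [NeZero n] (j : ℤ) :
    signMap n d * opE n d β z j = opE n d β (-z) j * signMap n d := by
  refine Finsupp.lhom_ext fun w c => ?_
  rw [Module.End.mul_apply, Module.End.mul_apply, opE_single, signMap_single, signMap_single,
    opE_single, mul_assoc, mul_assoc, mul_comm (wt n β z j w.fn), sign_next_mul_wt]

theorem signMap_involutive [NeZero n] : Function.Involutive (signMap n d) := fun w => by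
  rw [← Module.End.mul_apply, signMap_mul_self, Module.End.one_apply]

theorem periodicIso_neg [NeZero n] (d : ℕ) (z : ℂˣ) : PeriodicIso n β (d, z) (d, -z) := by
  refine ⟨LinearEquiv.ofInvolutive (signMap n d) signMap_involutive, fun j w => ?_⟩
  change signMap n d (opE n d β z (j.val : ℤ) w) = opE n d β (-z) (j.val : ℤ) (signMap n d w)
  rw [← Module.End.mul_apply, signMap_mul_opE, Module.End.mul_apply]

theorem periodicIso_refl [NeZero n] (s : Label) : PeriodicIso n β s s :=
  ⟨LinearEquiv.refl ℂ _, fun _ _ => rfl⟩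

theorem periodicIso_full [NeZero n] (z z' : ℂˣ) : PeriodicIso n β (n, z) (n, z') := by
  refine ⟨LinearEquiv.refl ℂ _, fun j w => ?_⟩
  have e : ∀ z : ℂˣ, periodicAct n β (n, z) j = 0 := fun z => opE_eq_zero_of_full _
  simp only [e]
  simp

end Sign

/-! ### The quotients over which a standard module descends -/

section Descend

variable {n : ℕ} {β : ℂ} {s : Label}

theorem smul_eq_smul_iff_eq_zero_or {M : Type} [AddCommGroup M] [Module ℂ M] {a b : ℂ} {T : M} :
    a • T = b • T ↔ T = 0 ∨ a = b := by
  rw [← sub_eq_zero, ← sub_smul, smul_eq_zero, sub_eq_zero, or_comm]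

theorem lift_affine_evenProd [NeZero n] :
    FreeAlgebra.lift ℂ (affineAct n β s) (evenProd n (aE n)) = evenProd n (actE n s.1 β s.2) := by
  refine (map_evenProd (FreeAlgebra.lift ℂ (affineAct n β s)) _).trans ?_
  simp only [aE, FreeAlgebra.lift_ι_apply]
  rfl

theorem lift_affine_opOm [NeZero n] :
    FreeAlgebra.lift ℂ (affineAct n β s) (aOm n) = opOm n s.1 s.2 := by
  rw [aOm, FreeAlgebra.lift_ι_apply]; rfl

theorem lift_periodic_e [NeZero n] (j : ZMod n) :
    FreeAlgebra.lift ℂ (periodicAct n β s) (pE n j) = actE n s.1 β s.2 j := by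
  rw [pE, FreeAlgebra.lift_ι_apply]; rfl

theorem lift_periodic_descProd [NeZero n] (m : ℕ) :
    FreeAlgebra.lift ℂ (periodicAct n β s) (descProd n (pE n) m) =
      descProd n (actE n s.1 β s.2) m := by
  refine (map_descProd (FreeAlgebra.lift ℂ (periodicAct n β s)) _ _).trans ?_
  simp only [lift_periodic_e]

theorem lift_periodic_evenProd [NeZero n] :
    FreeAlgebra.lift ℂ (periodicAct n β s) (evenProd n (pE n)) =
      evenProd n (actE n s.1 β s.2) := by
  refine (map_evenProd (FreeAlgebra.lift ℂ (periodicAct n β s)) _).trans ?_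
  simp only [lift_periodic_e]

theorem lift_periodic_oddProd [NeZero n] :
    FreeAlgebra.lift ℂ (periodicAct n β s) (oddProd n (pE n)) =
      oddProd n (actE n s.1 β s.2) := by
  refine (map_oddProd (FreeAlgebra.lift ℂ (periodicAct n β s)) _).trans ?_
  simp only [lift_periodic_e]

theorem isAffineModule_aTL [NeZero n] (s : Label) : IsAffineModule n β (aTLRel n β) s :=
  (exists_presented_hom_iff _ _).2 fun _ _ h => lift_aTLRel s h

theorem isAffineModule_uaTL_iff [NeZero n] (γ : ℂ) :
    IsAffineModule n β (uaTLRel n β γ) s ↔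
      opOm n s.1 s.2 ^ n = γ • (1 : Module.End ℂ (StdSpace n s.1)) := by
  refine (exists_presented_hom_iff _ _).trans ⟨fun h => ?_, fun h a b hab => ?_⟩
  · simpa only [map_pow, map_smul, map_one, lift_affine_opOm] using h _ _ .unwind
  · cases hab with
    | affine h => exact lift_aTLRel s h
    | unwind => simpa only [map_pow, map_smul, map_one, lift_affine_opOm] using h

theorem isAffineModule_uaTLa_iff [NeZero n] (α : ℂ) :
    IsAffineModule n β (uaTLaRel n β α) s ↔
      evenProd n (actE n s.1 β s.2) * opOm n s.1 s.2 * evenProd n (actE n s.1 β s.2) =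
          α • evenProd n (actE n s.1 β s.2) ∧
        opOm n s.1 s.2 ^ n = 1 := by
  refine (exists_presented_hom_iff _ _).trans ⟨fun h => ⟨?_, ?_⟩, fun h a b hab => ?_⟩
  · simpa only [map_mul, map_smul, lift_affine_opOm, lift_affine_evenProd] using h _ _ .loop
  · simpa only [map_pow, map_one, lift_affine_opOm] using h _ _ .unwind
  · cases hab with
    | affine h => exact lift_aTLRel s h
    | loop => simpa only [map_mul, map_smul, lift_affine_opOm, lift_affine_evenProd] using h.1
    | unwind => simpa only [map_pow, map_one, lift_affine_opOm] using h.2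

theorem isAffineModule_uaTLb_iff [NeZero n] (γ : ℂ) :
    IsAffineModule n β (uaTLbRel n β γ) s ↔
      evenProd n (actE n s.1 β s.2) = 0 ∧
        opOm n s.1 s.2 ^ n = γ • (1 : Module.End ℂ (StdSpace n s.1)) := by
  refine (exists_presented_hom_iff _ _).trans ⟨fun h => ⟨?_, ?_⟩, fun h a b hab => ?_⟩
  · simpa only [map_zero, lift_affine_evenProd] using h _ _ .loop
  · simpa only [map_pow, map_smul, map_one, lift_affine_opOm] using h _ _ .unwind
  · cases hab with
    | affine h => exact lift_aTLRel s h
    | loop => simpa only [map_zero, lift_affine_evenProd] using h.1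
    | unwind => simpa only [map_pow, map_smul, map_one, lift_affine_opOm] using h.2

theorem isPeriodicModule_upTL_iff [NeZero n] (γ : ℂ) :
    IsPeriodicModule n β (upTLRel n β γ) s ↔
      actE n s.1 β s.2 0 * descProd n (actE n s.1 β s.2) n ^ (n - 2) =
        γ ^ 2 • actE n s.1 β s.2 0 := by
  refine (exists_presented_hom_iff _ _).trans ⟨fun h => ?_, fun h a b hab => ?_⟩
  · simpa only [map_mul, map_pow, map_smul, lift_periodic_e, lift_periodic_descProd] using
      h _ _ .unwind
  · cases hab with
    | periodic h => exact lift_pTLRel s h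
    | unwind =>
      simpa only [map_mul, map_pow, map_smul, lift_periodic_e, lift_periodic_descProd] using h

theorem isPeriodicModule_upTLa_iff [NeZero n] (α : ℂ) :
    IsPeriodicModule n β (upTLaRel n β α) s ↔
      evenProd n (actE n s.1 β s.2) * oddProd n (actE n s.1 β s.2) * evenProd n (actE n s.1 β s.2) =
          α ^ 2 • evenProd n (actE n s.1 β s.2) ∧
        actE n s.1 β s.2 0 * descProd n (actE n s.1 β s.2) n ^ ((n - 2) / 2) =
          actE n s.1 β s.2 0 := by
  refine (exists_presented_hom_iff _ _).trans ⟨fun h => ⟨?_, ?_⟩, fun h a b hab => ?_⟩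
  · simpa only [map_mul, map_smul, lift_periodic_evenProd, lift_periodic_oddProd] using h _ _ .loop
  · simpa only [map_mul, map_pow, lift_periodic_e, lift_periodic_descProd] using h _ _ .unwind
  · cases hab with
    | periodic h => exact lift_pTLRel s h
    | loop => simpa only [map_mul, map_smul, lift_periodic_evenProd, lift_periodic_oddProd] using h.1
    | unwind => simpa only [map_mul, map_pow, lift_periodic_e, lift_periodic_descProd] using h.2

theorem isPeriodicModule_upTLb_iff [NeZero n] (γ : ℂ) :
    IsPeriodicModule n β (upTLbRel n β γ) s ↔
      evenProd n (actE n s.1 β s.2) = 0 ∧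
        actE n s.1 β s.2 0 * descProd n (actE n s.1 β s.2) n ^ ((n - 2) / 2) =
          γ • actE n s.1 β s.2 0 := by
  refine (exists_presented_hom_iff _ _).trans ⟨fun h => ⟨?_, ?_⟩, fun h a b hab => ?_⟩
  · simpa only [map_zero, lift_periodic_evenProd] using h _ _ .loop
  · simpa only [map_mul, map_pow, map_smul, lift_periodic_e, lift_periodic_descProd] using
      h _ _ .unwind
  · cases hab with
    | periodic h => exact lift_pTLRel s h
    | loop => simpa only [map_zero, lift_periodic_evenProd] using h.1
    | unwind =>
      simpa only [map_mul, map_pow, map_smul, lift_periodic_e, lift_periodic_descProd] using h.2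

variable {d : ℕ} {z : ℂˣ}

theorem actE_zero [NeZero n] : actE n d β z 0 = opE n d β z 0 := by
  have := actE_intCast (n := n) (d := d) (β := β) (z := z) 0
  rwa [Int.cast_zero] at this

theorem opOm_pow_n_eq_iff [NeZero n] (hs : (d, z) ∈ labels n) (c : ℂ) :
    opOm n d z ^ n = c • (1 : Module.End ℂ (StdSpace n d)) ↔ (z : ℂ) ^ d = c := by
  obtain ⟨w, -⟩ := exists_linkState_arc (n := n) hs.1 hs.2
  rw [opOm_pow_n]
  refine (smul_eq_smul_iff_eq_zero_or (M := Module.End ℂ (StdSpace n d))).trans (or_iff_right fun h => ?_)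
  have := LinearMap.congr_fun h (Finsupp.single w (1 : ℂ))
  simp at this

theorem actE_zero_eq_zero_iff [NeZero n] (hs : (d, z) ∈ labels n) (hn : 3 ≤ n) :
    actE n d β z 0 = 0 ↔ d = n := by
  rw [actE_zero]
  constructor
  · intro h
    by_contra hc
    exact opE_zero_ne_zero hn (lt_of_le_of_ne hs.1 hc) hs.2 h
  · rintro rfl
    exact opE_eq_zero_of_full 0

theorem unwind_actE_even [NeZero n] (hn : Even n) :
    actE n d β z 0 * descProd n (actE n d β z) n ^ ((n - 2) / 2) =
      ((z : ℂ) ^ d) • actE n d β z 0 := by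
  have h2 : 2 ≤ n := by have := NeZero.pos n; obtain ⟨k, hk⟩ := hn; omega
  rw [unwind_even opOm_mul_actE opOm_mul_opOmInv (opOm_sq_mul_actE h2) hn, opOm_pow_n,
    smul_mul_assoc, one_mul]

theorem unwind_actE_odd [NeZero n] (hn : 2 ≤ n) :
    actE n d β z 0 * descProd n (actE n d β z) n ^ (n - 2) =
      (((z : ℂ) ^ d) ^ 2) • actE n d β z 0 := by
  rw [unwind_odd opOm_mul_actE opOm_mul_opOmInv (opOm_sq_mul_actE hn) hn, mul_comm 2 n, pow_mul,
    opOm_pow_n, smul_pow, one_pow, smul_mul_assoc, one_mul]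

theorem evenProd_two (e : ZMod 2 → Module.End ℂ (StdSpace 2 d)) : evenProd 2 e = e 0 := by
  simp [evenProd]

end Descend

/-! ### Lists of roots of unity -/

section Lists

variable {n d : ℕ} {γ ν ζ : ℂ}

theorem pow_eq_iff_exists_exp (hd : 0 < d) (hν : ν ^ d = γ) (hζ : ζ ≠ 0) :
    ζ ^ d = γ ↔ ∃ r : ℕ, r < d ∧ ζ = ν * Complex.exp (2 * Real.pi * Complex.I * r / d) := by
  have hexp : ∀ r : ℕ, Complex.exp (2 * Real.pi * Complex.I * r / d) =
      Complex.exp (2 * Real.pi * Complex.I / d) ^ r := fun r => by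
    rw [← Complex.exp_nat_mul]; congr 1; ring
  have hp := Complex.isPrimitiveRoot_exp d hd.ne'
  constructor
  · intro h
    have hν0 : ν ≠ 0 := by
      rintro rfl
      rw [zero_pow hd.ne'] at hν
      exact hζ (eq_zero_of_pow_eq_zero (h.trans hν.symm))
    have : NeZero d := ⟨hd.ne'⟩
    obtain ⟨r, hr, e⟩ := hp.eq_pow_of_pow_eq_one (ξ := ζ / ν) (by
      rw [div_pow, h, hν]; exact div_self (hν ▸ pow_ne_zero d hν0))
    refine ⟨r, hr, ?_⟩
    rw [hexp, e]; field_simp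
  · rintro ⟨r, -, rfl⟩
    rw [mul_pow, hν, hexp, ← pow_mul, mul_comm r, pow_mul, hp.pow_eq_one, one_pow, mul_one]

theorem exp_eq_neg_exp {a b : ℕ} (hd : 0 < d) (hab : a < b + d) (hba : b < a + d) :
    Complex.exp (Real.pi * Complex.I * a / d) ≠ -Complex.exp (Real.pi * Complex.I * b / d) := by
  intro h
  have h1 : Complex.exp (Real.pi * Complex.I * a / d) =
      Complex.exp (Real.pi * Complex.I * b / d + Real.pi * Complex.I) := by
    rw [Complex.exp_add, Complex.exp_pi_mul_I, mul_neg_one, h]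
  obtain ⟨m, hm⟩ := Complex.exp_eq_exp_iff_exists_int.1 h1
  have hd' : (d : ℂ) ≠ 0 := by exact_mod_cast hd.ne'
  have hπ : (Real.pi : ℂ) ≠ 0 := by exact_mod_cast Real.pi_ne_zero
  have h2 : (a : ℂ) = b + d * (1 + 2 * m) := by
    field_simp at hm
    linear_combination hm
  have h3 : (a : ℤ) = b + d * (1 + 2 * m) := by exact_mod_cast h2
  rcases lt_or_ge m 0 with h4 | h4 <;> nlinarith

theorem exp_shift (hd : 0 < d) {a b : ℕ} (h : a = b + d) :
    Complex.exp (Real.pi * Complex.I * a / d) = -Complex.exp (Real.pi * Complex.I * b / d) := by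
  have hd' : (d : ℂ) ≠ 0 := by exact_mod_cast hd.ne'
  rw [← mul_neg_one, ← Complex.exp_pi_mul_I, ← Complex.exp_add]
  congr 1
  rw [h]; push_cast; field_simp

theorem exp_double (r : ℕ) : Complex.exp (2 * Real.pi * Complex.I * r / d) =
    Complex.exp (Real.pi * Complex.I * (2 * r : ℕ) / d) := by
  congr 1; push_cast; ring

/-- For odd `d`, half of the solutions of `ζ ^ d = ± γ` suffice up to sign. -/
theorem exists_exp_of_odd (hd : Odd d) (hν : ν ^ d = γ) (hζ : ζ ≠ 0) (h : ζ ^ d = γ ∨ ζ ^ d = -γ) :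
    ∃ r : ℕ, r < d ∧ (ζ = ν * Complex.exp (Real.pi * Complex.I * r / d) ∨
      -ζ = ν * Complex.exp (Real.pi * Complex.I * r / d)) := by
  have key : ∀ ζ : ℂ, ζ ≠ 0 → ζ ^ d = γ →
      ∃ r : ℕ, r < d ∧ (ζ = ν * Complex.exp (Real.pi * Complex.I * r / d) ∨
        -ζ = ν * Complex.exp (Real.pi * Complex.I * r / d)) := by
    intro ζ hζ h
    obtain ⟨r, hr, e⟩ := (pow_eq_iff_exists_exp hd.pos hν hζ).1 h
    rw [exp_double] at e
    by_cases hr2 : 2 * r < d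
    · exact ⟨2 * r, hr2, Or.inl e⟩
    · refine ⟨2 * r - d, by omega, Or.inr ?_⟩
      rw [e, exp_shift hd.pos (b := 2 * r - d) (by omega)]; ring
  rcases h with h | h
  · exact key ζ hζ h
  · obtain ⟨r, hr, e⟩ := key (-ζ) (neg_ne_zero.2 hζ) (by rw [hd.neg_pow, h, neg_neg])
    rw [neg_neg] at e
    exact ⟨r, hr, e.symm⟩

/-- For even `d`, half of the solutions of `ζ ^ d = γ` suffice up to sign. -/
theorem exists_exp_of_even (hd : Even d) (hd0 : 0 < d) (hν : ν ^ d = γ) (hζ : ζ ≠ 0)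
    (h : ζ ^ d = γ) :
    ∃ r : ℕ, 2 * r < d ∧ (ζ = ν * Complex.exp (2 * Real.pi * Complex.I * r / d) ∨
      -ζ = ν * Complex.exp (2 * Real.pi * Complex.I * r / d)) := by
  obtain ⟨r, hr, e⟩ := (pow_eq_iff_exists_exp hd0 hν hζ).1 h
  obtain ⟨k, hk⟩ := hd
  by_cases hr2 : 2 * r < d
  · exact ⟨r, hr2, Or.inl e⟩
  · refine ⟨r - k, by omega, Or.inr ?_⟩
    rw [e, exp_double, exp_double, exp_shift hd0 (b := 2 * (r - k)) (by omega)]; ring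

theorem affineList_eq {ν : ℕ → ℂ} (hν : ∀ d : ℕ, 1 ≤ d → ν d ^ d = γ) :
    affineList n ν = {s ∈ labels n | 0 < s.1 ∧ (s.2 : ℂ) ^ s.1 = γ} := by
  ext ⟨d, z⟩
  constructor
  · rintro ⟨h1, h2, h3, h4⟩
    exact ⟨⟨h2, h3⟩, h1, (pow_eq_iff_exists_exp h1 (hν d h1) z.ne_zero).2 h4⟩
  · rintro ⟨⟨h2, h3⟩, h1, h4⟩
    exact ⟨h1, h2, h3, (pow_eq_iff_exists_exp h1 (hν d h1) z.ne_zero).1 h4⟩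

theorem mem_loopLabels_neg {α : ℂ} {z : ℂˣ} :
    (d, -z) ∈ loopLabels α ↔ (d, z) ∈ loopLabels (-α) := by
  have : ((-z : ℂˣ) : ℂ) + ((-z : ℂˣ) : ℂ)⁻¹ = α ↔ (z : ℂ) + (z : ℂ)⁻¹ = -α := by
    rw [Units.val_neg, inv_neg, ← neg_add, neg_eq_iff_eq_neg]
  simp only [loopLabels, Set.mem_ofPred_eq, this]

end Lists

/-! ### Classification of the standard modules over the quotients -/

section Classification

variable {n : ℕ} {β : ℂ}

theorem affineModules_uaTL [NeZero n] (γ : ℂ) :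
    affineModules n β (uaTLRel n β γ) = {s ∈ labels n | (s.2 : ℂ) ^ s.1 = γ} := by
  ext ⟨d, z⟩
  exact and_congr_right fun hs => (isAffineModule_uaTL_iff γ).trans (opOm_pow_n_eq_iff hs γ)

theorem labels_pos_of_odd (hn : Odd n) {s : Label} (hs : s ∈ labels n) : 0 < s.1 := by
  have h1 := hs.2
  unfold Nat.ModEq at h1
  have := Nat.odd_iff.1 hn
  omega

theorem labels_even (hn : Even n) {s : Label} (hs : s ∈ labels n) : Even s.1 := by
  have h1 := hs.2
  unfold Nat.ModEq at h1
  have := Nat.even_iff.1 hn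
  exact Nat.even_iff.2 (by omega)

theorem labels_add_two_le {s : Label} (hs : s ∈ labels n) (h : s.1 ≠ n) : s.1 + 2 ≤ n := by
  have h1 := hs.2
  have h2 := hs.1
  unfold Nat.ModEq at h1
  omega

theorem mem_labels_zero (hn : Even n) (z : ℂˣ) : ((0, z) : Label) ∈ labels n := by
  refine ⟨Nat.zero_le _, ?_⟩
  unfold Nat.ModEq
  have := Nat.even_iff.1 hn
  simp [this]

theorem mem_labels_full (z : ℂˣ) : ((n, z) : Label) ∈ labels n := ⟨le_rfl, rfl⟩

theorem periodicModules_upTL [NeZero n] (hn : Odd n) (γ : ℂ) :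
    periodicModules n β (upTLRel n β γ) =
      {s ∈ labels n | s.1 = n ∨ (s.2 : ℂ) ^ s.1 = γ ∨ (s.2 : ℂ) ^ s.1 = -γ} := by
  ext ⟨d, z⟩
  refine and_congr_right fun hs => (isPeriodicModule_upTL_iff γ).trans ?_
  by_cases hn3 : 3 ≤ n
  · simp only
    rw [unwind_actE_odd (by omega)]
    refine (smul_eq_smul_iff_eq_zero_or (M := Module.End ℂ (StdSpace n d))).trans ?_
    rw [actE_zero_eq_zero_iff hs hn3, sq_eq_sq_iff_eq_or_eq_neg]
  · have h0 := labels_pos_of_odd hn hs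
    have h1 : n = 1 := by obtain ⟨k, hk⟩ := hn; omega
    have h2 := hs.1
    have h3 : d = n := by simp only at h0 h2; omega
    have e : actE n d β z 0 = 0 := opE_of_one h1 _
    simp [e, h3]

theorem affineModules_uaTLa [NeZero n] (hn : Even n) (α : ℂ) :
    affineModules n β (uaTLaRel n β α) = loopLabels α ∪ degenerateLabels β ∪
      {s ∈ labels n | 0 < s.1 ∧ (s.2 : ℂ) ^ s.1 = 1} := by
  ext ⟨d, z⟩
  rw [affineModules, Set.mem_ofPred_eq, isAffineModule_uaTLa_iff]
  simp only [loopLabels, degenerateLabels, Set.mem_union, Set.mem_ofPred_eq]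
  have hu : ∀ hs : (d, z) ∈ labels n,
      opOm n d z ^ n = 1 ↔ (z : ℂ) ^ d = 1 := fun hs => by
    have := opOm_pow_n_eq_iff hs 1
    rwa [one_smul] at this
  rcases Nat.eq_zero_or_pos d with rfl | hd
  · have hs := mem_labels_zero hn z
    have hl := (smul_eq_smul_iff_eq_zero_or (M := Module.End ℂ (StdSpace n 0))
      (T := evenProd n (actE n 0 β z)) (a := (z : ℂ) + (z : ℂ)⁻¹) (b := α))
    rw [even_mul_opOm_mul_even hn, hl, evenProd_eq_zero_iff hn, hu hs]
    simp only [hs, pow_zero, lt_irrefl]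
    tauto
  · rw [evenProd_eq_zero_of_pos hn hd]
    have hd' := hd.ne'
    simp only [zero_mul, smul_zero, true_and, hd', hd, false_and, or_self, false_or]
    exact and_congr_right fun hs => hu hs

theorem affineModules_uaTLb [NeZero n] (hn : Even n) (γ : ℂ) :
    affineModules n β (uaTLbRel n β γ) = {s ∈ degenerateLabels β | γ = 1} ∪
      {s ∈ labels n | 0 < s.1 ∧ (s.2 : ℂ) ^ s.1 = γ} := by
  ext ⟨d, z⟩
  rw [affineModules, Set.mem_ofPred_eq, isAffineModule_uaTLb_iff]
  simp only [loopLabels, degenerateLabels, Set.mem_union, Set.mem_ofPred_eq]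
  rcases Nat.eq_zero_or_pos d with rfl | hd
  · have hs := mem_labels_zero hn z
    rw [evenProd_eq_zero_iff hn, opOm_pow_n_eq_iff hs]
    simp only [hs, pow_zero, lt_irrefl, eq_comm (a := (1 : ℂ))]
    tauto
  · rw [evenProd_eq_zero_of_pos hn hd]
    have hd' := hd.ne'
    simp only [true_and, hd', hd, false_and, false_or]
    exact and_congr_right fun hs => opOm_pow_n_eq_iff hs γ

theorem unwind_even_iff [NeZero n] (hn : Even n) {d : ℕ} {z : ℂˣ} (hs : (d, z) ∈ labels n)
    (hd : 0 < d) (γ : ℂ) :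
    actE n d β z 0 * descProd n (actE n d β z) n ^ ((n - 2) / 2) = γ • actE n d β z 0 ↔
      d = n ∨ (z : ℂ) ^ d = γ := by
  rw [unwind_actE_even hn]
  refine (smul_eq_smul_iff_eq_zero_or (M := Module.End ℂ (StdSpace n d))).trans ?_
  by_cases hn3 : 3 ≤ n
  · rw [actE_zero_eq_zero_iff hs hn3]
  · have h1 := labels_even hn hs
    have h2 := hs.1
    have h3 : d = n := by
      obtain ⟨k, hk⟩ := h1; simp only at hk h2; omega
    subst h3
    have e : actE d d β z 0 = 0 := opE_eq_zero_of_full _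
    simp [e]

theorem periodicModules_upTLa [NeZero n] (hn : Even n) (α : ℂ) :
    periodicModules n β (upTLaRel n β α) =
      loopLabels α ∪ loopLabels (-α) ∪ degenerateLabels β ∪
        {s ∈ labels n | s.1 = n ∨ (0 < s.1 ∧ (s.2 : ℂ) ^ s.1 = 1)} := by
  have h0 := (NeZero.ne n)
  ext ⟨d, z⟩
  rw [periodicModules, Set.mem_ofPred_eq, isPeriodicModule_upTLa_iff]
  simp only [loopLabels, degenerateLabels, Set.mem_union, Set.mem_ofPred_eq]
  rcases Nat.eq_zero_or_pos d with rfl | hd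
  · have hs := mem_labels_zero hn z
    have hl := (smul_eq_smul_iff_eq_zero_or (M := Module.End ℂ (StdSpace n 0))
      (T := evenProd n (actE n 0 β z)) (a := ((z : ℂ) + (z : ℂ)⁻¹) ^ 2) (b := α ^ 2))
    rw [even_mul_odd_mul_even hn, hl, evenProd_eq_zero_iff hn, unwind_actE_even hn,
      sq_eq_sq_iff_eq_or_eq_neg]
    simp only [hs, pow_zero, lt_irrefl, one_smul, h0.symm]
    tauto
  · rw [evenProd_eq_zero_of_pos hn hd]
    have hd' := hd.ne'
    simp only [zero_mul, smul_zero, true_and, hd', hd, false_and, or_self, false_or]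
    refine and_congr_right fun hs => ?_
    have := unwind_even_iff (β := β) hn hs hd 1
    rwa [one_smul] at this

theorem periodicModules_upTLb [NeZero n] (hn : Even n) (γ : ℂ) :
    periodicModules n β (upTLbRel n β γ) = {s ∈ degenerateLabels β | γ = 1 ∨ n = 2} ∪
      {s ∈ labels n | s.1 = n ∨ (0 < s.1 ∧ (s.2 : ℂ) ^ s.1 = γ)} := by
  have h0 := (NeZero.ne n)
  ext ⟨d, z⟩
  rw [periodicModules, Set.mem_ofPred_eq, isPeriodicModule_upTLb_iff]
  simp only [loopLabels, degenerateLabels, Set.mem_union, Set.mem_ofPred_eq]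
  rcases Nat.eq_zero_or_pos d with rfl | hd
  · have hs := mem_labels_zero hn z
    simp only [hs, lt_irrefl, h0.symm, true_and, false_and, or_self, and_false,
      or_false]
    rw [evenProd_eq_zero_iff hn, unwind_actE_even hn, pow_zero]
    have hu : β = 0 ∧ (z : ℂ) + (z : ℂ)⁻¹ = 0 →
        ((1 : ℂ) • actE n 0 β z 0 = γ • actE n 0 β z 0 ↔ γ = 1 ∨ n = 2) := by
      intro hloop
      refine (smul_eq_smul_iff_eq_zero_or (M := Module.End ℂ (StdSpace n 0))).trans ?_
      rw [eq_comm (a := (1 : ℂ)), or_comm]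
      by_cases hn3 : 3 ≤ n
      · rw [actE_zero_eq_zero_iff hs hn3]
        have : n ≠ 2 := by omega
        simp [this, h0.symm]
      · have h2 : n = 2 := by obtain ⟨k, hk⟩ := hn; omega
        subst h2
        have := (evenProd_eq_zero_iff (β := β) (z := z) hn).2 hloop
        rw [evenProd_two] at this
        simp [this]
    constructor
    · rintro ⟨h1, h2⟩; exact ⟨⟨h1.2, h1.1⟩, (hu h1).1 h2⟩
    · rintro ⟨⟨h1, h2⟩, h3⟩; exact ⟨⟨h2, h1⟩, (hu ⟨h2, h1⟩).2 h3⟩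
  · rw [evenProd_eq_zero_of_pos hn hd]
    have hd' := hd.ne'
    simp only [true_and, hd', hd, false_and, false_or]
    exact and_congr_right fun hs => unwind_even_iff (β := β) hn hs hd γ

/-- A common form of the three lists up to sign: besides labels without defects, the list `L`
contains `(n, 1)`, and for other `d` exactly one of each pair `z`, `-z`. -/
theorem isListUpToSign_of [NeZero n] {S L : Set Label} (hS : S ⊆ labels n) (hLS : L ⊆ S)
    (hfull : (n, 1) ∈ L) (hfull' : ∀ z, (n, z) ∈ L → z = 1)
    (hex : ∀ d z, (d, z) ∈ S → d ≠ n → (d, z) ∈ L ∨ (d, -z) ∈ L)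
    (hirr : ∀ d z, d ≠ n → 0 < d → (d, z) ∈ L → (d, -z) ∉ L) : IsListUpToSign n β S L where
  subset := hLS
  exists_iso := by
    rintro ⟨d, z⟩ hs
    by_cases hd : d = n
    · subst hd
      exact ⟨(d, 1), hfull, rfl, Or.inr (Or.inr rfl), periodicIso_full z 1⟩
    · rcases hex d z hs hd with h | h
      · exact ⟨(d, z), h, rfl, Or.inl rfl, periodicIso_refl _⟩
      · exact ⟨(d, -z), h, rfl, Or.inr (Or.inl rfl), periodicIso_neg d z⟩
  irredundant := by
    rintro ⟨d, z⟩ h1 hd h2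
    by_cases hdn : d = n
    · subst hdn
      have e1 := hfull' z h1
      have e2 := hfull' (-z) h2
      rw [e1] at e2
      have : (-1 : ℂ) = 1 := by simpa using congrArg Units.val e2
      norm_num at this
    · exact hirr d z hdn hd h1 h2

theorem mem_periodicListOdd {d : ℕ} {z : ℂˣ} {ν : ℕ → ℂ} (hd : d ≠ n) :
    (d, z) ∈ periodicListOdd n ν ↔ 1 ≤ d ∧ d + 2 ≤ n ∧ d ≡ n [MOD 2] ∧
      ∃ r : ℕ, r < d ∧ (z : ℂ) = ν d * Complex.exp (Real.pi * Complex.I * r / d) := by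
  simp [periodicListOdd, hd]

theorem mem_periodicListEven {d : ℕ} {z : ℂˣ} {ν : ℕ → ℂ} (hd : d ≠ n) :
    (d, z) ∈ periodicListEven n ν ↔ 1 ≤ d ∧ d + 2 ≤ n ∧ d ≡ n [MOD 2] ∧
      ∃ r : ℕ, 2 * r < d ∧ (z : ℂ) = ν d * Complex.exp (2 * Real.pi * Complex.I * r / d) := by
  simp [periodicListEven, hd]

theorem not_exp_of_neg {d a b : ℕ} {z : ℂˣ} {ν : ℂ} (ha : a < d) (hb : b < d)
    (h1 : (z : ℂ) = ν * Complex.exp (Real.pi * Complex.I * a / d))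
    (h2 : ((-z : ℂˣ) : ℂ) = ν * Complex.exp (Real.pi * Complex.I * b / d)) : False := by
  have hν : ν ≠ 0 := by rintro rfl; simp at h1
  refine exp_eq_neg_exp (d := d) (a := a) (b := b) (by omega) (by omega) (by omega) ?_
  apply mul_left_cancel₀ hν
  rw [mul_neg, ← h1, ← h2, Units.val_neg, neg_neg]

theorem isListUpToSign_upTL [NeZero n] (hn : Odd n) {γ : ℂ} {ν : ℕ → ℂ}
    (hν : ∀ d : ℕ, 1 ≤ d → ν d ^ d = γ) :
    IsListUpToSign n β {s ∈ labels n | s.1 = n ∨ (s.2 : ℂ) ^ s.1 = γ ∨ (s.2 : ℂ) ^ s.1 = -γ}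
      (periodicListOdd n ν) := by
  refine isListUpToSign_of (fun s hs => hs.1) ?_ (Or.inl rfl) ?_ ?_ ?_
  · rintro ⟨d, z⟩ h
    by_cases hd : d = n
    · subst hd; exact ⟨mem_labels_full z, Or.inl rfl⟩
    · rw [mem_periodicListOdd hd] at h
      obtain ⟨h1, h2, h3, r, hr, e⟩ := h
      refine ⟨⟨by simp only; omega, h3⟩, Or.inr ?_⟩
      have hd0 : (d : ℂ) ≠ 0 := by exact_mod_cast (by omega : d ≠ 0)
      have : (z : ℂ) ^ d = γ * (-1) ^ r := by
        rw [e, mul_pow, hν d h1, ← Complex.exp_nat_mul, ← Complex.exp_pi_mul_I,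
          ← Complex.exp_nat_mul]
        congr 2; field_simp
      simp only [this]
      rcases neg_one_pow_eq_or ℂ r with h | h <;> simp [h]
  · rintro z (h | h)
    · exact (Prod.ext_iff.1 h).2
    · have := h.2.1; simp at this
  · intro d z hs hd
    have h0 := labels_pos_of_odd hn hs.1
    have h1 := labels_add_two_le hs.1 hd
    have h2 : Odd d := by
      have h1 := hs.1.2
      unfold Nat.ModEq at h1
      exact Nat.odd_iff.2 (h1.trans (Nat.odd_iff.1 hn))
    rw [mem_periodicListOdd hd, mem_periodicListOdd hd]
    obtain ⟨r, hr, h | h⟩ := exists_exp_of_odd h2 (hν d h0) z.ne_zero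
      (hs.2.resolve_left hd)
    · exact Or.inl ⟨h0, h1, hs.1.2, r, hr, h⟩
    · exact Or.inr ⟨h0, h1, hs.1.2, r, hr, by rw [Units.val_neg, h]⟩
  · intro d z hd _ h1 h2
    rw [mem_periodicListOdd hd] at h1 h2
    obtain ⟨-, -, -, r, hr, e⟩ := h1
    obtain ⟨-, -, -, r', hr', e'⟩ := h2
    exact not_exp_of_neg hr hr' e e'

/-- The lists up to sign for even `n`; the sets `D` and `D'` consist of labels without defects. -/
theorem isListUpToSign_even [NeZero n] (hn : Even n) {γ : ℂ} {ν : ℕ → ℂ}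
    (hν : ∀ d : ℕ, 1 ≤ d → ν d ^ d = γ) {D D' : Set Label} (hD : ∀ s ∈ D, s.1 = 0)
    (hsub : D' ⊆ D) (hD' : ∀ z, (0, z) ∈ D → (0, z) ∈ D' ∨ (0, -z) ∈ D') :
    IsListUpToSign n β
      (D ∪ {s ∈ labels n | s.1 = n ∨ (0 < s.1 ∧ (s.2 : ℂ) ^ s.1 = γ)})
      (D' ∪ periodicListEven n ν) := by
  have h0 := NeZero.pos n
  refine isListUpToSign_of ?_ ?_ (Or.inr (Or.inl rfl)) ?_ ?_ ?_
  · rintro ⟨d, z⟩ (h | h)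
    · obtain rfl : d = 0 := hD _ h
      exact mem_labels_zero hn z
    · exact h.1
  · rintro ⟨d, z⟩ (h | h)
    · exact Or.inl (hsub h)
    · right
      by_cases hd : d = n
      · subst hd; exact ⟨mem_labels_full z, Or.inl rfl⟩
      · rw [mem_periodicListEven hd] at h
        obtain ⟨h1, h2, h3, r, hr, e⟩ := h
        exact ⟨⟨by simp only; omega, h3⟩, Or.inr ⟨h1,
          (pow_eq_iff_exists_exp h1 (hν d h1) z.ne_zero).2 ⟨r, by omega, e⟩⟩⟩
  · rintro z (h | h | h)
    · exact absurd (hD _ (hsub h)) h0.ne'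
    · exact (Prod.ext_iff.1 h).2
    · have := h.2.1; simp at this
  · rintro d z (hs | hs) hd
    · obtain rfl : d = 0 := hD _ hs
      exact (hD' z hs).imp Or.inl Or.inl
    · have h1 := labels_add_two_le hs.1 hd
      obtain ⟨h2, h3⟩ := hs.2.resolve_left hd
      simp only [Set.mem_union, mem_periodicListEven hd]
      obtain ⟨r, hr, h | h⟩ := exists_exp_of_even (labels_even hn hs.1) h2 (hν d h2) z.ne_zero h3
      · exact Or.inl (Or.inr ⟨h2, h1, hs.1.2, r, hr, h⟩)
      · exact Or.inr (Or.inr ⟨h2, h1, hs.1.2, r, hr, by rw [Units.val_neg, h]⟩)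
  · intro d z hd hd0 h1 h2
    have hl : ∀ z : ℂˣ, (d, z) ∈ D' ∪ periodicListEven n ν → (d, z) ∈ periodicListEven n ν :=
      fun z h => h.resolve_left fun hc => hd0.ne' (hD _ (hsub hc))
    have h1 := hl _ h1
    have h2 := hl _ h2
    rw [mem_periodicListEven hd] at h1 h2
    obtain ⟨-, -, -, r, hr, e⟩ := h1
    obtain ⟨-, -, -, r', hr', e'⟩ := h2
    rw [exp_double] at e e'
    exact not_exp_of_neg hr hr' e e'

end Classification

end AffineTL

theorem mainTheorem6 (n : ℕ) [NeZero n] (β : ℂ) :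
    -- the standard modules are modules over the affine algebra
    (∀ s ∈ AffineTL.labels n, AffineTL.IsAffineModule n β (AffineTL.aTLRel n β) s) ∧
    -- the two algebras for odd n
    (Odd n → ∀ (γ : ℂ) (ν : ℕ → ℂ), (∀ d : ℕ, 1 ≤ d → ν d ^ d = γ) →
      (AffineTL.affineModules n β (AffineTL.uaTLRel n β γ) =
          {s ∈ AffineTL.labels n | (s.2 : ℂ) ^ s.1 = γ} ∧
        AffineTL.affineModules n β (AffineTL.uaTLRel n β γ) = AffineTL.affineList n ν) ∧
      (AffineTL.periodicModules n β (AffineTL.upTLRel n β γ) =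
          {s ∈ AffineTL.labels n |
            s.1 = n ∨ (s.2 : ℂ) ^ s.1 = γ ∨ (s.2 : ℂ) ^ s.1 = -γ} ∧
        AffineTL.IsListUpToSign n β (AffineTL.periodicModules n β (AffineTL.upTLRel n β γ))
          (AffineTL.periodicListOdd n ν))) ∧
    -- the two algebras of the first type for even n
    (Even n → ∀ α : ℂ,
      (AffineTL.affineModules n β (AffineTL.uaTLaRel n β α) =
          AffineTL.loopLabels α ∪ AffineTL.degenerateLabels β ∪
            {s ∈ AffineTL.labels n | 0 < s.1 ∧ (s.2 : ℂ) ^ s.1 = 1} ∧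
        AffineTL.affineModules n β (AffineTL.uaTLaRel n β α) =
          AffineTL.loopLabels α ∪ AffineTL.degenerateLabels β ∪
            AffineTL.affineList n (fun _ => 1)) ∧
      (AffineTL.periodicModules n β (AffineTL.upTLaRel n β α) =
          AffineTL.loopLabels α ∪ AffineTL.loopLabels (-α) ∪ AffineTL.degenerateLabels β ∪
            {s ∈ AffineTL.labels n | s.1 = n ∨ (0 < s.1 ∧ (s.2 : ℂ) ^ s.1 = 1)} ∧
        AffineTL.IsListUpToSign n β (AffineTL.periodicModules n β (AffineTL.upTLaRel n β α))
          (AffineTL.loopLabels α ∪ AffineTL.degenerateLabels β ∪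
            AffineTL.periodicListEven n (fun _ => 1)))) ∧
    -- the two algebras of the second type for even n
    (Even n → ∀ (γ : ℂ) (ν : ℕ → ℂ), (∀ d : ℕ, 1 ≤ d → ν d ^ d = γ) →
      (AffineTL.affineModules n β (AffineTL.uaTLbRel n β γ) =
          {s ∈ AffineTL.degenerateLabels β | γ = 1} ∪
            {s ∈ AffineTL.labels n | 0 < s.1 ∧ (s.2 : ℂ) ^ s.1 = γ} ∧
        AffineTL.affineModules n β (AffineTL.uaTLbRel n β γ) =
          {s ∈ AffineTL.degenerateLabels β | γ = 1} ∪ AffineTL.affineList n ν) ∧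
      (AffineTL.periodicModules n β (AffineTL.upTLbRel n β γ) =
          {s ∈ AffineTL.degenerateLabels β | γ = 1 ∨ n = 2} ∪
            {s ∈ AffineTL.labels n | s.1 = n ∨ (0 < s.1 ∧ (s.2 : ℂ) ^ s.1 = γ)} ∧
        AffineTL.IsListUpToSign n β (AffineTL.periodicModules n β (AffineTL.upTLbRel n β γ))
          ({s ∈ AffineTL.degenerateLabels β | γ = 1 ∨ n = 2} ∪
            AffineTL.periodicListEven n ν))) := by
  refine ⟨fun s _ => AffineTL.isAffineModule_aTL s, fun hn γ ν hν => ⟨⟨?_, ?_⟩, ?_, ?_⟩,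
    fun hn α => ⟨⟨?_, ?_⟩, ?_, ?_⟩, fun hn γ ν hν => ⟨⟨?_, ?_⟩, ?_, ?_⟩⟩
  · exact AffineTL.affineModules_uaTL γ
  · rw [AffineTL.affineModules_uaTL, AffineTL.affineList_eq hν]
    ext s
    exact and_congr_right fun hs =>
      ⟨fun h => ⟨AffineTL.labels_pos_of_odd hn hs, h⟩, fun h => h.2⟩
  · exact AffineTL.periodicModules_upTL hn γ
  · rw [AffineTL.periodicModules_upTL hn]
    exact AffineTL.isListUpToSign_upTL hn hν
  · exact AffineTL.affineModules_uaTLa hn α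
  · rw [AffineTL.affineModules_uaTLa hn, AffineTL.affineList_eq fun d _ => one_pow d]
  · exact AffineTL.periodicModules_upTLa hn α
  · rw [AffineTL.periodicModules_upTLa hn]
    refine AffineTL.isListUpToSign_even hn (fun d _ => one_pow d) ?_ ?_ ?_
    · rintro s ((h | h) | h)
      exacts [h.1, h.1, h.1.1]
    · rintro s (h | h)
      exacts [Or.inl (Or.inl h), Or.inr h]
    · rintro z ((h | h) | h)
      exacts [Or.inl (Or.inl h), Or.inr (Or.inl (AffineTL.mem_loopLabels_neg.2 h)),
        Or.inl (Or.inr h)]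
  · exact AffineTL.affineModules_uaTLb hn γ
  · rw [AffineTL.affineModules_uaTLb hn, AffineTL.affineList_eq hν]
  · exact AffineTL.periodicModules_upTLb hn γ
  · rw [AffineTL.periodicModules_upTLb hn]
    exact AffineTL.isListUpToSign_even hn hν (fun s h => h.1.1.1) subset_rfl fun z h => Or.inl h
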